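/- Let $\mathrm{Ai}$ be the Airy function and let $u_3(x,t)=(3t)^{-1/3}\,\mathrm{Ai}\big(x/(3t)^{1/3}\big)$, $x\in\mathbb R$, $t>0$, be the fundamental solution of $\partial_t u=-\partial_x^3u$, $u(x,0)=\delta(x)$, that is, the (sign-varying) density of the third-order pseudo-process $X_3(t)$. Let $n\ge 1$, and let $T^1_{1/3},\dots,T^n_{1/3}$ be independent, measurable random functions of time such that, for every $t>0$, $T^j_{1/3}(t)$ is the positively skewed $\tfrac13$-stable random variable with density $\frac ts\,(3s)^{-1/3}\,\mathrm{Ai}\big(t/(3s)^{1/3}\big)$ in $s>0$. For $t>0$ put $S_n(t)=T^1_{1/3}(T^2_{1/3}(\dots(T^n_{1/3}(t))\dots))$ and let $Z_n(t)=X_3(S_n(t))$ be the composition, whose density at $x$ is $E[u_3(x,S_n(t))]$. Then this expectation converges absolutely for every $x\in\mathbb R$ and defines a strictly positive probability density, so that $Z_n(t)$ is a genuine random variable spread on the whole line, with characteristic function, for $\beta\in\mathbb R$, $$E e^{i\beta Z_n(t)}=\exp\Big[-t|\beta|^{\frac1{3^{n-1}}}\Big(\cos\tfrac{\pi}{2\cdot3^n}+i\,\mathrm{sgn}(\beta)\sin\tfrac{\pi}{2\cdot3^n}\Big)\Big]=\exp\Big[-t|\beta|^{\frac1{3^{n-1}}}\cos\tfrac{\pi}{2\cdot3^n}\Big(1+i\,\mathrm{sgn}(\beta)\tan\tfrac{\pi}{2\cdot3^n}\Big)\Big].$$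 Hence $Z_n(t)$ is a stable random variable of index $\alpha=3^{1-n}$, and its law is not symmetric about $0$. If $n\ge2$, then, in the parametrization $\exp\big[-c|\beta|^\alpha\big(1-i\,\theta\,\mathrm{sgn}(\beta)\tan\frac{\pi\alpha}2\big)\big]$ of stable laws, it has scale $c=t\cos\frac{\pi}{2\cdot3^n}$ and skewness $$\theta=-\frac{\tan\frac{\pi}{2\cdot3^n}}{\tan\frac{\pi}{2\cdot3^{n-1}}}\in(-1,0).$$ If $n=1$, then $Z_1(t)$ has the Cauchy law with characteristic function $\exp\big[-\frac{\sqrt3}2t|\beta|-i\frac t2\beta\big]$, that is, $\alpha=1$, skewness $0$, scale $\frac{\sqrt3}2t$ and location $-\frac t2$. -/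

import Mathlib

open MeasureTheory ProbabilityTheory Filter Topology

/-- The Airy function `Ai` on the real line, through its everywhere convergent power series
`Ai(w) = (3^{-2/3}/π) ∑_{k ≥ 0} (3^{1/3} w)^k (sin (2π(k+1)/3) / k!) Γ((k+1)/3)`. -/
noncomputable def airyAi (w : ℝ) : ℝ :=
  (3 : ℝ) ^ (-(2 / 3) : ℝ) / Real.pi *
    ∑' k : ℕ, ((3 : ℝ) ^ (1 / 3 : ℝ) * w) ^ k *
      (Real.sin (2 * Real.pi * ((k : ℝ) + 1) / 3) / (Nat.factorial k : ℝ)) *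
      Real.Gamma (((k : ℝ) + 1) / 3)

/-- The (sign-varying) density at `x` of the third-order pseudo-process `X₃` at time `t > 0`:
`u₃(x,t) = (3t)^{-1/3} Ai(x / (3t)^{1/3})`. -/
noncomputable def thirdOrderKernel (x t : ℝ) : ℝ :=
  1 / (3 * t) ^ (1 / 3 : ℝ) * airyAi (x / (3 * t) ^ (1 / 3 : ℝ))

/-- `u` solves `∂u/∂t = - ∂³u/∂x³` for `x ∈ ℝ`, `t > 0`, with initial datum `u(x,0) = δ(x)`,
attained in the sense of distributions as `t ↓ 0`. -/
structure IsThirdOrderFundamentalSolution (u : ℝ → ℝ → ℝ) : Prop where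
  contDiff : ∀ t : ℝ, 0 < t → ContDiff ℝ 3 (fun x => u x t)
  equation : ∀ t : ℝ, 0 < t → ∀ x : ℝ,
    HasDerivAt (fun s => u x s) (-(iteratedDeriv 3 (fun y => u y t) x)) t
  initial : ∀ φ : ℝ → ℝ, ContDiff ℝ ((⊤ : ℕ∞) : WithTop ℕ∞) φ → HasCompactSupport φ →
    Tendsto (fun t => ∫ x, φ x * u x t) (𝓝[>] 0) (𝓝 (φ 0))

/-- The density in `s > 0` of the positively skewed stable variable `T_{1/3}(t)`:
`(t/s) (3s)^{-1/3} Ai(t / (3s)^{1/3})`. -/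
noncomputable def stableThirdDensity (t s : ℝ) : ℝ :=
  t / s * (1 / (3 * s) ^ (1 / 3 : ℝ)) * airyAi (t / (3 * s) ^ (1 / 3 : ℝ))

/-- `T 0, …, T (n-1)` are independent random functions of time, and `T j t` has the law with
density `stableThirdDensity t` on `(0,∞)` for every `t > 0`.

Each `T j` is jointly measurable in time and in `ω`, where only events of the σ-algebra `m j`
generated by `T j` (or of a larger one) matter, and the `m j` are independent.  This makes
`T j` evaluated at an independent random time meaningful; it holds for independent families
with right-continuous paths, and for `T j t = t ^ 3 * τ j` with independent `τ j`. -/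
structure IsIndepStableThirdFamily {Ω : Type*} [MeasurableSpace Ω] (P : Measure Ω) {n : ℕ}
    (T : Fin n → ℝ → Ω → ℝ) : Prop where
  indep : ∃ m : Fin n → MeasurableSpace Ω,
    (∀ j, m j ≤ ‹MeasurableSpace Ω›) ∧ iIndep m P ∧
    ∀ j, @Measurable (ℝ × Ω) ℝ (@Prod.instMeasurableSpace ℝ Ω (borel ℝ) (m j)) (borel ℝ)
      (fun p => T j p.1 p.2)
  law : ∀ j, ∀ t : ℝ, 0 < t → P.map (T j t) =
    (volume.restrict (Set.Ioi 0)).withDensity (fun s => ENNReal.ofReal (stableThirdDensity t s))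

/-- The iterated random time `T 0 (T 1 (… (T (n-1) t) …))`. -/
def iteratedTime {Ω : Type*} {n : ℕ} (T : Fin n → ℝ → Ω → ℝ) (t : ℝ) (ω : Ω) : ℝ :=
  Fin.foldr n (fun j s => T j s ω) t

/-- The density at `x` of the composition `X₃(S)` of the pseudo-process with an independent
positive random time `S`, that is `E[u₃(x, S)]`. -/
noncomputable def composedDensity {Ω : Type*} [MeasurableSpace Ω] (P : Measure Ω)
    (S : Ω → ℝ) (x : ℝ) : ℝ :=
  ∫ ω, thirdOrderKernel x (S ω) ∂P

/-- The law of `X₃(S)` when its density is nonnegative. -/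
noncomputable def composedLaw {Ω : Type*} [MeasurableSpace Ω] (P : Measure Ω)
    (S : Ω → ℝ) : Measure ℝ :=
  volume.withDensity (fun x => ENNReal.ofReal (composedDensity P S x))

/-- `ν` is a non-degenerate stable law of index `α`: for independent `X, Y` with law `ν` and
`a, b > 0`, the variable `a X + b Y` has the law of `(a^α + b^α)^{1/α} X + d` for some `d`. -/
def IsStableOfIndex (ν : Measure ℝ) (α : ℝ) : Prop :=
  IsProbabilityMeasure ν ∧ (∀ x : ℝ, ν ≠ Measure.dirac x) ∧
    ∀ a b : ℝ, 0 < a → 0 < b → ∃ d : ℝ,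
      Measure.conv (ν.map (fun x => a * x)) (ν.map (fun x => b * x)) =
        ν.map (fun x => (a ^ α + b ^ α) ^ (1 / α) * x + d)

/-- `ν` is the stable law with index `α ∈ (0,2]`, scale `c > 0`, skewness `θ ∈ [-1,1]` and
location `δ`: its characteristic function at `β` is
`exp(-c |β|^α (1 - i θ sgn β tan (π α / 2)) + i δ β)` if `α ≠ 1`, and
`exp(-c |β| (1 + i θ (2/π) sgn β log |β|) + i δ β)` if `α = 1`. -/
structure HasStableParameters (ν : Measure ℝ) (α c θ δ : ℝ) : Prop where
  isProbabilityMeasure : IsProbabilityMeasure ν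
  index_mem : α ∈ Set.Ioc (0 : ℝ) 2
  scale_pos : 0 < c
  skewness_mem : θ ∈ Set.Icc (-1 : ℝ) 1
  charFun_of_ne_one : α ≠ 1 → ∀ β : ℝ, charFun ν β = Complex.exp
    (-((c * |β| ^ α : ℝ) : ℂ) *
        (1 - Complex.I * ((θ * Real.sign β * Real.tan (Real.pi * α / 2) : ℝ) : ℂ)) +
      Complex.I * ((δ * β : ℝ) : ℂ))
  charFun_of_eq_one : α = 1 → ∀ β : ℝ, charFun ν β = Complex.exp
    (-((c * |β| : ℝ) : ℂ) *
        (1 + Complex.I * ((θ * (2 / Real.pi) * Real.sign β * Real.log |β| : ℝ) : ℂ)) +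
      Complex.I * ((δ * β : ℝ) : ℂ))

/-- The number `tan(π/(2·3ⁿ)) / tan(π/(2·3ⁿ⁻¹))`, meant for `n ≥ 2`. -/
noncomputable def asymmetryRatio (n : ℕ) : ℝ :=
  Real.tan (Real.pi / (2 * 3 ^ n)) / Real.tan (Real.pi / (2 * 3 ^ (n - 1)))

/-! Write `p_r` for the density of `T_{1/3}(r)`. Given that the inner times have produced the value
`r`, the outermost stable time gives `X₃` the density `∫ u₃(x,s) p_r(s) ds`. With `a = (3s)^{-1/3}`
this is `3r ∫ a Ai(xa) Ai(ra) da`. Because `Ai'' = w Ai`, the integrand has a primitive of Wronskian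
type, and the integral is the Cauchy density `√3 r / (2π(x² + xr + r²))`
(`integral_kernel_mul_stableThirdDensity`). One stable layer thus removes the sign changes: the
density of `Z_n(t)` is a mixture of Cauchy densities over the remaining `(n-1)`-fold iterated time
(`composedDensity_eq`).

The Cauchy characteristic function is `exp(-κr)` with `κ = |β| e^{iπ sgn(β)/6}`, so that of `Z_n(t)`
is the Laplace transform of the remaining time at the complex point `κ`. Each stable layer replaces
`e^l` by `e^{l/3}` (`timeLaplace_stableThirdDensity`). Indeed `p_r` is three times the second space
derivative of `u₃` at `x = r`, and the Laplace transform in time of `u₃` at `κ³` is a bounded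
solution of `U''' = -κ³U` on `x > 0`, hence a multiple of `e^{-κx}`. After `n-1` layers the modulus
is `|β|^{3^{1-n}}` and the angle `π/(2·3ⁿ)`. Stability, asymmetry and the parameters are read off
this formula.

Absolute convergence follows from `|u₃(x,s)| ≤ C (3s)^{-1/3}` and the finiteness of the moment of
order `-1/3`, which comes from the Laplace transform on the positive axis
(`integrable_airyScale_iteratedTime`).

For the initial datum of `u₃` the one nontrivial constant is the total mass of `Ai`; it is obtained
from the Cauchy identity as `r → 0` (`airyPrimitive_limit_sub_eq_one`). The facts on `Ai` itself
come from its contour integral (`airyAi_eq_im`), Airy's equation, and monotonicity and energy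
arguments. -/

/-! ### The Airy function as a contour integral -/

/-- The direction `e^{iπ/3}` of the contour. -/
noncomputable def airyDir : ℂ := ⟨1 / 2, Real.sqrt 3 / 2⟩

/-- The moments `∫₀^∞ r^k exp(-r³/3 - w r e^{iπ/3}) dr`. -/
noncomputable def airyMoment (k : ℕ) (w : ℝ) : ℂ :=
  ∫ r in Set.Ioi (0 : ℝ), (r : ℂ) ^ k * Complex.exp (-((r ^ 3 / 3 : ℝ) : ℂ) - w * r * airyDir)

lemma sqrt_three_sq : Real.sqrt 3 * Real.sqrt 3 = 3 := Real.mul_self_sqrt (by norm_num)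

lemma airyDir_sq : airyDir ^ 2 = airyDir - 1 := by
  have := sqrt_three_sq
  apply Complex.ext
  · simp [airyDir, pow_two]; linarith
  · simp [airyDir, pow_two]; ring

lemma airyDir_cube : airyDir ^ 3 = -1 := by
  rw [pow_succ, airyDir_sq, sub_mul, ← pow_two, airyDir_sq]; ring

lemma airyDir_eq_exp : airyDir = Complex.exp ((Real.pi / 3 : ℝ) * Complex.I) := by
  rw [Complex.exp_mul_I, ← Complex.ofReal_cos, ← Complex.ofReal_sin, Real.cos_pi_div_three,
    Real.sin_pi_div_three]
  apply Complex.ext <;> simp [airyDir]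

lemma norm_airyDir : ‖airyDir‖ = 1 := by
  rw [airyDir_eq_exp, Complex.norm_exp_ofReal_mul_I]

/-- `r^k exp(M r - r³/3)` is integrable on the half-line. -/
lemma integrableOn_pow_mul_exp_cubic (k : ℕ) (M : ℝ) :
    IntegrableOn (fun r : ℝ => r ^ k * Real.exp (M * r - r ^ 3 / 3)) (Set.Ioi 0) := by
  -- Tangent-line bound: `r³ - 3m²r + 2m³ = (r-m)²(r+2m) ≥ 0`. The choice `m² = |M| + 1` gives `M r
  -- - r³/3 ≤ 2m³/3 - r`, leaving a factor `e^{-r}`.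
  set m : ℝ := Real.sqrt (|M| + 1)
  have hm : m ^ 2 = |M| + 1 := Real.sq_sqrt (by positivity)
  have hm0 : 0 ≤ m := Real.sqrt_nonneg _
  have h := integrableOn_rpow_mul_exp_neg_mul_rpow (p := 1) (s := k) (b := 1)
    (by have : (0 : ℝ) ≤ k := Nat.cast_nonneg k
        linarith) one_pos one_pos
  refine (h.const_mul (Real.exp (2 / 3 * m ^ 3))).mono' (by fun_prop) ?_
  refine (ae_restrict_iff' measurableSet_Ioi).2 (ae_of_all _ fun r hr => ?_)
  have hr0 : (0 : ℝ) < r := hr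
  rw [Real.norm_of_nonneg (by positivity), Real.rpow_natCast, Real.rpow_one, mul_left_comm,
    ← Real.exp_add]
  gcongr
  have h1 : 0 ≤ (r - m) ^ 2 * (r + 2 * m) := by positivity
  have h2 : M * r ≤ |M| * r := by gcongr; exact le_abs_self M
  nlinarith

lemma norm_airyIntegrand (k : ℕ) (w : ℝ) {r : ℝ} (hr : 0 ≤ r) :
    ‖(r : ℂ) ^ k * Complex.exp (-((r ^ 3 / 3 : ℝ) : ℂ) - w * r * airyDir)‖ =
      r ^ k * Real.exp (-(w / 2) * r - r ^ 3 / 3) := by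
  rw [norm_mul, norm_pow, Complex.norm_real, Real.norm_of_nonneg hr, Complex.norm_exp]
  congr 2
  have : ((w : ℂ) * r * airyDir).re = w * r / 2 := by
    rw [← Complex.ofReal_mul, Complex.re_ofReal_mul]; simp [airyDir]; ring
  rw [Complex.sub_re, this, Complex.neg_re, Complex.ofReal_re]; ring

lemma integrable_airyIntegrand (k : ℕ) (w : ℝ) :
    IntegrableOn (fun r : ℝ => (r : ℂ) ^ k *
      Complex.exp (-((r ^ 3 / 3 : ℝ) : ℂ) - w * r * airyDir)) (Set.Ioi 0) := by
  refine (integrableOn_pow_mul_exp_cubic k (-(w / 2))).mono' (by fun_prop) ?_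
  refine (ae_restrict_iff' measurableSet_Ioi).2 (ae_of_all _ fun r hr => ?_)
  exact (norm_airyIntegrand k w (le_of_lt hr)).le

lemma hasDerivAt_airyMoment (k : ℕ) (w : ℝ) :
    HasDerivAt (airyMoment k) (-airyDir * airyMoment (k + 1) w) w := by
  have key := hasDerivAt_integral_of_dominated_loc_of_deriv_le
    (μ := volume.restrict (Set.Ioi (0 : ℝ))) (x₀ := w) (s := Metric.ball w 1)
    (F := fun (w : ℝ) (r : ℝ) => (r : ℂ) ^ k *
      Complex.exp (-((r ^ 3 / 3 : ℝ) : ℂ) - w * r * airyDir))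
    (F' := fun (w : ℝ) (r : ℝ) => -airyDir * ((r : ℂ) ^ (k + 1) *
      Complex.exp (-((r ^ 3 / 3 : ℝ) : ℂ) - w * r * airyDir)))
    (bound := fun r => r ^ (k + 1) * Real.exp ((|w| + 1) * r - r ^ 3 / 3))
    (Metric.ball_mem_nhds w one_pos)
    (Eventually.of_forall fun v => (integrable_airyIntegrand k v).aestronglyMeasurable)
    (integrable_airyIntegrand k w)
    ((integrable_airyIntegrand (k + 1) w).const_mul _).aestronglyMeasurable
    ?_ (integrableOn_pow_mul_exp_cubic (k + 1) (|w| + 1)) ?_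
  · have h2 := key.2
    rw [integral_const_mul] at h2
    exact h2
  · refine (ae_restrict_iff' measurableSet_Ioi).2 (ae_of_all _ fun r hr v hv => ?_)
    have hr0 : (0 : ℝ) < r := hr
    rw [norm_mul, norm_neg, norm_airyDir, one_mul, norm_airyIntegrand _ _ hr0.le]
    have hv1 : |v - w| < 1 := by simpa [Real.dist_eq] using hv
    have : -(v / 2) ≤ |w| + 1 := by
      have := abs_lt.1 hv1
      have := neg_abs_le w
      have := abs_nonneg w
      linarith
    gcongr
  · refine ae_of_all _ fun r v _ => ?_
    have h1 : HasDerivAt (fun v : ℝ => -((r ^ 3 / 3 : ℝ) : ℂ) - v * r * airyDir)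
        (-(r * airyDir)) v := by
      have h := ((Complex.ofRealCLM.hasDerivAt (x := v)).mul_const ((r : ℂ) * airyDir)).const_sub
        (-((r ^ 3 / 3 : ℝ) : ℂ))
      simpa [mul_assoc] using h
    refine (h1.cexp.const_mul ((r : ℂ) ^ k)).congr_deriv ?_
    ring

lemma airyMoment_zero (k : ℕ) : airyMoment k 0 =
    (((3 : ℝ) ^ (((k : ℝ) + 1) / 3) / 3 * Real.Gamma (((k : ℝ) + 1) / 3) : ℝ) : ℂ) := by
  have h := integral_rpow_mul_exp_neg_mul_rpow (p := 3) (q := k) (b := 1 / 3) (by norm_num)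
    (by have : (0 : ℝ) ≤ k := Nat.cast_nonneg k
        linarith) (by norm_num)
  have e : (1 / 3 : ℝ) ^ (-((k : ℝ) + 1) / 3) * (1 / 3) = (3 : ℝ) ^ (((k : ℝ) + 1) / 3) / 3 := by
    rw [one_div, Real.inv_rpow (by norm_num), ← Real.rpow_neg (by norm_num), neg_div, neg_neg,
      ← one_div, mul_one_div]
  rw [e] at h
  rw [airyMoment, ← h, ← integral_complex_ofReal]
  refine setIntegral_congr_fun measurableSet_Ioi fun r hr => ?_
  have h3 : (r : ℝ) ^ (3 : ℝ) = r ^ 3 := by exact_mod_cast Real.rpow_natCast r 3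
  simp only [h3, Real.rpow_natCast]
  push_cast
  ring_nf

/-- Expand `exp(-w r e^{iπ/3})` under the integral; the absolute values sum to `exp(|w| r - r³/3)`,
which is integrable. This links the contour integral to the defining power series. -/
lemma hasSum_airyMoment (w : ℝ) :
    HasSum (fun k : ℕ => (-(w : ℂ) * airyDir) ^ k / (Nat.factorial k : ℂ) * airyMoment k 0)
      (airyMoment 0 w) := by
  have hexp : ∀ M r : ℝ, HasSum (fun k : ℕ => (M * r) ^ k / (Nat.factorial k : ℝ) *
      Real.exp (-(r ^ 3 / 3))) (Real.exp (M * r - r ^ 3 / 3)) := fun M r => by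
    rw [sub_eq_add_neg, Real.exp_add]
    have := NormedSpace.expSeries_div_hasSum_exp (𝔸 := ℝ) (M * r)
    rw [← Real.exp_eq_exp_ℝ] at this
    exact this.mul_right _
  have key := hasSum_integral_of_dominated_convergence
    (μ := volume.restrict (Set.Ioi (0 : ℝ)))
    (F := fun (k : ℕ) (r : ℝ) => (-(w : ℂ) * airyDir) ^ k / (Nat.factorial k : ℂ) *
      ((r : ℂ) ^ k * Complex.exp (-((r ^ 3 / 3 : ℝ) : ℂ) - (0 : ℝ) * r * airyDir)))
    (f := fun r : ℝ => (r : ℂ) ^ 0 * Complex.exp (-((r ^ 3 / 3 : ℝ) : ℂ) - w * r * airyDir))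
    (fun k r => (|w| * r) ^ k / (Nat.factorial k : ℝ) * Real.exp (-(r ^ 3 / 3)))
    (fun k => ((integrable_airyIntegrand k 0).const_mul _).aestronglyMeasurable)
    ?_ ?_ ?_ ?_
  · simpa only [integral_const_mul, airyMoment] using key
  · intro k
    refine (ae_restrict_iff' measurableSet_Ioi).2 (ae_of_all _ fun r hr => ?_)
    rw [norm_mul, norm_airyIntegrand _ _ (le_of_lt hr)]
    simp only [norm_div, norm_pow, norm_mul, norm_neg, norm_airyDir, Complex.norm_real,
      Complex.norm_natCast, Real.norm_eq_abs]
    apply le_of_eq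
    ring_nf
  · exact ae_of_all _ fun r => (hexp |w| r).summable
  · simp only [(hexp |w| _).tsum_eq]
    simpa [IntegrableOn] using integrableOn_pow_mul_exp_cubic 0 |w|
  · refine ae_of_all _ fun r => ?_
    have := NormedSpace.expSeries_div_hasSum_exp (𝔸 := ℂ) (-(w : ℂ) * airyDir * r)
    rw [← Complex.exp_eq_exp_ℂ] at this
    have h2 := this.mul_right (Complex.exp (-((r ^ 3 / 3 : ℝ) : ℂ)))
    rw [← Complex.exp_add] at h2
    rw [pow_zero, one_mul, show -((r ^ 3 / 3 : ℝ) : ℂ) - w * r * airyDir =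
      -(w : ℂ) * airyDir * r + -((r ^ 3 / 3 : ℝ) : ℂ) by ring]
    refine h2.congr_fun fun k => ?_
    rw [mul_pow (-(w : ℂ) * airyDir) (r : ℂ) k]
    simp only [Complex.ofReal_zero, zero_mul, sub_zero]
    ring

/-- The contour yields the angle `(k+1)π/3` and the series has `2π(k+1)/3`; the two add up to
`(k+1)π`, which accounts for the sign. -/
lemma airyDir_pow_im (k : ℕ) : ((-1) ^ k * airyDir ^ (k + 1)).im =
    Real.sin (2 * Real.pi * ((k : ℝ) + 1) / 3) := by
  have h1 : airyDir ^ (k + 1) = Complex.exp ((((k : ℝ) + 1) * Real.pi / 3 : ℝ) * Complex.I) := by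
    rw [airyDir_eq_exp, ← Complex.exp_nat_mul]; push_cast; ring_nf
  have h2 : ((-1 : ℂ) ^ k) = (((-1 : ℝ) ^ k : ℝ) : ℂ) := by push_cast; ring
  rw [h2, Complex.im_ofReal_mul, h1, Complex.exp_ofReal_mul_I_im,
    show 2 * Real.pi * ((k : ℝ) + 1) / 3 =
      ((k + 1 : ℕ) : ℝ) * Real.pi - ((k : ℝ) + 1) * Real.pi / 3 by push_cast; ring,
    Real.sin_nat_mul_pi_sub]
  ring

/-- The Airy contour consists of the rays in the directions `e^{±iπ/3}`, which are conjugate, so one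
ray and an imaginary part suffice. On it `z³ = -r³`, which gives cubic decay. -/
lemma airyAi_eq_im (w : ℝ) : airyAi w = (airyDir * airyMoment 0 w).im / Real.pi := by
  have h := (Complex.hasSum_im ((hasSum_airyMoment w).mul_left airyDir)).mul_left
    ((3 : ℝ) ^ (2 / 3 : ℝ))
  have e : ∀ k : ℕ, (3 : ℝ) ^ (2 / 3 : ℝ) * (airyDir * ((-(w : ℂ) * airyDir) ^ k /
      (Nat.factorial k : ℂ) * airyMoment k 0)).im = ((3 : ℝ) ^ (1 / 3 : ℝ) * w) ^ k *
      (Real.sin (2 * Real.pi * ((k : ℝ) + 1) / 3) / (Nat.factorial k : ℝ)) *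
      Real.Gamma (((k : ℝ) + 1) / 3) := fun k => by
    rw [airyMoment_zero, show airyDir * ((-(w : ℂ) * airyDir) ^ k / (Nat.factorial k : ℂ) *
        (((3 : ℝ) ^ (((k : ℝ) + 1) / 3) / 3 * Real.Gamma (((k : ℝ) + 1) / 3) : ℝ) : ℂ)) =
      ((w ^ k / (Nat.factorial k : ℝ) *
        ((3 : ℝ) ^ (((k : ℝ) + 1) / 3) / 3 * Real.Gamma (((k : ℝ) + 1) / 3)) : ℝ) : ℂ) *
        ((-1) ^ k * airyDir ^ (k + 1)) by
          push_cast; rw [mul_pow, neg_pow]; ring, Complex.im_ofReal_mul, airyDir_pow_im]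
    have h3 : (3 : ℝ) ^ (2 / 3 : ℝ) * ((3 : ℝ) ^ (((k : ℝ) + 1) / 3) / 3) =
        ((3 : ℝ) ^ (1 / 3 : ℝ)) ^ k := by
      rw [← Real.rpow_natCast, ← Real.rpow_mul (by norm_num), mul_div_assoc',
        ← Real.rpow_add (by norm_num), show (2 / 3 : ℝ) + ((k : ℝ) + 1) / 3 = 1 / 3 * k + 1 by ring,
        Real.rpow_add_one (by norm_num)]
      ring
    rw [mul_pow, ← h3]; ring
  simp only [e] at h
  rw [airyAi, h.tsum_eq, Real.rpow_neg (by norm_num)]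
  have : (3 : ℝ) ^ (2 / 3 : ℝ) ≠ 0 := by positivity
  field_simp

/-- The derivative of the Airy function. -/
noncomputable def airyAiDeriv (w : ℝ) : ℝ := -(airyDir ^ 2 * airyMoment 1 w).im / Real.pi

lemma hasDerivAt_airyAi (w : ℝ) : HasDerivAt airyAi (airyAiDeriv w) w := by
  have h := ((Complex.imCLM.hasFDerivAt.comp_hasDerivAt w
    ((hasDerivAt_airyMoment 0 w).const_mul airyDir)).div_const Real.pi)
  have e : airyAi = fun w => (Complex.imCLM ∘ fun y => airyDir * airyMoment 0 y) w / Real.pi := by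
    ext w; simp [airyAi_eq_im]
  rw [e]
  refine h.congr_deriv ?_
  rw [Complex.imCLM_apply, airyAiDeriv, zero_add, show airyDir * (-airyDir * airyMoment 1 w) = -(airyDir ^ 2 * airyMoment 1 w) by ring,
    Complex.neg_im]

/-- The integrand is a total derivative and `1` is the boundary term at `r = 0`. That term is real,
so it disappears from the imaginary part and leaves Airy's equation in `hasDerivAt_airyAiDeriv`. -/
lemma airyMoment_two (w : ℝ) : airyMoment 2 w + w * airyDir * airyMoment 0 w = 1 := by
  have hd : ∀ r : ℝ, HasDerivAt
      (fun r : ℝ => -Complex.exp (-((r ^ 3 / 3 : ℝ) : ℂ) - w * r * airyDir))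
      ((r : ℂ) ^ 2 * Complex.exp (-((r ^ 3 / 3 : ℝ) : ℂ) - w * r * airyDir) + w * airyDir *
        ((r : ℂ) ^ 0 * Complex.exp (-((r ^ 3 / 3 : ℝ) : ℂ) - w * r * airyDir))) r := fun r => by
    have h1 : HasDerivAt (fun r : ℂ => -Complex.exp (-(r ^ 3 / 3) - w * r * airyDir))
        ((r : ℂ) ^ 2 * Complex.exp (-((r : ℂ) ^ 3 / 3) - w * r * airyDir) + w * airyDir *
        ((r : ℂ) ^ 0 * Complex.exp (-((r : ℂ) ^ 3 / 3) - w * r * airyDir))) (r : ℂ) := by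
      have h2 := ((((hasDerivAt_pow 3 (r : ℂ)).div_const 3).neg.sub
        (((hasDerivAt_id (r : ℂ)).const_mul (w : ℂ)).mul_const airyDir)).cexp).neg
      refine h2.congr_deriv ?_
      simp; ring
    have := h1.comp_ofReal
    simpa using this
  have hlim : Tendsto (fun r : ℝ => -Complex.exp (-((r ^ 3 / 3 : ℝ) : ℂ) - w * r * airyDir))
      atTop (𝓝 0) := by
    have h0 : Tendsto (fun r : ℝ => Real.exp (-(w / 2) * r - r ^ 3 / 3)) atTop (𝓝 0) := by
      refine Real.tendsto_exp_atBot.comp ?_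
      have h1 : Tendsto (fun r : ℝ => -r * (r ^ 2 / 3 + w / 2)) atTop atBot :=
        tendsto_neg_atTop_atBot.atBot_mul_atTop₀ (tendsto_atTop_add_const_right _ _
          ((tendsto_pow_atTop (by norm_num)).atTop_div_const (by norm_num)))
      refine h1.congr fun r => by ring
    rw [tendsto_zero_iff_norm_tendsto_zero]
    refine h0.congr' ?_
    filter_upwards [eventually_ge_atTop 0] with r hr
    have := norm_airyIntegrand 0 w hr
    simp only [pow_zero, one_mul] at this
    rw [norm_neg, this]
  have hint := (integrable_airyIntegrand 2 w).add
    ((integrable_airyIntegrand 0 w).const_mul (w * airyDir))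
  have h := integral_Ioi_of_hasDerivAt_of_tendsto' (a := 0) (fun r _ => hd r) hint hlim
  rw [integral_add (integrable_airyIntegrand 2 w)
    ((integrable_airyIntegrand 0 w).const_mul (w * airyDir)), integral_const_mul] at h
  simpa [airyMoment] using h

lemma hasDerivAt_airyAiDeriv (w : ℝ) : HasDerivAt airyAiDeriv (w * airyAi w) w := by
  have h := ((Complex.imCLM.hasFDerivAt.comp_hasDerivAt w
    ((hasDerivAt_airyMoment 1 w).const_mul (airyDir ^ 2))).neg.div_const Real.pi)
  have e : airyAiDeriv = fun w =>
      (-(Complex.imCLM ∘ fun y => airyDir ^ 2 * airyMoment 1 y)) w / Real.pi := by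
    ext w; simp [airyAiDeriv]
  rw [e]
  refine h.congr_deriv ?_
  have h2 : airyMoment 2 w = 1 - w * (airyDir * airyMoment 0 w) := by
    rw [← airyMoment_two w]; ring
  rw [Complex.imCLM_apply, show airyDir ^ 2 * (-airyDir * airyMoment (1 + 1) w) =
    -airyDir ^ 3 * airyMoment 2 w by ring, airyDir_cube, h2, airyAi_eq_im]
  simp
  ring

lemma airyAi_zero : airyAi 0 =
    Real.sqrt 3 / (2 * Real.pi) * ((3 : ℝ) ^ (1 / 3 : ℝ) / 3 * Real.Gamma (1 / 3)) := by
  rw [airyAi_eq_im, airyMoment_zero, mul_comm airyDir, Complex.im_ofReal_mul]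
  simp [airyDir]; ring

lemma airyAiDeriv_zero : airyAiDeriv 0 =
    -(Real.sqrt 3 / (2 * Real.pi) * ((3 : ℝ) ^ (2 / 3 : ℝ) / 3 * Real.Gamma (2 / 3))) := by
  rw [airyAiDeriv, airyMoment_zero, mul_comm (airyDir ^ 2), Complex.im_ofReal_mul, airyDir_sq]
  norm_num [airyDir]; ring

lemma Gamma_one_third_mul : Real.Gamma (1 / 3) * Real.Gamma (2 / 3) =
    2 * Real.pi / Real.sqrt 3 := by
  have h := Real.Gamma_mul_Gamma_one_sub (1 / 3)
  rw [show (1 : ℝ) - 1 / 3 = 2 / 3 by norm_num, show Real.pi * (1 / 3) = Real.pi / 3 by ring,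
    Real.sin_pi_div_three] at h
  rw [h]; field_simp

/-- The boundary value at `0` of the Wronskian primitive; it produces the normalising constant of
the Cauchy density. -/
lemma airyAi_zero_mul_deriv : airyAi 0 * airyAiDeriv 0 = -1 / (2 * Real.pi * Real.sqrt 3) := by
  rw [airyAi_zero, airyAiDeriv_zero]
  have h3 : (3 : ℝ) ^ (1 / 3 : ℝ) * (3 : ℝ) ^ (2 / 3 : ℝ) = 3 := by
    rw [← Real.rpow_add (by norm_num)]; norm_num
  have hs := sqrt_three_sq
  have hs0 : Real.sqrt 3 ≠ 0 := by positivity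
  calc _ = -((Real.sqrt 3 * Real.sqrt 3) / (4 * Real.pi ^ 2) / 9 *
        ((3 : ℝ) ^ (1 / 3 : ℝ) * (3 : ℝ) ^ (2 / 3 : ℝ)) *
        (Real.Gamma (1 / 3) * Real.Gamma (2 / 3))) := by ring
    _ = _ := by rw [h3, hs, Gamma_one_third_mul]; field_simp; norm_num

lemma airyAi_zero_pos : 0 < airyAi 0 := by
  rw [airyAi_zero]
  have := Real.Gamma_pos_of_pos (show (0 : ℝ) < 1 / 3 by norm_num)
  positivity

lemma continuous_airyAi : Continuous airyAi :=
  continuous_iff_continuousAt.2 fun w => (hasDerivAt_airyAi w).continuousAt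

lemma continuous_airyAiDeriv : Continuous airyAiDeriv :=
  continuous_iff_continuousAt.2 fun w => (hasDerivAt_airyAiDeriv w).continuousAt

/-! ### Sign, boundedness and decay of the Airy function -/

lemma exists_abs_airyAi_le_of_nonneg : ∃ C : ℝ, 0 < C ∧ ∀ w : ℝ, 0 ≤ w → |airyAi w| ≤ C := by
  set I : ℝ := ∫ r in Set.Ioi (0 : ℝ), r ^ 0 * Real.exp (0 * r - r ^ 3 / 3)
  have hI : 0 ≤ I := setIntegral_nonneg measurableSet_Ioi fun r hr => by positivity
  refine ⟨(I + 1) / Real.pi, by positivity, fun w hw => ?_⟩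
  rw [airyAi_eq_im, abs_div, abs_of_pos Real.pi_pos]
  gcongr
  refine (Complex.abs_im_le_norm _).trans ?_
  rw [norm_mul, norm_airyDir, one_mul]
  refine le_trans (norm_integral_le_of_norm_le (integrableOn_pow_mul_exp_cubic 0 0) ?_)
    (le_add_of_nonneg_right zero_le_one)
  refine (ae_restrict_iff' measurableSet_Ioi).2 (ae_of_all _ fun r hr => ?_)
  have hr0 : (0 : ℝ) < r := hr
  rw [norm_airyIntegrand 0 w hr0.le]
  gcongr
  linarith

lemma monotoneOn_Ici_of_hasDerivAt_nonneg {f f' : ℝ → ℝ} {a : ℝ}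
    (hf : ∀ x, a ≤ x → HasDerivAt f (f' x) x) (h : ∀ x, a ≤ x → 0 ≤ f' x) :
    MonotoneOn f (Set.Ici a) :=
  monotoneOn_of_hasDerivWithinAt_nonneg (convex_Ici a)
    (fun x hx => (hf x hx).continuousAt.continuousWithinAt)
    (fun x hx => (hf x (interior_subset hx)).hasDerivWithinAt)
    fun x hx => h x (interior_subset hx)

/-- A function with derivative at least `c > 0` on `[a, ∞)` is unbounded. -/
lemma not_bounded_of_le_deriv {f f' : ℝ → ℝ} {a c C : ℝ} (hc : 0 < c)
    (hf : ∀ x, a ≤ x → HasDerivAt f (f' x) x) (h : ∀ x, a ≤ x → c ≤ f' x)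
    (hC : ∀ x, a ≤ x → f x ≤ C) : False := by
  have hm : MonotoneOn (fun x => f x - c * x) (Set.Ici a) :=
    monotoneOn_Ici_of_hasDerivAt_nonneg (f' := fun x => f' x - c * 1)
      (fun x hx => (hf x hx).sub ((hasDerivAt_id x).const_mul c))
      fun x hx => by have := h x hx; linarith
  set d : ℝ := (|C - f a| + 1) / c
  have hd : 0 ≤ d := by positivity
  have h1 := hm (Set.self_mem_Ici) (show a + d ∈ Set.Ici a by simpa using hd) (by linarith)
  have h2 := hC (a + d) (by linarith)
  have h3 : c * d = |C - f a| + 1 := by simp only [d]; field_simp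
  have h4 := le_abs_self (C - f a)
  simp only [mul_add] at h1
  linarith

/-- By Airy's equation `(Ai Ai')' = Ai'² + w Ai² ≥ 0` for `w ≥ 0`. If `Ai Ai'` were positive
somewhere, `Ai²` would from there on grow at least linearly, against boundedness. -/
lemma antitoneOn_airyAi_sq : AntitoneOn (fun w => airyAi w ^ 2) (Set.Ici 0) := by
  obtain ⟨C, hC0, hC⟩ := exists_abs_airyAi_le_of_nonneg
  have hd : ∀ x : ℝ, HasDerivAt (fun w => airyAi w ^ 2) (2 * (airyAi x * airyAiDeriv x)) x :=
    fun x => ((hasDerivAt_airyAi x).pow 2).congr_deriv (by ring)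
  have hq : MonotoneOn (fun w => airyAi w * airyAiDeriv w) (Set.Ici 0) :=
    monotoneOn_Ici_of_hasDerivAt_nonneg
      (fun x _ => (hasDerivAt_airyAi x).mul (hasDerivAt_airyAiDeriv x))
      fun x hx => by
        have : 0 ≤ airyAiDeriv x * airyAiDeriv x + x * (airyAi x * airyAi x) :=
          add_nonneg (mul_self_nonneg _) (mul_nonneg hx (mul_self_nonneg _))
        linarith
  have hq0 : ∀ x : ℝ, 0 ≤ x → airyAi x * airyAiDeriv x ≤ 0 := by
    intro x hx
    by_contra! hpos
    refine not_bounded_of_le_deriv (f := fun w => airyAi w ^ 2) (a := x) (C := C ^ 2) hpos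
      (fun y _ => hd y) (fun y hy => ?_) fun y hy => ?_
    · have := hq hx (show y ∈ Set.Ici (0 : ℝ) from hx.trans hy) hy
      simp only at this
      linarith
    · exact sq_le_sq' (neg_le_of_abs_le (hC y (hx.trans hy))) (le_of_abs_le (hC y (hx.trans hy)))
  have := monotoneOn_Ici_of_hasDerivAt_nonneg (a := 0) (fun x _ => (hd x).neg)
    fun x hx => by have := hq0 x hx; linarith
  intro x hx y hy hxy
  have := this hx hy hxy
  simp only [Pi.neg_apply] at this
  simp only
  linarith

/-- Since `Ai(0) > 0`, a negative value would come after a zero, and beyond a zero the decreasing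
function `Ai²` stays zero. -/
lemma airyAi_nonneg {w : ℝ} (hw : 0 ≤ w) : 0 ≤ airyAi w := by
  by_contra! h
  obtain ⟨c, hc, hc0⟩ := intermediate_value_Icc' hw continuous_airyAi.continuousOn
    (show (0 : ℝ) ∈ Set.Icc (airyAi w) (airyAi 0) from ⟨h.le, airyAi_zero_pos.le⟩)
  have := antitoneOn_airyAi_sq (show c ∈ Set.Ici 0 from hc.1) hw hc.2
  simp only [hc0] at this
  nlinarith

lemma monotoneOn_airyAiDeriv : MonotoneOn airyAiDeriv (Set.Ici 0) :=
  monotoneOn_Ici_of_hasDerivAt_nonneg (fun x _ => hasDerivAt_airyAiDeriv x)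
    fun _ hx => mul_nonneg hx (airyAi_nonneg hx)

lemma airyAiDeriv_nonpos {w : ℝ} (hw : 0 ≤ w) : airyAiDeriv w ≤ 0 := by
  obtain ⟨C, hC0, hC⟩ := exists_abs_airyAi_le_of_nonneg
  by_contra! h
  exact not_bounded_of_le_deriv (C := C) h (fun y _ => hasDerivAt_airyAi y)
    (fun y hy => monotoneOn_airyAiDeriv hw (show y ∈ Set.Ici 0 from hw.trans hy) hy)
    fun y hy => le_of_abs_le (hC y (hw.trans hy))

/-- `((Ai' + Ai) e^{-x})' = (x-1) Ai e^{-x} ≥ 0` for `x ≥ 1`, so a positive value would make `Ai' +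
Ai` grow exponentially, whereas `Ai' ≤ 0` and `Ai` is bounded. Integrated, the inequality gives
exponential decay. -/
lemma airyAiDeriv_add_airyAi_nonpos {w : ℝ} (hw : 1 ≤ w) : airyAiDeriv w + airyAi w ≤ 0 := by
  obtain ⟨C, hC0, hC⟩ := exists_abs_airyAi_le_of_nonneg
  by_contra! h
  have hm : MonotoneOn (fun x => (airyAiDeriv x + airyAi x) * Real.exp (-x)) (Set.Ici 1) :=
    monotoneOn_Ici_of_hasDerivAt_nonneg
      (fun x _ => ((hasDerivAt_airyAiDeriv x).add (hasDerivAt_airyAi x)).mul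
        (hasDerivAt_neg x).exp)
      fun x hx => by
        have h1 : 0 ≤ (x - 1) * airyAi x * Real.exp (-x) :=
          mul_nonneg (mul_nonneg (by linarith) (airyAi_nonneg (by linarith))) (Real.exp_nonneg _)
        simp only [Pi.add_apply]
        linarith
  refine not_bounded_of_le_deriv (a := w)
    (f := fun x => (airyAiDeriv w + airyAi w) * (1 + (x - w))) (C := C) h
    (f' := fun _ => airyAiDeriv w + airyAi w) (fun x _ => ?_) (fun _ _ => le_rfl) fun x hx => ?_
  · simpa using (((hasDerivAt_id x).sub_const w).const_add 1).const_mul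
      (airyAiDeriv w + airyAi w)
  · have h1 := hm hw (hw.trans hx) hx
    have h2 : (airyAiDeriv w + airyAi w) * Real.exp (x - w) ≤ airyAiDeriv x + airyAi x := by
      have h3 : Real.exp (x - w) = Real.exp (-w) * Real.exp x := by rw [← Real.exp_add]; ring_nf
      have h4 : Real.exp (-x) * Real.exp x = 1 := by rw [← Real.exp_add]; simp
      have h5 := mul_le_mul_of_nonneg_right h1 (Real.exp_nonneg x)
      simp only [mul_assoc, h4] at h5
      rw [h3]; linarith
    have h6 := Real.add_one_le_exp (x - w)
    have h7 := airyAiDeriv_nonpos (show 0 ≤ x by linarith)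
    have h8 := le_of_abs_le (hC x (by linarith))
    have h9 := mul_le_mul_of_nonneg_left h6 h.le
    linarith

/-- `Ai(x) e^x` is nonincreasing on `[1, ∞)`. The derivative inherits the decay because `Ai'` is
nondecreasing, so the mean value theorem gives `-Ai'(w+1) ≤ Ai(w)`. -/
lemma exists_airy_exp_decay : ∃ C : ℝ, 0 < C ∧ ∀ w : ℝ, 0 ≤ w →
    |airyAi w| ≤ C * Real.exp (-w) ∧ |airyAiDeriv w| ≤ C * Real.exp (-w) := by
  obtain ⟨C, hC0, hC⟩ := exists_abs_airyAi_le_of_nonneg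
  have hm := monotoneOn_Ici_of_hasDerivAt_nonneg (a := 1)
    (fun x _ => ((hasDerivAt_airyAi x).mul (Real.hasDerivAt_exp x)).neg)
    fun x hx => by
      have := mul_nonneg (neg_nonneg.2 (airyAiDeriv_add_airyAi_nonpos hx)) (Real.exp_nonneg x)
      linarith
  have h1 : ∀ w : ℝ, 0 ≤ w → airyAi w ≤ C * Real.exp 1 * Real.exp (-w) := by
    intro w hw
    rcases le_total w 1 with h | h
    · have h2 : 1 ≤ Real.exp (1 - w) := Real.one_le_exp (by linarith)
      have h3 := le_of_abs_le (hC w hw)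
      rw [mul_assoc, ← Real.exp_add, ← sub_eq_add_neg]
      nlinarith
    · have h2 := hm (Set.self_mem_Ici) h h
      simp only [Pi.neg_apply, Pi.mul_apply, neg_le_neg_iff] at h2
      have h3 := mul_le_mul_of_nonneg_right h2 (Real.exp_nonneg (-w))
      have h4 : Real.exp w * Real.exp (-w) = 1 := by rw [← Real.exp_add]; simp
      rw [mul_assoc, h4, mul_one] at h3
      refine h3.trans ?_
      gcongr
      exact le_of_abs_le (hC 1 zero_le_one)
  have h2 : ∀ w : ℝ, 0 ≤ w → -airyAiDeriv (w + 1) ≤ airyAi w := by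
    intro w hw
    obtain ⟨c, hc, hc'⟩ := exists_hasDerivAt_eq_slope airyAi airyAiDeriv
      (show w < w + 1 by linarith) continuous_airyAi.continuousOn fun x _ => hasDerivAt_airyAi x
    have h3 := monotoneOn_airyAiDeriv (show c ∈ Set.Ici 0 from hw.trans hc.1.le)
      (show w + 1 ∈ Set.Ici (0 : ℝ) by simp only [Set.mem_Ici]; linarith) hc.2.le
    rw [hc', add_sub_cancel_left, div_one] at h3
    have := airyAi_nonneg (show 0 ≤ w + 1 by linarith)
    linarith
  set D : ℝ := C * Real.exp 1 * Real.exp 1 + -airyAiDeriv 0 * Real.exp 1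
  have hD : 0 ≤ -airyAiDeriv 0 * Real.exp 1 :=
    mul_nonneg (neg_nonneg.2 (airyAiDeriv_nonpos le_rfl)) (Real.exp_nonneg _)
  have hDC : C * Real.exp 1 ≤ C * Real.exp 1 * Real.exp 1 :=
    le_mul_of_one_le_right (by positivity) (Real.one_le_exp zero_le_one)
  refine ⟨D, by positivity, fun w hw => ⟨?_, ?_⟩⟩
  · rw [abs_of_nonneg (airyAi_nonneg hw)]
    refine (h1 w hw).trans ?_
    gcongr
    simp only [D]; linarith
  · rw [abs_of_nonpos (airyAiDeriv_nonpos hw)]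
    rcases le_total w 1 with h | h
    · have h4 := monotoneOn_airyAiDeriv (Set.self_mem_Ici) hw hw
      have h5 : 1 ≤ Real.exp 1 * Real.exp (-w) := by
        rw [← Real.exp_add]; exact Real.one_le_exp (by linarith)
      have h6 : -airyAiDeriv w ≤ -airyAiDeriv 0 * (Real.exp 1 * Real.exp (-w)) := by
        refine (neg_le_neg h4).trans (le_mul_of_one_le_right ?_ h5)
        exact neg_nonneg.2 (airyAiDeriv_nonpos le_rfl)
      have h7 : 0 ≤ C * Real.exp 1 * Real.exp 1 * Real.exp (-w) := by positivity
      simp only [D, add_mul]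
      linarith
    · have h4 := h2 (w - 1) (by linarith)
      have h5 := h1 (w - 1) (by linarith)
      rw [sub_add_cancel] at h4
      refine (h4.trans h5).trans ?_
      rw [mul_assoc C, ← Real.exp_add, show 1 + -(w - 1) = 1 + 1 + -w by ring, Real.exp_add,
        Real.exp_add, ← mul_assoc, ← mul_assoc]
      gcongr
      simp only [D]; linarith

/-- On the positive half-line `Ai` and `Ai'` decay faster than any power. -/
lemma exists_airy_pow_decay (k : ℕ) : ∃ C : ℝ, 0 < C ∧ ∀ w : ℝ, 0 ≤ w →
    w ^ k * |airyAi w| ≤ C ∧ w ^ k * |airyAiDeriv w| ≤ C := by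
  obtain ⟨C, hC0, hC⟩ := exists_airy_exp_decay
  have key : ∀ w b : ℝ, 0 ≤ w → b ≤ C * Real.exp (-w) → w ^ k * b ≤ C * (k.factorial : ℝ) := by
    intro w b hw hb
    have h1 := Real.pow_div_factorial_le_exp w hw k
    rw [div_le_iff₀ (by positivity)] at h1
    calc w ^ k * b ≤ (Real.exp w * (k.factorial : ℝ)) * (C * Real.exp (-w)) := by
          refine (mul_le_mul_of_nonneg_left hb (by positivity)).trans ?_
          gcongr
      _ = C * (k.factorial : ℝ) * (Real.exp w * Real.exp (-w)) := by ring
      _ = _ := by rw [← Real.exp_add]; simp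
  exact ⟨C * (k.factorial : ℝ), by positivity, fun w hw =>
    ⟨key w _ hw (hC w hw).1, key w _ hw (hC w hw).2⟩⟩

/-- The energy estimate on the negative half-line. -/
lemma airy_energy_le {v : ℝ} (hv : 1 ≤ v) : airyAi (-v) ^ 2 + airyAiDeriv (-v) ^ 2 / v ≤
    airyAi (-1) ^ 2 + airyAiDeriv (-1) ^ 2 := by
  have hm := monotoneOn_Ici_of_hasDerivAt_nonneg (a := 1)
    (f := fun v => -(airyAi (-v) ^ 2 + airyAiDeriv (-v) ^ 2 / v))
    (f' := fun v => airyAiDeriv (-v) ^ 2 / v ^ 2)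
    (fun x hx => by
      have hx0 : x ≠ 0 := by linarith
      have h1 := ((hasDerivAt_airyAi (-x)).comp x (hasDerivAt_neg x)).pow 2
      have h2 := (((hasDerivAt_airyAiDeriv (-x)).comp x (hasDerivAt_neg x)).pow 2).div
        (hasDerivAt_id x) hx0
      refine (h1.add h2).neg.congr_deriv ?_
      simp only [Function.comp, id, Pi.pow_apply]
      field_simp
      ring) fun x hx => by positivity
  have := hm (Set.self_mem_Ici) hv hv
  simp only [div_one] at this
  linarith

lemma exists_abs_airyAi_le : ∃ C : ℝ, 0 < C ∧ ∀ w : ℝ, |airyAi w| ≤ C := by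
  obtain ⟨C₁, hC₁, h₁⟩ := exists_abs_airyAi_le_of_nonneg
  obtain ⟨C₂, h₂⟩ := isCompact_Icc.exists_bound_of_continuousOn
    (continuous_airyAi.continuousOn (s := Set.Icc (-1 : ℝ) 0))
  set C₃ : ℝ := Real.sqrt (airyAi (-1) ^ 2 + airyAiDeriv (-1) ^ 2)
  have h0 : 0 ≤ C₃ := Real.sqrt_nonneg _
  have hC₂ : 0 ≤ C₂ := (norm_nonneg _).trans (h₂ 0 (by simp))
  refine ⟨C₁ + C₂ + C₃, by positivity, fun w => ?_⟩
  rcases le_total 0 w with hw | hw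
  · linarith [h₁ w hw]
  rcases le_total (-1) w with hw1 | hw1
  · have := h₂ w ⟨hw1, hw⟩
    rw [Real.norm_eq_abs] at this
    linarith
  · have h := airy_energy_le (show 1 ≤ -w by linarith)
    rw [neg_neg] at h
    have h3 : |airyAi w| ≤ C₃ := by
      refine Real.abs_le_sqrt ?_
      have : 0 ≤ airyAiDeriv w ^ 2 / -w := div_nonneg (sq_nonneg _) (by linarith)
      linarith
    linarith

/-- The energy controls `Ai'(-v)²/v`. The growth `√v` makes `Ai'(-v)/v²` integrable at infinity, as
needed in `exists_tendsto_airyPrimitive_atBot`. -/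
lemma exists_abs_airyAiDeriv_neg_le :
    ∃ C : ℝ, 0 < C ∧ ∀ v : ℝ, 1 ≤ v → |airyAiDeriv (-v)| ≤ C * Real.sqrt v := by
  set K : ℝ := airyAi (-1) ^ 2 + airyAiDeriv (-1) ^ 2
  refine ⟨Real.sqrt K + 1, by positivity, fun v hv => ?_⟩
  have hK : 0 ≤ K := by positivity
  have h := airy_energy_le hv
  have h1 : airyAiDeriv (-v) ^ 2 ≤ K * v := by
    have := sq_nonneg (airyAi (-v))
    rw [← div_le_iff₀ (by linarith)]
    linarith
  refine (Real.abs_le_sqrt h1).trans ?_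
  rw [Real.sqrt_mul hK]
  gcongr
  linarith

lemma exists_abs_airyAiDeriv_le :
    ∃ C : ℝ, 0 < C ∧ ∀ w : ℝ, |airyAiDeriv w| ≤ C * (1 + |w|) := by
  obtain ⟨C₁, hC₁, h₁⟩ := exists_airy_pow_decay 0
  obtain ⟨C₂, h₂⟩ := isCompact_Icc.exists_bound_of_continuousOn
    (continuous_airyAiDeriv.continuousOn (s := Set.Icc (-1 : ℝ) 0))
  obtain ⟨C₃, hC₃, h₃⟩ := exists_abs_airyAiDeriv_neg_le
  have hC₂ : 0 ≤ C₂ := (norm_nonneg _).trans (h₂ 0 (by simp))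
  have key : ∀ w : ℝ, 0 ≤ |w| * (C₁ + C₂) := fun w => by positivity
  refine ⟨C₁ + C₂ + C₃, by positivity, fun w => ?_⟩
  have hk := key w
  have hk' : 0 ≤ |w| * C₃ := by positivity
  rcases le_total 0 w with hw | hw
  · have := (h₁ w hw).2
    simp only [pow_zero, one_mul] at this
    nlinarith
  rcases le_total (-1) w with hw1 | hw1
  · have := h₂ w ⟨hw1, hw⟩
    rw [Real.norm_eq_abs] at this
    nlinarith
  · have h := h₃ (-w) (by linarith)
    rw [neg_neg] at h
    have h4 : Real.sqrt (-w) ≤ 1 + |w| := by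
      rw [abs_of_nonpos hw, Real.sqrt_le_left (by linarith)]
      nlinarith
    have := mul_le_mul_of_nonneg_left h4 hC₃.le
    nlinarith

/-! ### The third-order kernel and its derivatives -/

/-- The spatial scale `(3 s)^{-1/3}` of the kernel at time `s`. -/
noncomputable def airyScale (s : ℝ) : ℝ := 1 / (3 * s) ^ (1 / 3 : ℝ)

lemma measurable_airyScale : Measurable airyScale := by
  unfold airyScale; fun_prop

lemma airyScale_pos {s : ℝ} (hs : 0 < s) : 0 < airyScale s := by
  unfold airyScale; positivity

lemma airyScale_eq_rpow {s : ℝ} (hs : 0 < s) : airyScale s = (3 * s) ^ (-(1 / 3) : ℝ) := by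
  rw [airyScale, Real.rpow_neg (by positivity), one_div]

lemma airyScale_cube {s : ℝ} (hs : 0 < s) : 3 * s * airyScale s ^ 3 = 1 := by
  rw [airyScale_eq_rpow hs, ← Real.rpow_natCast, ← Real.rpow_mul (by positivity)]
  norm_num
  rw [Real.rpow_neg_one]
  field_simp

lemma airyScale_pow_eq {s : ℝ} (hs : 0 < s) (k : ℕ) :
    airyScale s ^ k = (3 : ℝ) ^ (-(k / 3) : ℝ) * s ^ (-(k / 3) : ℝ) := by
  rw [airyScale_eq_rpow hs, ← Real.rpow_natCast, ← Real.rpow_mul (by positivity),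
    Real.mul_rpow (by norm_num) hs.le]
  ring_nf

lemma airyScale_mul {r s : ℝ} (hr : 0 < r) (hs : 0 < s) :
    airyScale (r ^ 3 * s) = airyScale s / r := by
  have h : (r ^ 3) ^ (1 / 3 : ℝ) = r := by
    rw [← Real.rpow_natCast, ← Real.rpow_mul hr.le]; norm_num
  rw [airyScale, airyScale, show 3 * (r ^ 3 * s) = r ^ 3 * (3 * s) by ring,
    Real.mul_rpow (by positivity) (by positivity), h]
  field_simp

/-- With `a = airyScale s` this reads `ds = -da/a⁴`, and the stable density carries exactly the
factor `a⁴` that cancels it. -/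
lemma hasDerivAt_airyScale {s : ℝ} (hs : 0 < s) : HasDerivAt airyScale (-airyScale s ^ 4) s := by
  have h1 : HasDerivAt (fun s : ℝ => (3 * s) ^ (-(1 / 3) : ℝ))
      (3 * -(1 / 3) * (3 * s) ^ (-(1 / 3) - 1 : ℝ)) s := by
    have := (((hasDerivAt_id s).const_mul (3 : ℝ)).rpow_const (p := -(1 / 3))
      (Or.inl (by simpa using hs.ne')))
    simpa using this
  refine (h1.congr_of_eventuallyEq ?_).congr_deriv ?_
  · filter_upwards [lt_mem_nhds hs] with v hv using airyScale_eq_rpow hv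
  · rw [airyScale_eq_rpow hs, ← Real.rpow_natCast, ← Real.rpow_mul (by positivity)]
    norm_num

lemma tendsto_airyScale_nhdsGT_zero : Tendsto airyScale (𝓝[>] 0) atTop := by
  have h := (tendsto_rpow_neg_nhdsGT_zero (y := -(1 / 3)) (by norm_num))
  refine (Tendsto.const_mul_atTop (r := (3 : ℝ) ^ (-(1 / 3) : ℝ)) (by positivity) h).congr' ?_
  filter_upwards [self_mem_nhdsWithin] with s hs
  have := airyScale_pow_eq (show 0 < s from hs) 1
  simpa using this.symm

lemma tendsto_airyScale_atTop : Tendsto airyScale atTop (𝓝 0) := by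
  have h := (tendsto_rpow_neg_atTop (y := 1 / 3) (by norm_num)).const_mul
    ((3 : ℝ) ^ (-(1 / 3) : ℝ))
  rw [mul_zero] at h
  refine h.congr' ?_
  filter_upwards [eventually_gt_atTop 0] with s hs
  have := airyScale_pow_eq hs 1
  simpa using this.symm

lemma thirdOrderKernel_eq (x s : ℝ) :
    thirdOrderKernel x s = airyScale s * airyAi (x * airyScale s) := by
  rw [thirdOrderKernel, airyScale, mul_one_div]

/-- In this form the stable density is three times `kernelDeriv₂ r s`, the second space derivative
of the kernel at `x = r`; its Laplace transform is computed through this identity. -/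
lemma stableThirdDensity_eq {r s : ℝ} (hs : 0 < s) :
    stableThirdDensity r s = 3 * (airyScale s ^ 4 * (r * airyAi (r * airyScale s))) := by
  have h := airyScale_cube hs
  have h1 : r / s = 3 * airyScale s ^ 3 * r := by
    rw [div_eq_iff hs.ne']
    linear_combination -r * h
  rw [stableThirdDensity, ← airyScale, div_eq_mul_one_div r ((3 * s) ^ (1 / 3 : ℝ)), ← airyScale,
    h1]
  ring

/-- The first spatial derivative of the kernel. -/
noncomputable def kernelDeriv₁ (x s : ℝ) : ℝ := airyScale s ^ 2 * airyAiDeriv (x * airyScale s)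

/-- The second spatial derivative of the kernel. -/
noncomputable def kernelDeriv₂ (x s : ℝ) : ℝ := airyScale s ^ 4 * (x * airyAi (x * airyScale s))

/-- The third spatial derivative of the kernel. -/
noncomputable def kernelDeriv₃ (x s : ℝ) : ℝ :=
  airyScale s ^ 4 * (airyAi (x * airyScale s) + x * airyScale s * airyAiDeriv (x * airyScale s))

lemma hasDerivAt_kernel (x s : ℝ) :
    HasDerivAt (fun x => thirdOrderKernel x s) (kernelDeriv₁ x s) x := by
  have h := (((hasDerivAt_airyAi (x * airyScale s)).comp x
    ((hasDerivAt_id x).mul_const (airyScale s))).const_mul (airyScale s))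
  simp only [thirdOrderKernel_eq]
  refine h.congr_deriv ?_
  simp only [kernelDeriv₁]; ring

lemma hasDerivAt_kernelDeriv₁ (x : ℝ) {s : ℝ} :
    HasDerivAt (fun x => kernelDeriv₁ x s) (kernelDeriv₂ x s) x := by
  have h := (((hasDerivAt_airyAiDeriv (x * airyScale s)).comp x
    ((hasDerivAt_id x).mul_const (airyScale s))).const_mul (airyScale s ^ 2))
  refine h.congr_deriv ?_
  simp only [kernelDeriv₂]; ring

lemma hasDerivAt_kernelDeriv₂ (x s : ℝ) :
    HasDerivAt (fun x => kernelDeriv₂ x s) (kernelDeriv₃ x s) x := by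
  have h := (((hasDerivAt_id x).mul ((hasDerivAt_airyAi (x * airyScale s)).comp x
    ((hasDerivAt_id x).mul_const (airyScale s)))).const_mul (airyScale s ^ 4))
  refine h.congr_deriv ?_
  simp only [kernelDeriv₃, id, Function.comp]; ring

lemma hasDerivAt_kernel_time (x : ℝ) {s : ℝ} (hs : 0 < s) :
    HasDerivAt (fun s => thirdOrderKernel x s) (-kernelDeriv₃ x s) s := by
  have hd := hasDerivAt_airyScale hs
  have h := hd.mul ((hasDerivAt_airyAi (x * airyScale s)).comp s (hd.const_mul x))
  simp only [thirdOrderKernel_eq]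
  refine h.congr_deriv ?_
  simp only [kernelDeriv₃, Function.comp]; ring

lemma measurable_airyAi : Measurable airyAi := continuous_airyAi.measurable

lemma measurable_airyAiDeriv : Measurable airyAiDeriv := continuous_airyAiDeriv.measurable

lemma measurable_thirdOrderKernel : Measurable (Function.uncurry thirdOrderKernel) := by
  have : Function.uncurry thirdOrderKernel =
      fun q : ℝ × ℝ => airyScale q.2 * airyAi (q.1 * airyScale q.2) := by
    ext q; simp only [Function.uncurry, thirdOrderKernel_eq]
  rw [this]
  exact (measurable_airyScale.comp measurable_snd).mul
    (measurable_airyAi.comp (measurable_fst.mul (measurable_airyScale.comp measurable_snd)))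

lemma measurable_stableThirdDensity : Measurable (Function.uncurry stableThirdDensity) := by
  have : Function.uncurry stableThirdDensity =
      fun q : ℝ × ℝ => q.1 / q.2 * airyScale q.2 * airyAi (q.1 * airyScale q.2) := by
    ext q
    simp only [Function.uncurry, stableThirdDensity, airyScale, mul_one_div]
  rw [this]
  exact ((measurable_fst.div measurable_snd).mul (measurable_airyScale.comp measurable_snd)).mul
    (measurable_airyAi.comp (measurable_fst.mul (measurable_airyScale.comp measurable_snd)))

lemma measurable_kernelDeriv₁ (x : ℝ) : Measurable (kernelDeriv₁ x) :=
  (measurable_airyScale.pow_const 2).mul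
    (measurable_airyAiDeriv.comp (measurable_airyScale.const_mul x))

lemma measurable_kernelDeriv₂ (x : ℝ) : Measurable (kernelDeriv₂ x) :=
  (measurable_airyScale.pow_const 4).mul
    ((measurable_airyAi.comp (measurable_airyScale.const_mul x)).const_mul x)

lemma measurable_kernelDeriv₃ (x : ℝ) : Measurable (kernelDeriv₃ x) :=
  (measurable_airyScale.pow_const 4).mul
    ((measurable_airyAi.comp (measurable_airyScale.const_mul x)).add
    ((measurable_airyScale.const_mul x).mul
      (measurable_airyAiDeriv.comp (measurable_airyScale.const_mul x))))

lemma stableThirdDensity_nonneg {r s : ℝ} (hr : 0 < r) (hs : 0 < s) :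
    0 ≤ stableThirdDensity r s := by
  have ha := airyScale_pos hs
  have := airyAi_nonneg (show 0 ≤ r * airyScale s by positivity)
  rw [stableThirdDensity_eq hs]
  positivity

/-- Self-similarity: `T_{1/3}(r)` scales as `r³ T_{1/3}(1)`. It turns limits `r → 0` into dominated
convergence against a fixed density. -/
lemma stableThirdDensity_mul {r s : ℝ} (hr : 0 < r) (hs : 0 < s) :
    r ^ 3 * stableThirdDensity r (r ^ 3 * s) = stableThirdDensity 1 s := by
  rw [stableThirdDensity_eq (by positivity), stableThirdDensity_eq hs, airyScale_mul hr hs,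
    one_mul, mul_div_cancel₀ _ hr.ne']
  field_simp

/-! ### Integrability in time -/

/-- Integration on the half-line of a derivative with limits at both ends. -/
lemma integral_Ioi_of_hasDerivAt_of_tendsto_nhdsGT {E : Type*} [NormedAddCommGroup E]
    [NormedSpace ℝ E] [CompleteSpace E] {f f' : ℝ → E} {a : ℝ} {l m : E}
    (hf : ∀ x ∈ Set.Ioi a, HasDerivAt f (f' x) x) (hi : IntegrableOn f' (Set.Ioi a))
    (hl : Tendsto f (𝓝[>] a) (𝓝 l)) (hm : Tendsto f atTop (𝓝 m)) :
    ∫ x in Set.Ioi a, f' x = m - l := by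
  classical
  have h := integral_Ioi_of_hasDerivAt_of_tendsto (f := Function.update f a l) (m := m)
    (continuousWithinAt_update_same.2 (by rwa [Set.Ici_sdiff_left]))
    (fun x hx => (hf x hx).congr_of_eventuallyEq ?_) hi ?_
  · rwa [Function.update_self] at h
  · filter_upwards [lt_mem_nhds (show a < x from hx)] with y hy
    rw [Function.update_of_ne hy.ne']
  · refine hm.congr' ?_
    filter_upwards [eventually_gt_atTop a] with y hy
    rw [Function.update_of_ne hy.ne']

lemma exists_airyScale_pow_mul_airy_le {x₀ : ℝ} (hx₀ : 0 < x₀) (k : ℕ) :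
    ∃ C : ℝ, 0 < C ∧ ∀ x s : ℝ, x₀ ≤ x → 0 < s →
      airyScale s ^ k * |airyAi (x * airyScale s)| ≤ C ∧
      airyScale s ^ k * |airyAiDeriv (x * airyScale s)| ≤ C := by
  obtain ⟨C, hC, h⟩ := exists_airy_pow_decay k
  refine ⟨C / x₀ ^ k, by positivity, fun x s hx hs => ?_⟩
  have ha := airyScale_pos hs
  have hx0 : 0 < x := hx₀.trans_le hx
  have := h (x * airyScale s) (by positivity)
  have key : ∀ b : ℝ, (x * airyScale s) ^ k * |b| ≤ C → airyScale s ^ k * |b| ≤ C / x₀ ^ k := by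
    intro b hb
    rw [le_div_iff₀ (by positivity)]
    calc airyScale s ^ k * |b| * x₀ ^ k ≤ airyScale s ^ k * |b| * x ^ k := by gcongr
      _ = (x * airyScale s) ^ k * |b| := by ring
      _ ≤ C := hb
  exact ⟨key _ this.1, key _ this.2⟩

/-- `s ↦ (3s)^{-k/3} Ai(r (3s)^{-1/3})` is integrable for `k ≥ 4`, `r > 0`. -/
lemma integrableOn_airyScale_pow_mul_airyAi {r : ℝ} (hr : 0 < r) {k : ℕ} (hk : 4 ≤ k) :
    IntegrableOn (fun s => airyScale s ^ k * airyAi (r * airyScale s)) (Set.Ioi 0) := by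
  have hmeas : Measurable (fun s => airyScale s ^ k * airyAi (r * airyScale s)) :=
    (measurable_airyScale.pow_const k).mul
      (measurable_airyAi.comp (measurable_airyScale.const_mul r))
  -- Near `s = 0` the scale blows up and the decay of `Ai` compensates; for `s > 1` the factor is of
  -- order `s^{-k/3}`, integrable because `k ≥ 4`.
  rw [← Set.Ioc_union_Ioi_eq_Ioi (zero_le_one (α := ℝ))]
  refine IntegrableOn.union ?_ ?_
  · obtain ⟨C, hC, h⟩ := exists_airyScale_pow_mul_airy_le hr k
    refine Integrable.mono' (integrable_const C) hmeas.aestronglyMeasurable ?_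
    refine (ae_restrict_iff' measurableSet_Ioc).2 (ae_of_all _ fun s hs => ?_)
    have ha := airyScale_pos hs.1
    rw [norm_mul, Real.norm_eq_abs, Real.norm_eq_abs, abs_of_nonneg (by positivity)]
    exact (h r s le_rfl hs.1).1
  · obtain ⟨C, hC, h⟩ := exists_abs_airyAi_le
    have hk3 : (-(k / 3 : ℝ)) < -1 := by
      have : (4 : ℝ) ≤ k := by exact_mod_cast hk
      linarith
    refine Integrable.mono' (((integrableOn_Ioi_rpow_of_lt hk3 one_pos).const_mul
      ((3 : ℝ) ^ (-(k / 3) : ℝ))).mul_const C) hmeas.aestronglyMeasurable ?_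
    refine (ae_restrict_iff' measurableSet_Ioi).2 (ae_of_all _ fun s hs => ?_)
    have hs0 : (0 : ℝ) < s := one_pos.trans hs
    have ha := airyScale_pos hs0
    rw [norm_mul, Real.norm_eq_abs, Real.norm_eq_abs, abs_of_nonneg (by positivity),
      airyScale_pow_eq hs0]
    gcongr
    exact h _

lemma integrableOn_stableThirdDensity {r : ℝ} (hr : 0 < r) :
    IntegrableOn (stableThirdDensity r) (Set.Ioi 0) := by
  refine IntegrableOn.congr_fun ((integrableOn_airyScale_pow_mul_airyAi hr (le_refl 4)).const_mul
    (3 * r)) (fun s hs => ?_) measurableSet_Ioi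
  simp only [stableThirdDensity_eq (show 0 < s from hs)]
  ring

lemma integrableOn_airyScale_mul_stableThirdDensity {r : ℝ} (hr : 0 < r) :
    IntegrableOn (fun s => airyScale s * stableThirdDensity r s) (Set.Ioi 0) := by
  refine IntegrableOn.congr_fun ((integrableOn_airyScale_pow_mul_airyAi hr
    (show 4 ≤ 5 by norm_num)).const_mul (3 * r)) (fun s hs => ?_) measurableSet_Ioi
  simp only [stableThirdDensity_eq (show 0 < s from hs)]
  ring

lemma exists_abs_thirdOrderKernel_le : ∃ C : ℝ, 0 < C ∧ ∀ x s : ℝ, 0 < s →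
    |thirdOrderKernel x s| ≤ C * airyScale s := by
  obtain ⟨C, hC, h⟩ := exists_abs_airyAi_le
  refine ⟨C, hC, fun x s hs => ?_⟩
  have ha := airyScale_pos hs
  rw [thirdOrderKernel_eq, abs_mul, abs_of_pos ha, mul_comm]
  gcongr
  exact h _

lemma integrableOn_kernel_mul_stableThirdDensity (x : ℝ) {r : ℝ} (hr : 0 < r) :
    IntegrableOn (fun s => thirdOrderKernel x s * stableThirdDensity r s) (Set.Ioi 0) := by
  obtain ⟨C, hC, h⟩ := exists_abs_thirdOrderKernel_le
  refine ((integrableOn_airyScale_mul_stableThirdDensity hr).const_mul C).mono' ?_ ?_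
  · exact ((measurable_thirdOrderKernel.comp measurable_prodMk_left).mul
      (measurable_stableThirdDensity.comp measurable_prodMk_left)).aestronglyMeasurable
  · refine (ae_restrict_iff' measurableSet_Ioi).2 (ae_of_all _ fun s hs => ?_)
    have hp := stableThirdDensity_nonneg hr hs
    rw [norm_mul, Real.norm_of_nonneg hp, Real.norm_eq_abs, ← mul_assoc]
    gcongr
    exact h x s hs

/-! ### Composition with a single stable time gives the Cauchy density -/

/-- The Cauchy density with location `-r/2` and scale `√3 r/2`. -/
noncomputable def skewCauchyDensity (r x : ℝ) : ℝ :=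
  Real.sqrt 3 / (2 * Real.pi) * (r / (x ^ 2 + x * r + r ^ 2))

lemma skewCauchy_quadratic_pos {r : ℝ} (hr : 0 < r) (x : ℝ) : 0 < x ^ 2 + x * r + r ^ 2 := by
  nlinarith [sq_nonneg (x + r / 2), pow_pos hr 2]

lemma skewCauchyDensity_pos {r : ℝ} (hr : 0 < r) (x : ℝ) : 0 < skewCauchyDensity r x := by
  have := skewCauchy_quadratic_pos hr x
  unfold skewCauchyDensity
  positivity

lemma tendsto_pow_mul_airy_atTop {r : ℝ} (hr : 0 < r) (k : ℕ) :
    Tendsto (fun a => a ^ k * airyAi (r * a)) atTop (𝓝 0) ∧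
    Tendsto (fun a => a ^ k * airyAiDeriv (r * a)) atTop (𝓝 0) := by
  obtain ⟨C, hC, h⟩ := exists_airy_pow_decay (k + 1)
  have key : ∀ f : ℝ → ℝ, (∀ w : ℝ, 0 ≤ w → w ^ (k + 1) * |f w| ≤ C) →
      Tendsto (fun a => a ^ k * f (r * a)) atTop (𝓝 0) := by
    intro f hf
    have h0 : Tendsto (fun a : ℝ => C / r ^ (k + 1) * a⁻¹) atTop (𝓝 0) := by
      simpa using tendsto_inv_atTop_zero.const_mul (C / r ^ (k + 1))
    refine squeeze_zero_norm' ?_ h0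
    filter_upwards [eventually_gt_atTop 0] with a ha
    rw [norm_mul, Real.norm_eq_abs, Real.norm_eq_abs, abs_of_nonneg (by positivity),
      ← div_eq_mul_inv, le_div_iff₀ ha, le_div_iff₀ (by positivity)]
    calc a ^ k * |f (r * a)| * a * r ^ (k + 1) = (r * a) ^ (k + 1) * |f (r * a)| := by ring
      _ ≤ C := hf _ (by positivity)
  exact ⟨key _ fun w hw => (h w hw).1, key _ fun w hw => (h w hw).2⟩

/-- The kernel at a stable time is a Cauchy density: `a Ai(x a) Ai(r a)` has a primitive of
Wronskian type. -/
lemma integral_kernel_mul_stableThirdDensity (x : ℝ) {r : ℝ} (hr : 0 < r) :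
    ∫ s in Set.Ioi (0 : ℝ), thirdOrderKernel x s * stableThirdDensity r s =
      skewCauchyDensity r x := by
  have hpos := skewCauchy_quadratic_pos hr x
  have hi := integrableOn_kernel_mul_stableThirdDensity x hr
  have h3 := sqrt_three_sq
  have h30 : Real.sqrt 3 ≠ 0 := by positivity
  -- After the substitution `a = airyScale s` it remains to find a primitive `W` of `a Ai(xa)
  -- Ai(ra)` vanishing at infinity; the integral is then `-3r W(0)`.
  suffices H : ∃ W : ℝ → ℝ, Continuous W ∧
      (∀ a, HasDerivAt W (a * airyAi (x * a) * airyAi (r * a)) a) ∧ Tendsto W atTop (𝓝 0) ∧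
      W 0 = airyAi 0 * airyAiDeriv 0 / (x ^ 2 + x * r + r ^ 2) by
    obtain ⟨W, hWc, hWd, hWt, hW0⟩ := H
    have hd : ∀ s ∈ Set.Ioi (0 : ℝ), HasDerivAt (fun s => -(3 * r) * W (airyScale s))
        (thirdOrderKernel x s * stableThirdDensity r s) s := by
      intro s hs
      refine (((hWd (airyScale s)).comp s (hasDerivAt_airyScale hs)).const_mul
        (-(3 * r))).congr_deriv ?_
      rw [thirdOrderKernel_eq, stableThirdDensity_eq hs]
      ring
    rw [integral_Ioi_of_hasDerivAt_of_tendsto_nhdsGT hd hi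
      ((hWt.comp tendsto_airyScale_nhdsGT_zero).const_mul _)
      (((hWc.tendsto 0).comp tendsto_airyScale_atTop).const_mul _), hW0, airyAi_zero_mul_deriv,
      skewCauchyDensity]
    have h4 := hpos.ne'
    generalize x ^ 2 + x * r + r ^ 2 = q at h4
    field_simp
    linear_combination -h3
  have t0 := tendsto_pow_mul_airy_atTop hr 0
  have t1 := tendsto_pow_mul_airy_atTop hr 1
  simp only [pow_zero, one_mul, pow_one] at t0 t1
  have d1 : ∀ c a : ℝ, HasDerivAt (fun a => airyAi (c * a)) (airyAiDeriv (c * a) * c) a :=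
    fun c a => ((hasDerivAt_airyAi (c * a)).comp a ((hasDerivAt_id a).const_mul c)).congr_deriv
      (by ring)
  have d2 : ∀ c a : ℝ, HasDerivAt (fun a => airyAiDeriv (c * a))
      (c * a * airyAi (c * a) * c) a :=
    fun c a => ((hasDerivAt_airyAiDeriv (c * a)).comp a
      ((hasDerivAt_id a).const_mul c)).congr_deriv (by ring)
  by_cases hxr : x = r
  · subst hxr
    -- The Wronskian quotient is `0/0` when `x = r`, so a separate primitive of `a Ai(xa)²` is used.
    refine ⟨fun a => (a * (a * airyAi (x * a) * airyAi (x * a)) -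
      a * airyAiDeriv (x * a) * airyAiDeriv (x * a) / x +
      airyAi (x * a) * airyAiDeriv (x * a) / x ^ 2) / 3, ?_, ?_, ?_, ?_⟩
    · have h1 : Continuous fun a => airyAi (x * a) := continuous_airyAi.comp (by fun_prop)
      have h2 : Continuous fun a => airyAiDeriv (x * a) :=
        continuous_airyAiDeriv.comp (by fun_prop)
      fun_prop
    · intro a
      have e1 := (hasDerivAt_id a).mul (((hasDerivAt_id a).mul (d1 x a)).mul (d1 x a))
      have e2 := (((hasDerivAt_id a).mul (d2 x a)).mul (d2 x a)).div_const x
      have e3 := ((d1 x a).mul (d2 x a)).div_const (x ^ 2)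
      refine (((e1.sub e2).add e3).div_const 3).congr_deriv ?_
      simp only [id, Pi.mul_apply]
      field_simp
      ring
    · have e1 := t1.1.mul t1.1
      have e2 := (t1.2.mul t0.2).div_const x
      have e3 := (t0.1.mul t0.2).div_const (x ^ 2)
      have := ((e1.sub e2).add e3).div_const 3
      simp only [mul_zero, zero_div, sub_zero, add_zero] at this
      refine this.congr fun a => ?_
      ring
    · simp only [mul_zero, zero_mul, zero_div, sub_zero, zero_add]
      field_simp
      ring
  · have hne : r ^ 3 - x ^ 3 ≠ 0 := by
      have : r ^ 3 - x ^ 3 = (r - x) * (x ^ 2 + x * r + r ^ 2) := by ring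
      rw [this]
      exact mul_ne_zero (sub_ne_zero.2 (Ne.symm hxr)) hpos.ne'
    -- The numerator is the Wronskian in `a` of `Ai(xa)` and `Ai(ra)`, which solve `f'' = x³ a f`
    -- and `f'' = r³ a f`; its derivative is `(r³ - x³) a Ai(xa) Ai(ra)`.
    refine ⟨fun a => (airyAi (x * a) * (airyAiDeriv (r * a) * r) -
      airyAiDeriv (x * a) * x * airyAi (r * a)) / (r ^ 3 - x ^ 3), ?_, ?_, ?_, ?_⟩
    · have h1 : ∀ c : ℝ, Continuous fun a => airyAi (c * a) :=
        fun c => continuous_airyAi.comp (by fun_prop)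
      have h2 : ∀ c : ℝ, Continuous fun a => airyAiDeriv (c * a) :=
        fun c => continuous_airyAiDeriv.comp (by fun_prop)
      have := h1 x
      have := h1 r
      have := h2 x
      have := h2 r
      fun_prop
    · intro a
      refine ((((d1 x a).mul ((d2 r a).mul_const r)).sub
        (((d2 x a).mul_const x).mul (d1 r a))).div_const _).congr_deriv ?_
      field_simp
      ring
    · obtain ⟨C₁, hC₁, h₁⟩ := exists_abs_airyAi_le
      obtain ⟨C₂, hC₂, h₂⟩ := exists_abs_airyAiDeriv_le
      have b1 : Tendsto (fun a => airyAi (x * a) * (airyAiDeriv (r * a) * r)) atTop (𝓝 0) := by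
        have := (t0.2.mul_const r)
        rw [zero_mul] at this
        exact bdd_le_mul_tendsto_zero' C₁ (Eventually.of_forall fun a => h₁ _) this
      -- For `x < 0` no decay of `Ai'(xa)` is available; its at most linear growth is beaten by the
      -- decay of `Ai(ra)`, `r > 0`.
      have b2 : Tendsto (fun a => airyAiDeriv (x * a) * x * airyAi (r * a)) atTop (𝓝 0) := by
        have h0 : Tendsto (fun a => C₂ * |x| * (|airyAi (r * a)| + |x| * |a * airyAi (r * a)|))
            atTop (𝓝 0) := by
          have := ((t0.1.abs).add ((t1.1.abs).const_mul |x|)).const_mul (C₂ * |x|)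
          simpa using this
        refine squeeze_zero_norm' ?_ h0
        filter_upwards [eventually_ge_atTop 0] with a ha
        rw [norm_mul, norm_mul, Real.norm_eq_abs, Real.norm_eq_abs, Real.norm_eq_abs]
        have := h₂ (x * a)
        calc _ ≤ C₂ * (1 + |x * a|) * |x| * |airyAi (r * a)| := by gcongr
          _ = _ := by rw [abs_mul, abs_mul]; ring
      have := (b1.sub b2).div_const (r ^ 3 - x ^ 3)
      simpa using this
    · simp only [mul_zero]
      rw [div_eq_div_iff hne hpos.ne']
      ring

/-! ### Laplace transform of the stable density of index `1/3` -/

lemma exists_eq_mul_exp_of_hasDerivAt {m : ℝ → ℂ} {c : ℂ}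
    (hm : ∀ x : ℝ, 0 < x → HasDerivAt m (c * m x) x) :
    ∀ x : ℝ, 0 < x → m x = m 1 * Complex.exp (c * (x - 1)) := by
  have hd : ∀ x : ℝ, 0 < x → HasDerivAt (fun x : ℝ => m x * Complex.exp (-c * (x - 1))) 0 x := by
    intro x hx
    have h1 : HasDerivAt (fun x : ℝ => -c * ((x : ℂ) - 1)) (-c) x := by
      simpa using ((Complex.ofRealCLM.hasDerivAt (x := x)).sub_const (1 : ℂ)).const_mul (-c)
    refine ((hm x hx).mul h1.cexp).congr_deriv ?_
    ring
  intro x hx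
  have h := isOpen_Ioi.is_const_of_deriv_eq_zero (isPreconnected_Ioi (a := (0 : ℝ)))
    (fun y hy => (hd y hy).differentiableAt.differentiableWithinAt)
    (fun y hy => (hd y hy).deriv) hx (Set.mem_Ioi.2 one_pos)
  simp only [Complex.ofReal_one, sub_self, mul_zero, Complex.exp_zero, mul_one] at h
  rw [← h, mul_assoc, ← Complex.exp_add]
  simp

lemma eq_zero_of_hasDerivAt_of_bounded {m : ℝ → ℂ} {c : ℂ} (hc : 0 < c.re)
    (hm : ∀ x : ℝ, 0 < x → HasDerivAt m (c * m x) x) {K : ℝ}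
    (hK : ∀ x : ℝ, 1 ≤ x → ‖m x‖ ≤ K) : ∀ x : ℝ, 0 < x → m x = 0 := by
  have h := exists_eq_mul_exp_of_hasDerivAt hm
  suffices h1 : m 1 = 0 by
    intro x hx
    rw [h x hx, h1, zero_mul]
  by_contra hne
  have hpos : 0 < ‖m 1‖ := norm_pos_iff.2 hne
  -- Chosen so that `‖m 1‖ Re(c) (x-1) = K`; then `e^y ≥ 1 + y` gives `‖m x‖ ≥ ‖m 1‖ + K > K`.
  set x : ℝ := 1 + K / (‖m 1‖ * c.re)
  have hK0 : 0 ≤ K := (norm_nonneg _).trans (hK 1 le_rfl)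
  have hx : 1 ≤ x := le_add_of_nonneg_right (by positivity)
  have h2 := hK x hx
  rw [h x (by linarith), norm_mul, Complex.norm_exp] at h2
  have h3 : (c * ((x : ℂ) - 1)).re = c.re * (x - 1) := by
    rw [show (x : ℂ) - 1 = ((x - 1 : ℝ) : ℂ) by push_cast; rfl, Complex.re_mul_ofReal]
  have h4 : ‖m 1‖ * (c.re * (x - 1)) = K := by simp only [x]; field_simp; ring
  have h5 := Real.add_one_le_exp (c.re * (x - 1))
  rw [h3] at h2
  nlinarith

lemma exp_re_pos {l : ℂ} (hl : |l.im| < Real.pi / 2) : 0 < (Complex.exp l).re := by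
  rw [Complex.exp_re]
  exact mul_pos (Real.exp_pos _) (Real.cos_pos_of_mem_Ioo (abs_lt.1 hl))

/-- A bounded solution of `U''' = -κ³ U` on the half-line, `|arg κ| < π/6`, decays like
`exp(-κ x)`. -/
lemma hasDerivAt_of_third_order_ode {l : ℂ} (hl : |l.im| < Real.pi / 6) {U₀ U₁ U₂ : ℝ → ℂ}
    (h₀ : ∀ x : ℝ, 0 < x → HasDerivAt U₀ (U₁ x) x)
    (h₁ : ∀ x : ℝ, 0 < x → HasDerivAt U₁ (U₂ x) x)
    (h₂ : ∀ x : ℝ, 0 < x → HasDerivAt U₂ (-Complex.exp l ^ 3 * U₀ x) x) {K : ℝ}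
    (b₀ : ∀ x : ℝ, 1 ≤ x → ‖U₀ x‖ ≤ K) (b₁ : ∀ x : ℝ, 1 ≤ x → ‖U₁ x‖ ≤ K)
    (b₂ : ∀ x : ℝ, 1 ≤ x → ‖U₂ x‖ ≤ K) :
    ∀ x : ℝ, 0 < x → U₁ x = -Complex.exp l * U₀ x := by
  set κ := Complex.exp l with hκ
  -- `λ³ + κ³ = (λ + κ)(λ - p)(λ - q)`. Multiplying `κ` by `e^{±iπ/3}` keeps the argument below
  -- `π/2` because `|arg κ| < π/6`, so `p` and `q` have positive real part. For `V = U' + κU`,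
  -- boundedness kills first `V' - pV`, which grows like `e^{qx}`, and then `V`, which grows like
  -- `e^{px}`.
  set p : ℂ := airyDir * κ
  set q : ℂ := (1 - airyDir) * κ
  have hpi := Real.pi_pos
  have hp : 0 < p.re := by
    simp only [p]
    rw [airyDir_eq_exp, hκ, ← Complex.exp_add]
    refine exp_re_pos ?_
    simp only [Complex.add_im, Complex.mul_im, Complex.ofReal_re, Complex.ofReal_im,
      Complex.I_re, Complex.I_im]
    rw [abs_lt] at hl ⊢
    constructor <;> linarith [hl.1, hl.2]
  have hq' : (1 : ℂ) - airyDir = Complex.exp (((-(Real.pi / 3) : ℝ) : ℂ) * Complex.I) := by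
    rw [Complex.exp_mul_I, ← Complex.ofReal_cos, ← Complex.ofReal_sin, Real.cos_neg,
      Real.sin_neg, Real.cos_pi_div_three, Real.sin_pi_div_three]
    apply Complex.ext
    · simp [airyDir]; norm_num
    · simp [airyDir]
  have hq : 0 < q.re := by
    simp only [q]
    rw [hq', hκ, ← Complex.exp_add]
    refine exp_re_pos ?_
    simp only [Complex.add_im, Complex.mul_im, Complex.ofReal_re, Complex.ofReal_im,
      Complex.I_re, Complex.I_im]
    rw [abs_lt] at hl ⊢
    constructor <;> linarith [hl.1, hl.2]
  have hpq : p + q = κ := by simp only [p, q]; ring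
  have hpq2 : p * q = κ ^ 2 := by
    simp only [p, q]
    rw [show airyDir * κ * ((1 - airyDir) * κ) = (airyDir - airyDir ^ 2) * κ ^ 2 by ring,
      airyDir_sq]
    ring
  have hV : ∀ x : ℝ, 0 < x → HasDerivAt (fun x => U₁ x + κ * U₀ x) (U₂ x + κ * U₁ x) x :=
    fun x hx => (h₁ x hx).add ((h₀ x hx).const_mul κ)
  have hV' : ∀ x : ℝ, 0 < x →
      HasDerivAt (fun x => U₂ x + κ * U₁ x) (-κ ^ 3 * U₀ x + κ * U₂ x) x :=
    fun x hx => (h₂ x hx).add ((h₁ x hx).const_mul κ)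
  have hVb : ∀ x : ℝ, 1 ≤ x → ‖U₁ x + κ * U₀ x‖ ≤ K + ‖κ‖ * K := fun x hx => by
    refine (norm_add_le _ _).trans ?_
    rw [norm_mul]
    gcongr
    exacts [b₁ x hx, b₀ x hx]
  have hVb' : ∀ x : ℝ, 1 ≤ x → ‖U₂ x + κ * U₁ x‖ ≤ K + ‖κ‖ * K := fun x hx => by
    refine (norm_add_le _ _).trans ?_
    rw [norm_mul]
    gcongr
    exacts [b₂ x hx, b₁ x hx]
  have e1 : ∀ x : ℝ, 0 < x → (U₂ x + κ * U₁ x) - p * (U₁ x + κ * U₀ x) = 0 := by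
    refine eq_zero_of_hasDerivAt_of_bounded hq (fun x hx => ?_)
      (K := (K + ‖κ‖ * K) + ‖p‖ * (K + ‖κ‖ * K)) fun x hx => ?_
    · refine ((hV' x hx).sub ((hV x hx).const_mul p)).congr_deriv ?_
      have e : q = κ - p := by rw [← hpq]; ring
      rw [e] at hpq2 ⊢
      linear_combination (U₁ x + κ * U₀ x) * hpq2
    · refine (norm_sub_le _ _).trans ?_
      rw [norm_mul]
      gcongr
      exacts [hVb' x hx, hVb x hx]
  have e2 := eq_zero_of_hasDerivAt_of_bounded hp
    (fun x hx => (hV x hx).congr_deriv (sub_eq_zero.1 (e1 x hx))) hVb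
  intro x hx
  linear_combination e2 x hx

/-! ### Laplace transform in time of the kernel and of its space derivatives. -/

lemma integrableOn_exp_mul_airyScale_pow {σ : ℝ} (hσ : 0 < σ) {k : ℕ} (hk : k ≤ 2) :
    IntegrableOn (fun s => Real.exp (-σ * s) * airyScale s ^ k) (Set.Ioi 0) := by
  have hk' : (k : ℝ) ≤ 2 := by exact_mod_cast hk
  have h := integrableOn_rpow_mul_exp_neg_mul_rpow (p := 1) (s := -(k / 3)) (b := σ)
    (by linarith) one_pos hσ
  refine IntegrableOn.congr_fun (h.const_mul ((3 : ℝ) ^ (-(k / 3) : ℝ))) (fun s hs => ?_)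
    measurableSet_Ioi
  simp only [Real.rpow_one, airyScale_pow_eq (show 0 < s from hs)]
  ring

lemma integrableOn_exp_mul_const_mul_airyScale {σ : ℝ} (hσ : 0 < σ) (C : ℝ) :
    IntegrableOn (fun s => Real.exp (-σ * s) * (C * airyScale s)) (Set.Ioi 0) := by
  refine IntegrableOn.congr_fun ((integrableOn_exp_mul_airyScale_pow hσ
    (show 1 ≤ 2 by norm_num)).const_mul C) (fun s _ => ?_) measurableSet_Ioi
  ring

/-- Integral of `e^{-z s} D(s)` over `s > 0`. -/
noncomputable def timeLaplace (z : ℂ) (D : ℝ → ℝ) : ℂ :=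
  ∫ s in Set.Ioi (0 : ℝ), Complex.exp (-z * s) * (D s : ℂ)

lemma norm_exp_neg_mul (z : ℂ) (s : ℝ) :
    ‖Complex.exp (-z * s)‖ = Real.exp (-z.re * s) := by
  rw [Complex.norm_exp, Complex.re_mul_ofReal, Complex.neg_re]

lemma measurable_exp_mul_ofReal (z : ℂ) {D : ℝ → ℝ} (hD : Measurable D) :
    Measurable fun s : ℝ => Complex.exp (-z * s) * (D s : ℂ) := by fun_prop

lemma norm_exp_mul_ofReal_le (z : ℂ) {D : ℝ → ℝ} {B : ℝ} {s : ℝ} (h : |D s| ≤ B) :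
    ‖Complex.exp (-z * s) * (D s : ℂ)‖ ≤ Real.exp (-z.re * s) * B := by
  rw [norm_mul, norm_exp_neg_mul, Complex.norm_real, Real.norm_eq_abs]
  gcongr

lemma norm_timeLaplace_le (z : ℂ) {D B : ℝ → ℝ}
    (hB : IntegrableOn (fun s => Real.exp (-z.re * s) * B s) (Set.Ioi 0))
    (h : ∀ s : ℝ, 0 < s → |D s| ≤ B s) :
    ‖timeLaplace z D‖ ≤ ∫ s in Set.Ioi (0 : ℝ), Real.exp (-z.re * s) * B s :=
  norm_integral_le_of_norm_le hB ((ae_restrict_iff' measurableSet_Ioi).2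
    (ae_of_all _ fun s hs => norm_exp_mul_ofReal_le z (h s hs)))

lemma integrableOn_exp_mul_ofReal (z : ℂ) {D B : ℝ → ℝ} (hD : Measurable D)
    (hB : IntegrableOn (fun s => Real.exp (-z.re * s) * B s) (Set.Ioi 0))
    (h : ∀ s : ℝ, 0 < s → |D s| ≤ B s) :
    IntegrableOn (fun s : ℝ => Complex.exp (-z * s) * (D s : ℂ)) (Set.Ioi 0) :=
  hB.mono' (measurable_exp_mul_ofReal z hD).aestronglyMeasurable
    ((ae_restrict_iff' measurableSet_Ioi).2
      (ae_of_all _ fun s hs => norm_exp_mul_ofReal_le z (h s hs)))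

/-- The derivative is dominated only for `y ≥ x/2`: the available bounds on the higher kernel
derivatives need `y` bounded away from `0`. -/
lemma hasDerivAt_timeLaplace (z : ℂ) {D D' : ℝ → ℝ → ℝ} {B₀ B : ℝ → ℝ} {x : ℝ} (hx : 0 < x)
    (hDm : ∀ y, Measurable (D y)) (hDm' : ∀ y, Measurable (D' y))
    (hB₀ : IntegrableOn (fun s => Real.exp (-z.re * s) * B₀ s) (Set.Ioi 0))
    (hB : IntegrableOn (fun s => Real.exp (-z.re * s) * B s) (Set.Ioi 0))
    (h0 : ∀ s : ℝ, 0 < s → |D x s| ≤ B₀ s)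
    (h : ∀ y s : ℝ, x / 2 ≤ y → 0 < s → |D' y s| ≤ B s)
    (hd : ∀ y s : ℝ, 0 < s → HasDerivAt (fun y => D y s) (D' y s) y) :
    HasDerivAt (fun y => timeLaplace z (D y)) (timeLaplace z (D' x)) x := by
  refine (hasDerivAt_integral_of_dominated_loc_of_deriv_le
    (μ := volume.restrict (Set.Ioi (0 : ℝ))) (s := Set.Ioi (x / 2))
    (F := fun (y : ℝ) (s : ℝ) => Complex.exp (-z * s) * (D y s : ℂ))
    (F' := fun (y : ℝ) (s : ℝ) => Complex.exp (-z * s) * (D' y s : ℂ))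
    (bound := fun s => Real.exp (-z.re * s) * B s)
    (Ioi_mem_nhds (by linarith))
    (Eventually.of_forall fun y => (measurable_exp_mul_ofReal z (hDm y)).aestronglyMeasurable)
    (integrableOn_exp_mul_ofReal z (hDm x) hB₀ h0)
    (measurable_exp_mul_ofReal z (hDm' x)).aestronglyMeasurable ?_ hB ?_).2
  · exact (ae_restrict_iff' measurableSet_Ioi).2 (ae_of_all _ fun s hs y hy =>
      norm_exp_mul_ofReal_le z (h y s (le_of_lt hy) hs))
  · exact (ae_restrict_iff' measurableSet_Ioi).2 (ae_of_all _ fun s hs y hy =>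
      ((hd y s hs).ofReal_comp).const_mul _)

lemma exists_abs_kernelDeriv₁_le : ∃ C : ℝ, 0 < C ∧ ∀ x s : ℝ, 0 ≤ x → 0 < s →
    |kernelDeriv₁ x s| ≤ C * airyScale s ^ 2 := by
  obtain ⟨C, hC, h⟩ := exists_airy_pow_decay 0
  refine ⟨C, hC, fun x s hx hs => ?_⟩
  have ha := airyScale_pos hs
  rw [kernelDeriv₁, abs_mul, abs_of_pos (by positivity), mul_comm]
  gcongr
  simpa using (h (x * airyScale s) (by positivity)).2

/-- Powers of the scale `a`, unbounded as `s → 0`, are traded for powers of `w = xa` at the cost of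
negative powers of `x`; the decay of `Ai` and `Ai'` absorbs the powers of `w`. -/
lemma exists_abs_kernelDeriv₂_le {x₀ : ℝ} (hx₀ : 0 < x₀) : ∃ C : ℝ, 0 < C ∧ ∀ x s : ℝ,
    x₀ ≤ x → 0 < s → |kernelDeriv₂ x s| ≤ C ∧ |kernelDeriv₃ x s| ≤ C := by
  obtain ⟨C₁, hC₁, h₁⟩ := exists_airy_pow_decay 4
  obtain ⟨C₂, hC₂, h₂⟩ := exists_airy_pow_decay 5
  refine ⟨C₁ / x₀ ^ 3 + (C₁ + C₂) / x₀ ^ 4, by positivity, fun x s hx hs => ?_⟩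
  have ha := airyScale_pos hs
  have hx0 : 0 < x := hx₀.trans_le hx
  set w := x * airyScale s with hw
  have hw0 : 0 ≤ w := by positivity
  have e2 : kernelDeriv₂ x s = w ^ 4 * airyAi w / x ^ 3 := by
    rw [kernelDeriv₂, ← hw, hw]; field_simp
  have e3 : kernelDeriv₃ x s = (w ^ 4 * airyAi w + w ^ 5 * airyAiDeriv w) / x ^ 4 := by
    rw [kernelDeriv₃, ← hw]
    rw [eq_div_iff (by positivity), show airyScale s ^ 4 * (airyAi w + w * airyAiDeriv w) * x ^ 4 =
      (x * airyScale s) ^ 4 * (airyAi w + w * airyAiDeriv w) by ring, ← hw]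
    ring
  have i1 : |w ^ 4 * airyAi w| ≤ C₁ := by
    rw [abs_mul, abs_of_nonneg (by positivity)]; exact (h₁ w hw0).1
  have i2 : |w ^ 5 * airyAiDeriv w| ≤ C₂ := by
    rw [abs_mul, abs_of_nonneg (by positivity)]; exact (h₂ w hw0).2
  constructor
  · rw [e2, abs_div, abs_of_pos (pow_pos hx0 3)]
    refine le_add_of_le_of_nonneg ?_ (by positivity)
    gcongr
  · rw [e3, abs_div, abs_of_pos (pow_pos hx0 4)]
    refine le_add_of_nonneg_of_le (by positivity) ?_
    gcongr
    exact (abs_add_le _ _).trans (add_le_add i1 i2)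

lemma exp_cube_re_pos {l : ℂ} (hl : |l.im| < Real.pi / 6) : 0 < (Complex.exp l ^ 3).re := by
  rw [← Complex.exp_nat_mul]
  refine exp_re_pos ?_
  have : (((3 : ℕ) : ℂ) * l).im = 3 * l.im := by simp
  rw [this, abs_mul, abs_of_pos (by norm_num)]
  linarith

/-- Integration by parts in time of `∂ₜu = -∂ₓ³u`. The boundary term at `s = 0` vanishes because `x
> 0` is away from the initial point mass. -/
lemma timeLaplace_kernelDeriv₃ {z : ℂ} (hz : 0 < z.re) {x : ℝ} (hx : 0 < x) :
    timeLaplace z (kernelDeriv₃ x) = -z * timeLaplace z (thirdOrderKernel x) := by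
  obtain ⟨C₀, hC₀, h₀⟩ := exists_abs_thirdOrderKernel_le
  obtain ⟨C₂, hC₂, h₂⟩ := exists_abs_kernelDeriv₂_le hx
  have m0 : Measurable (thirdOrderKernel x) :=
    measurable_thirdOrderKernel.comp measurable_prodMk_left
  have B0 := integrableOn_exp_mul_const_mul_airyScale hz C₀
  have B2 : IntegrableOn (fun s => Real.exp (-z.re * s) * C₂) (Set.Ioi 0) := by
    simpa [IntegrableOn] using (integrableOn_exp_mul_airyScale_pow hz (show 0 ≤ 2 by norm_num)).mul_const C₂
  have i0 := integrableOn_exp_mul_ofReal z m0 B0 (h₀ x)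
  have i3 := integrableOn_exp_mul_ofReal z (measurable_kernelDeriv₃ x) B2
    (fun s hs => (h₂ x s le_rfl hs).2)
  have hd : ∀ s ∈ Set.Ioi (0 : ℝ), HasDerivAt
      (fun s : ℝ => Complex.exp (-z * s) * (thirdOrderKernel x s : ℂ))
      (-z * (Complex.exp (-z * s) * (thirdOrderKernel x s : ℂ)) -
        Complex.exp (-z * s) * (kernelDeriv₃ x s : ℂ)) s := by
    intro s hs
    have h1 : HasDerivAt (fun s : ℝ => -z * (s : ℂ)) (-z) s := by
      simpa using (Complex.ofRealCLM.hasDerivAt (x := s)).const_mul (-z)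
    refine (h1.cexp.mul (hasDerivAt_kernel_time x hs).ofReal_comp).congr_deriv ?_
    push_cast
    ring
  have lim0 : Tendsto (fun s : ℝ => Complex.exp (-z * s) * (thirdOrderKernel x s : ℂ))
      (𝓝[>] 0) (𝓝 0) := by
    have h1 := ((tendsto_pow_mul_airy_atTop hx 1).1.comp tendsto_airyScale_nhdsGT_zero)
    have h2 : Tendsto (fun s => (thirdOrderKernel x s : ℂ)) (𝓝[>] 0) (𝓝 0) := by
      have := (Complex.continuous_ofReal.tendsto 0).comp h1
      simp only [Complex.ofReal_zero] at this
      refine this.congr fun s => ?_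
      simp [thirdOrderKernel_eq]
    have h3 : Tendsto (fun s : ℝ => Complex.exp (-z * s)) (𝓝[>] 0)
        (𝓝 (Complex.exp (-z * (0 : ℝ)))) :=
      ((by fun_prop : Continuous fun s : ℝ => Complex.exp (-z * s)).tendsto 0).mono_left
        nhdsWithin_le_nhds
    simpa using h3.mul h2
  have lim1 : Tendsto (fun s : ℝ => Complex.exp (-z * s) * (thirdOrderKernel x s : ℂ))
      atTop (𝓝 0) := by
    have h1 : Tendsto (fun s => C₀ * airyScale s) atTop (𝓝 0) := by
      simpa using tendsto_airyScale_atTop.const_mul C₀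
    refine squeeze_zero_norm' ?_ h1
    filter_upwards [eventually_gt_atTop 0] with s hs
    refine (norm_exp_mul_ofReal_le z (h₀ x s hs)).trans ?_
    have ha := airyScale_pos hs
    refine mul_le_of_le_one_left (by positivity) (Real.exp_le_one_iff.2 ?_)
    nlinarith
  have h := integral_Ioi_of_hasDerivAt_of_tendsto_nhdsGT hd ((i0.const_mul (-z)).sub i3) lim0 lim1
  rw [integral_sub (i0.const_mul (-z)) i3, integral_const_mul] at h
  simp only [timeLaplace]
  linear_combination -h

/-- The transform at `z = κ³`, `κ = e^l`, solves `U''' = -κ³U` and is bounded on `[1, ∞)` with its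
first two derivatives, so only the decaying mode survives: `U' = -κU`, `U'' = κ²U`. Working with the
logarithm `l` fixes the cube root of `z` without a branch choice. -/
lemma timeLaplace_kernel_ode {l : ℂ} (hl : |l.im| < Real.pi / 6) :
    (∀ x : ℝ, 0 < x → HasDerivAt (fun x => timeLaplace (Complex.exp l ^ 3) (thirdOrderKernel x))
      (-Complex.exp l * timeLaplace (Complex.exp l ^ 3) (thirdOrderKernel x)) x) ∧
    ∀ x : ℝ, 0 < x → timeLaplace (Complex.exp l ^ 3) (kernelDeriv₂ x) =
      Complex.exp l ^ 2 * timeLaplace (Complex.exp l ^ 3) (thirdOrderKernel x) := by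
  set z := Complex.exp l ^ 3 with hz'
  have hz : 0 < z.re := exp_cube_re_pos hl
  obtain ⟨C₀, hC₀, h₀⟩ := exists_abs_thirdOrderKernel_le
  obtain ⟨C₁, hC₁, h₁⟩ := exists_abs_kernelDeriv₁_le
  have m0 : ∀ x, Measurable (thirdOrderKernel x) := fun x =>
    measurable_thirdOrderKernel.comp measurable_prodMk_left
  have B0 := integrableOn_exp_mul_const_mul_airyScale hz C₀
  have B1 : IntegrableOn (fun s => Real.exp (-z.re * s) * (C₁ * airyScale s ^ 2))
      (Set.Ioi 0) := by
    refine IntegrableOn.congr_fun ((integrableOn_exp_mul_airyScale_pow hz le_rfl).const_mul C₁)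
      (fun s _ => ?_) measurableSet_Ioi
    ring
  have B2 : ∀ C : ℝ, IntegrableOn (fun s => Real.exp (-z.re * s) * C) (Set.Ioi 0) := fun C => by
    simpa [IntegrableOn] using (integrableOn_exp_mul_airyScale_pow hz (show 0 ≤ 2 by norm_num)).mul_const C
  have d0 : ∀ x : ℝ, 0 < x → HasDerivAt (fun x => timeLaplace z (thirdOrderKernel x))
      (timeLaplace z (kernelDeriv₁ x)) x := fun x hx =>
    hasDerivAt_timeLaplace z hx m0 measurable_kernelDeriv₁ B0 B1 (h₀ x)
      (fun y s hy hs => h₁ y s (by linarith) hs) fun y s _ => hasDerivAt_kernel y s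
  have d1 : ∀ x : ℝ, 0 < x → HasDerivAt (fun x => timeLaplace z (kernelDeriv₁ x))
      (timeLaplace z (kernelDeriv₂ x)) x := fun x hx => by
    obtain ⟨C, hC, h⟩ := exists_abs_kernelDeriv₂_le (half_pos hx)
    exact hasDerivAt_timeLaplace z hx measurable_kernelDeriv₁ measurable_kernelDeriv₂ B1 (B2 C)
      (fun s hs => h₁ x s hx.le hs) (fun y s hy hs => (h y s hy hs).1)
      fun y s _ => hasDerivAt_kernelDeriv₁ y
  have d2 : ∀ x : ℝ, 0 < x → HasDerivAt (fun x => timeLaplace z (kernelDeriv₂ x))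
      (-z * timeLaplace z (thirdOrderKernel x)) x := fun x hx => by
    obtain ⟨C, hC, h⟩ := exists_abs_kernelDeriv₂_le (half_pos hx)
    rw [← timeLaplace_kernelDeriv₃ hz hx]
    exact hasDerivAt_timeLaplace z hx measurable_kernelDeriv₂ measurable_kernelDeriv₃ (B2 C) (B2 C)
      (fun s hs => (h x s (by linarith) hs).1) (fun y s hy hs => (h y s hy hs).2)
      fun y s _ => hasDerivAt_kernelDeriv₂ y s
  obtain ⟨C₂, hC₂, h₂⟩ := exists_abs_kernelDeriv₂_le one_pos
  set K₀ := ∫ s in Set.Ioi (0 : ℝ), Real.exp (-z.re * s) * (C₀ * airyScale s)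
  set K₁ := ∫ s in Set.Ioi (0 : ℝ), Real.exp (-z.re * s) * (C₁ * airyScale s ^ 2)
  set K₂ := ∫ s in Set.Ioi (0 : ℝ), Real.exp (-z.re * s) * C₂
  have key := hasDerivAt_of_third_order_ode hl d0 d1 (by simpa only [hz'] using d2)
    (K := max K₀ (max K₁ K₂))
    (fun x _ => (norm_timeLaplace_le z B0 (h₀ x)).trans (le_max_left _ _))
    (fun x hx => (norm_timeLaplace_le z B1 fun s hs => h₁ x s (by linarith) hs).trans
      ((le_max_left _ _).trans (le_max_right _ _)))
    (fun x hx => (norm_timeLaplace_le z (B2 C₂) fun s hs => (h₂ x s hx hs).1).trans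
      ((le_max_right _ _).trans (le_max_right _ _)))
  refine ⟨fun x hx => key x hx ▸ d0 x hx, fun x hx => ?_⟩
  have h1 : HasDerivAt (fun x => timeLaplace z (kernelDeriv₁ x))
      (-Complex.exp l * timeLaplace z (kernelDeriv₁ x)) x := by
    refine ((d0 x hx).const_mul (-Complex.exp l)).congr_of_eventuallyEq ?_
    filter_upwards [lt_mem_nhds hx] with y hy using key y hy
  rw [(d1 x hx).unique h1, key x hx]
  ring

/-- The equation `U' = -κU` holds on `x > 0`; continuity at `0` identifies the multiplicative
constant as `U(0)`. The factor `3κ²` comes from the density being `3 ∂ₓ²u₃`. -/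
lemma exists_timeLaplace_eq_mul_exp {l : ℂ} (hl : |l.im| < Real.pi / 6) :
    ∀ x : ℝ, 0 < x → timeLaplace (Complex.exp l ^ 3) (stableThirdDensity x) =
      3 * Complex.exp l ^ 2 * timeLaplace (Complex.exp l ^ 3) (thirdOrderKernel 0) *
        Complex.exp (-Complex.exp l * x) := by
  obtain ⟨h1, h2⟩ := timeLaplace_kernel_ode hl
  set z := Complex.exp l ^ 3 with hz'
  have hz : 0 < z.re := exp_cube_re_pos hl
  have h3 := exists_eq_mul_exp_of_hasDerivAt h1
  obtain ⟨C₀, hC₀, h₀⟩ := exists_abs_thirdOrderKernel_le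
  have m0 : ∀ x, Measurable (thirdOrderKernel x) := fun x =>
    measurable_thirdOrderKernel.comp measurable_prodMk_left
  have B0 := integrableOn_exp_mul_const_mul_airyScale hz C₀
  have lim : Tendsto (fun x => timeLaplace z (thirdOrderKernel x)) (𝓝[>] 0)
      (𝓝 (timeLaplace z (thirdOrderKernel 0))) := by
    refine tendsto_integral_filter_of_dominated_convergence
      (fun s => Real.exp (-z.re * s) * (C₀ * airyScale s))
      (Eventually.of_forall fun x => (measurable_exp_mul_ofReal z (m0 x)).aestronglyMeasurable)
      (Eventually.of_forall fun x => (ae_restrict_iff' measurableSet_Ioi).2 (ae_of_all _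
        fun s hs => norm_exp_mul_ofReal_le z (h₀ x s hs))) B0
      (ae_of_all _ fun s => ?_)
    have hc : Continuous fun x => thirdOrderKernel x s := by
      simp only [thirdOrderKernel_eq]
      exact (continuous_airyAi.comp (by fun_prop)).const_mul _
    exact (((by fun_prop : Continuous fun x => Complex.exp (-z * s) *
      (thirdOrderKernel x s : ℂ))).tendsto 0).mono_left nhdsWithin_le_nhds
  have lim' : Tendsto (fun x => timeLaplace z (thirdOrderKernel x)) (𝓝[>] 0)
      (𝓝 (timeLaplace z (thirdOrderKernel 1) * Complex.exp (-Complex.exp l * ((0 : ℝ) - 1)))) := by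
    have hc : Continuous fun x : ℝ => timeLaplace z (thirdOrderKernel 1) *
      Complex.exp (-Complex.exp l * ((x : ℂ) - 1)) := by fun_prop
    refine ((hc.tendsto 0).mono_left nhdsWithin_le_nhds).congr' ?_
    filter_upwards [self_mem_nhdsWithin] with x hx using (h3 x hx).symm
  have h4 := tendsto_nhds_unique lim lim'
  intro x hx
  have h5 : timeLaplace z (stableThirdDensity x) = 3 * timeLaplace z (kernelDeriv₂ x) := by
    rw [timeLaplace, timeLaplace, ← integral_const_mul]
    refine setIntegral_congr_fun measurableSet_Ioi fun s hs => ?_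
    simp only [stableThirdDensity_eq (show 0 < s from hs), kernelDeriv₂]
    push_cast
    ring
  rw [h5, h2 x hx, h3 x hx, h4, show -Complex.exp l * ((x : ℂ) - 1) =
    -Complex.exp l * ((0 : ℝ) - 1) + -Complex.exp l * x by push_cast; ring, Complex.exp_add]
  ring

/-- At `x = 0` the kernel is a pure power of `s`, so the transform is `Ai(0) 3^{-1/3} Γ(2/3)` and
the reflection formula evaluates it. -/
lemma timeLaplace_one_kernel_zero : 3 * timeLaplace 1 (thirdOrderKernel 0) = 1 := by
  have h := Real.integral_rpow_mul_exp_neg_mul_Ioi (a := 2 / 3) (r := 1) (by norm_num) one_pos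
  have e : timeLaplace 1 (thirdOrderKernel 0) = ((airyAi 0 * (3 : ℝ) ^ (-(1 / 3) : ℝ) *
      Real.Gamma (2 / 3) : ℝ) : ℂ) := by
    rw [one_div_one, Real.one_rpow, one_mul] at h
    rw [← h, ← integral_const_mul, ← integral_complex_ofReal, timeLaplace]
    refine setIntegral_congr_fun measurableSet_Ioi fun s hs => ?_
    have ha := airyScale_pow_eq (show 0 < s from hs) 1
    simp only [pow_one, Nat.cast_one] at ha
    simp only [thirdOrderKernel_eq, zero_mul, ha]
    rw [show (2 / 3 - 1 : ℝ) = -(1 / 3) by norm_num]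
    push_cast
    ring_nf
  have h3 := sqrt_three_sq
  have h30 : Real.sqrt 3 ≠ 0 := by positivity
  have hg := Gamma_one_third_mul
  have h33 : (3 : ℝ) ^ (1 / 3 : ℝ) * (3 : ℝ) ^ (-(1 / 3) : ℝ) = 1 := by
    rw [← Real.rpow_add (by norm_num)]; norm_num
  rw [e, airyAi_zero]
  norm_cast
  calc _ = Real.sqrt 3 / (2 * Real.pi) * ((3 : ℝ) ^ (1 / 3 : ℝ) * (3 : ℝ) ^ (-(1 / 3) : ℝ)) *
        (Real.Gamma (1 / 3) * Real.Gamma (2 / 3)) := by ring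
    _ = 1 := by rw [h33, hg]; field_simp

lemma tendsto_timeLaplace_stableThirdDensity {z : ℂ} (hz : 0 < z.re) :
    Tendsto (fun t => timeLaplace z (stableThirdDensity t)) (𝓝[>] 0)
      (𝓝 ((∫ s in Set.Ioi (0 : ℝ), stableThirdDensity 1 s : ℝ) : ℂ)) := by
  have hi := integrableOn_stableThirdDensity one_pos
  have e : ∀ t : ℝ, 0 < t → timeLaplace z (stableThirdDensity t) =
      ∫ s in Set.Ioi (0 : ℝ), Complex.exp (-z * ((t ^ 3 * s : ℝ) : ℂ)) *
        (stableThirdDensity 1 s : ℂ) := by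
    intro t ht
    have h := integral_comp_mul_left_Ioi
      (fun s : ℝ => Complex.exp (-z * s) * (stableThirdDensity t s : ℂ)) 0 (pow_pos ht 3)
    rw [mul_zero, eq_inv_smul_iff₀ (by positivity)] at h
    rw [timeLaplace, ← h, ← integral_smul]
    refine setIntegral_congr_fun measurableSet_Ioi fun s hs => ?_
    simp only [← stableThirdDensity_mul ht hs, Complex.real_smul]
    push_cast
    ring
  rw [← integral_complex_ofReal]
  refine Tendsto.congr' (f₁ := fun t : ℝ => ∫ s in Set.Ioi (0 : ℝ),
    Complex.exp (-z * ((t ^ 3 * s : ℝ) : ℂ)) * (stableThirdDensity 1 s : ℂ)) ?_ ?_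
  · filter_upwards [self_mem_nhdsWithin] with t ht using (e t ht).symm
  · refine tendsto_integral_filter_of_dominated_convergence
      (fun s => |stableThirdDensity 1 s|) ?_ ?_ hi.abs ?_
    · exact Eventually.of_forall fun t => ((by fun_prop : Measurable fun s : ℝ =>
        Complex.exp (-z * ((t ^ 3 * s : ℝ) : ℂ))).aestronglyMeasurable).mul
        (Complex.continuous_ofReal.comp_aestronglyMeasurable hi.aestronglyMeasurable)
    · filter_upwards [self_mem_nhdsWithin] with t ht
      refine (ae_restrict_iff' measurableSet_Ioi).2 (ae_of_all _ fun s hs => ?_)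
      rw [norm_mul, norm_exp_neg_mul, Complex.norm_real, Real.norm_eq_abs]
      have ht0 : 0 < t := ht
      have hs0 : 0 < s := hs
      refine mul_le_of_le_one_left (abs_nonneg _) (Real.exp_le_one_iff.2 ?_)
      have : 0 ≤ z.re * (t ^ 3 * s) := by positivity
      linarith
    · refine ae_of_all _ fun s => ?_
      have hc : Continuous fun t : ℝ => Complex.exp (-z * ((t ^ 3 * s : ℝ) : ℂ)) *
        (stableThirdDensity 1 s : ℂ) := by fun_prop
      simpa using (hc.tendsto 0).mono_left nhdsWithin_le_nhds

/-- The prefactor is the limit `x → 0` of the transform of the density, which by scaling is the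
total mass and so does not depend on `l`. Its explicit value at `l = 0` then shows that the mass,
and the prefactor for every `l`, equal `1`. -/
lemma timeLaplace_stableThirdDensity_aux {l : ℂ} (hl : |l.im| < Real.pi / 6) :
    (3 * Complex.exp l ^ 2 * timeLaplace (Complex.exp l ^ 3) (thirdOrderKernel 0)) =
      ((∫ s in Set.Ioi (0 : ℝ), stableThirdDensity 1 s : ℝ) : ℂ) := by
  refine tendsto_nhds_unique ?_
    (tendsto_timeLaplace_stableThirdDensity (exp_cube_re_pos hl))
  have hc : Continuous fun x : ℝ => 3 * Complex.exp l ^ 2 *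
    timeLaplace (Complex.exp l ^ 3) (thirdOrderKernel 0) * Complex.exp (-Complex.exp l * x) := by
    fun_prop
  have h := (hc.tendsto 0).mono_left (nhdsWithin_le_nhds (s := Set.Ioi 0))
  simp only [Complex.ofReal_zero, mul_zero, Complex.exp_zero, mul_one] at h
  refine h.congr' ?_
  filter_upwards [self_mem_nhdsWithin] with x hx using (exists_timeLaplace_eq_mul_exp hl x hx).symm

lemma integral_stableThirdDensity_one :
    ∫ s in Set.Ioi (0 : ℝ), stableThirdDensity 1 s = 1 := by
  have h := timeLaplace_stableThirdDensity_aux (l := 0) (by simp; positivity)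
  simp only [Complex.exp_zero, one_pow, mul_one, timeLaplace_one_kernel_zero] at h
  exact_mod_cast h.symm

/-- The Laplace transform of the stable density of index `1/3`. -/
lemma timeLaplace_stableThirdDensity {l : ℂ} (hl : |l.im| < Real.pi / 2) {t : ℝ} (ht : 0 < t) :
    timeLaplace (Complex.exp l) (stableThirdDensity t) =
      Complex.exp (-Complex.exp (l / 3) * t) := by
  have hl3 : |(l / 3).im| < Real.pi / 6 := by
    rw [show (l / 3).im = l.im / 3 by simp, abs_div, abs_of_pos (by norm_num : (0 : ℝ) < 3)]
    linarith
  have h := exists_timeLaplace_eq_mul_exp hl3 t ht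
  rw [timeLaplace_stableThirdDensity_aux hl3, integral_stableThirdDensity_one,
    ← Complex.exp_nat_mul] at h
  rw [show ((3 : ℕ) : ℂ) * (l / 3) = l by push_cast; ring] at h
  rw [h]
  simp

/-! ### The Cauchy characteristic function -/

/-- Fourier inversion for `e^{-2π|x|}`, whose transform, computed on the two half-lines, is the
standard Cauchy density. -/
lemma integral_exp_mul_standardCauchy (t : ℝ) :
    ∫ x : ℝ, Complex.exp (t * x * Complex.I) * ((Real.pi⁻¹ * (1 + x ^ 2)⁻¹ : ℝ) : ℂ) =
      Complex.exp (-(|t| : ℝ)) := by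
  have hpi := Real.pi_pos
  set f : ℝ → ℂ := fun x => Complex.exp (-((2 * Real.pi * |x| : ℝ) : ℂ)) with hf
  have hfc : Continuous f := by fun_prop
  have hre : ∀ ξ : ℝ, (-(2 * Real.pi : ℝ) - (2 * Real.pi * ξ : ℝ) * Complex.I : ℂ).re < 0 ∧
      0 < ((2 * Real.pi : ℝ) - (2 * Real.pi * ξ : ℝ) * Complex.I : ℂ).re := fun ξ => by
    constructor
    · simp [hpi]
    · simp [hpi]
  have epos : ∀ ξ : ℝ, Set.EqOn (fun x : ℝ => Complex.exp (((-2 * Real.pi * x * ξ : ℝ) : ℂ) *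
      Complex.I) • f x) (fun x : ℝ => Complex.exp ((-(2 * Real.pi : ℝ) -
        (2 * Real.pi * ξ : ℝ) * Complex.I) * x)) (Set.Ioi 0) := fun ξ x hx => by
    simp only [hf, abs_of_pos (show 0 < x from hx), smul_eq_mul, ← Complex.exp_add]
    push_cast
    ring_nf
  have eneg : ∀ ξ : ℝ, Set.EqOn (fun x : ℝ => Complex.exp (((-2 * Real.pi * x * ξ : ℝ) : ℂ) *
      Complex.I) • f x) (fun x : ℝ => Complex.exp (((2 * Real.pi : ℝ) -
        (2 * Real.pi * ξ : ℝ) * Complex.I) * x)) (Set.Iic 0) := fun ξ x hx => by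
    simp only [hf, abs_of_nonpos (show x ≤ 0 from hx), smul_eq_mul, ← Complex.exp_add]
    push_cast
    ring_nf
  have ipos := fun ξ : ℝ => (integrableOn_exp_mul_complex_Ioi (hre ξ).1 0).congr_fun
    (epos ξ).symm measurableSet_Ioi
  have ineg := fun ξ : ℝ => (integrableOn_exp_mul_complex_Iic (hre ξ).2 0).congr_fun
    (eneg ξ).symm measurableSet_Iic
  have hfi : Integrable f := by
    have h := (ineg 0).union (ipos 0)
    rw [Set.Iic_union_Ioi, integrableOn_univ] at h
    simpa using h
  have hF : ∀ ξ : ℝ, FourierTransform.fourier f ξ = ((Real.pi⁻¹ * (1 + ξ ^ 2)⁻¹ : ℝ) : ℂ) := by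
    intro ξ
    rw [Real.fourier_real_eq_integral_exp_smul, ← intervalIntegral.integral_Iic_add_Ioi
      (ineg ξ) (ipos ξ), setIntegral_congr_fun measurableSet_Iic (eneg ξ),
      setIntegral_congr_fun measurableSet_Ioi (epos ξ), integral_exp_mul_complex_Iic (hre ξ).2,
      integral_exp_mul_complex_Ioi (hre ξ).1]
    simp only [Complex.ofReal_zero, mul_zero, Complex.exp_zero]
    have h1 : ((2 * Real.pi : ℝ) - (2 * Real.pi * ξ : ℝ) * Complex.I : ℂ) ≠ 0 := fun h => by
      have := (hre ξ).2
      rw [h] at this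
      simp at this
    have h2 : (-(2 * Real.pi : ℝ) - (2 * Real.pi * ξ : ℝ) * Complex.I : ℂ) ≠ 0 := fun h => by
      have := (hre ξ).1
      rw [h] at this
      simp at this
    have h3 : ((Real.pi * (1 + ξ ^ 2) : ℝ) : ℂ) ≠ 0 := by
      exact_mod_cast (by positivity : Real.pi * (1 + ξ ^ 2) ≠ 0)
    rw [← mul_inv, Complex.ofReal_inv, div_add_div _ _ h1 h2, ← one_div,
      div_eq_div_iff (mul_ne_zero h1 h2) h3]
    push_cast
    ring_nf
    simp only [Complex.I_sq]
    ring
  have hFi : Integrable (FourierTransform.fourier f) := by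
    have h : FourierTransform.fourier f = fun ξ : ℝ => ((Real.pi⁻¹ * (1 + ξ ^ 2)⁻¹ : ℝ) : ℂ) :=
      funext hF
    rw [h]
    exact (integrable_inv_one_add_sq.const_mul _).ofReal
  have h := hfi.fourierInv_fourier_eq hFi (v := t / (2 * Real.pi)) hfc.continuousAt
  rw [Real.fourierInv_eq'] at h
  simp only [hF, smul_eq_mul, RCLike.inner_apply, conj_trivial] at h
  rw [hf] at h
  beta_reduce at h
  rw [abs_div, abs_of_pos (by positivity : 0 < 2 * Real.pi),
    mul_div_cancel₀ _ (by positivity)] at h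
  rw [← h]
  congr 1
  ext x
  congr 3
  rw [show 2 * Real.pi * (t / (2 * Real.pi) * x) = t * x by field_simp]
  push_cast
  ring

/-- Completing the square, `x² + xr + r² = (x + r/2)² + 3r²/4`, reduces everything to the standard
Cauchy density. -/
lemma skewCauchyDensity_comp {r : ℝ} (hr : 0 < r) (y : ℝ) :
    Real.sqrt 3 / 2 * r * skewCauchyDensity r (Real.sqrt 3 / 2 * r * y + -(r / 2)) =
      Real.pi⁻¹ * (1 + y ^ 2)⁻¹ := by
  have h3 := sqrt_three_sq
  have e : (Real.sqrt 3 / 2 * r * y + -(r / 2)) ^ 2 + (Real.sqrt 3 / 2 * r * y + -(r / 2)) * r +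
      r ^ 2 = 3 / 4 * r ^ 2 * (1 + y ^ 2) := by
    linear_combination (r ^ 2 * y ^ 2 / 4) * h3
  have : 0 < 1 + y ^ 2 := by positivity
  rw [skewCauchyDensity, e]
  field_simp
  linear_combination 4 * h3

lemma integral_comp_affine {E : Type*} [NormedAddCommGroup E] [NormedSpace ℝ E] {a : ℝ}
    (ha : 0 < a) (b : ℝ) (g : ℝ → E) : ∫ x, g x = ∫ y, a • g (a * y + b) := by
  have h := Measure.integral_comp_mul_left (fun x => g (x + b)) a
  rw [integral_add_right_eq_self (fun x => g x), abs_of_pos (inv_pos.2 ha)] at h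
  rw [integral_smul, h, smul_smul, mul_inv_cancel₀ ha.ne', one_smul]

lemma measurable_skewCauchyDensity : Measurable (Function.uncurry skewCauchyDensity) := by
  unfold skewCauchyDensity Function.uncurry
  fun_prop

lemma integrable_skewCauchyDensity {r : ℝ} (hr : 0 < r) : Integrable (skewCauchyDensity r) := by
  have ha : Real.sqrt 3 / 2 * r ≠ 0 := by positivity
  have h : Integrable fun y => skewCauchyDensity r (Real.sqrt 3 / 2 * r * y + -(r / 2)) := by
    refine ((integrable_inv_one_add_sq.const_mul Real.pi⁻¹).const_mul
      (Real.sqrt 3 / 2 * r)⁻¹).congr (ae_of_all _ fun y => ?_)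
    simp only
    rw [← skewCauchyDensity_comp hr, inv_mul_cancel_left₀ ha]
  have h2 := (integrable_comp_mul_left_iff
    (fun x => skewCauchyDensity r (x + -(r / 2))) ha).1 h
  simpa using h2.comp_add_right (r / 2)

/-- The characteristic function of the Cauchy density with location `-r/2` and scale `√3 r/2`. -/
lemma integral_exp_mul_skewCauchyDensity {r : ℝ} (hr : 0 < r) (β : ℝ) :
    ∫ x : ℝ, Complex.exp (β * x * Complex.I) * (skewCauchyDensity r x : ℂ) =
      Complex.exp (-((Real.sqrt 3 / 2 * |β| : ℝ) + (β / 2 : ℝ) * Complex.I) * r) := by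
  have ha : 0 < Real.sqrt 3 / 2 * r := by positivity
  rw [integral_comp_affine ha (-(r / 2))]
  have e : ∀ y : ℝ, (Real.sqrt 3 / 2 * r) • (Complex.exp (β * ((Real.sqrt 3 / 2 * r * y +
      -(r / 2) : ℝ) : ℂ) * Complex.I) * (skewCauchyDensity r (Real.sqrt 3 / 2 * r * y +
      -(r / 2)) : ℂ)) = Complex.exp (-((β / 2 : ℝ) * Complex.I) * r) *
      (Complex.exp (((β * (Real.sqrt 3 / 2 * r) : ℝ) : ℂ) * y * Complex.I) *
        ((Real.pi⁻¹ * (1 + y ^ 2)⁻¹ : ℝ) : ℂ)) := fun y => by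
    rw [← skewCauchyDensity_comp hr, ← mul_assoc, ← Complex.exp_add, Complex.real_smul,
      Complex.ofReal_mul (Real.sqrt 3 / 2 * r) (skewCauchyDensity r _)]
    push_cast
    ring_nf
  simp only [e]
  rw [integral_const_mul, integral_exp_mul_standardCauchy, ← Complex.exp_add, abs_mul,
    abs_of_pos ha]
  push_cast
  ring_nf

lemma integral_skewCauchyDensity {r : ℝ} (hr : 0 < r) : ∫ x, skewCauchyDensity r x = 1 := by
  have h := integral_exp_mul_skewCauchyDensity hr 0
  simp only [Complex.ofReal_zero, zero_mul, Complex.exp_zero, one_mul, abs_zero, mul_zero,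
    zero_div, add_zero, neg_zero] at h
  rw [integral_complex_ofReal] at h
  exact_mod_cast h

/-! ### The kernel is the fundamental solution -/

lemma contDiff_airyAi_and_deriv (n : ℕ) :
    ContDiff ℝ n airyAi ∧ ContDiff ℝ n airyAiDeriv := by
  induction n with
  | zero => exact ⟨contDiff_zero.2 continuous_airyAi, contDiff_zero.2 continuous_airyAiDeriv⟩
  | succ n ih =>
    have e1 : deriv airyAi = airyAiDeriv := funext fun w => (hasDerivAt_airyAi w).deriv
    have e2 : deriv airyAiDeriv = fun w => w * airyAi w :=
      funext fun w => (hasDerivAt_airyAiDeriv w).deriv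
    constructor
    · exact_mod_cast contDiff_succ_iff_deriv.2 ⟨fun w => (hasDerivAt_airyAi w).differentiableAt,
        fun h => absurd h (by simp), e1 ▸ ih.2⟩
    · exact_mod_cast contDiff_succ_iff_deriv.2
        ⟨fun w => (hasDerivAt_airyAiDeriv w).differentiableAt, fun h => absurd h (by simp),
          e2 ▸ contDiff_id.mul ih.1⟩

lemma contDiff_thirdOrderKernel (s : ℝ) : ContDiff ℝ 3 (fun x => thirdOrderKernel x s) := by
  simp only [thirdOrderKernel_eq]
  have h : ContDiff ℝ 3 airyAi := by exact_mod_cast (contDiff_airyAi_and_deriv 3).1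
  exact contDiff_const.mul (h.comp (contDiff_id.mul contDiff_const))

lemma iteratedDeriv_three_thirdOrderKernel (x s : ℝ) :
    iteratedDeriv 3 (fun y => thirdOrderKernel y s) x = kernelDeriv₃ x s := by
  have e1 : deriv (fun y => thirdOrderKernel y s) = fun y => kernelDeriv₁ y s :=
    funext fun y => (hasDerivAt_kernel y s).deriv
  have e2 : deriv (fun y => kernelDeriv₁ y s) = fun y => kernelDeriv₂ y s :=
    funext fun y => (hasDerivAt_kernelDeriv₁ y).deriv
  rw [iteratedDeriv_succ', iteratedDeriv_succ', iteratedDeriv_succ', iteratedDeriv_zero, e1, e2]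
  exact (hasDerivAt_kernelDeriv₂ x s).deriv

/-! ### The primitive of `Ai` and the initial datum of the kernel. -/

/-- The primitive of the Airy function vanishing at `0`. -/
noncomputable def airyPrimitive (w : ℝ) : ℝ := ∫ v in (0 : ℝ)..w, airyAi v

lemma hasDerivAt_airyPrimitive (w : ℝ) : HasDerivAt airyPrimitive (airyAi w) w :=
  intervalIntegral.integral_hasDerivAt_right (continuous_airyAi.intervalIntegrable _ _)
    (continuous_airyAi.stronglyMeasurableAtFilter _ _) continuous_airyAi.continuousAt

lemma continuous_airyPrimitive : Continuous airyPrimitive :=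
  continuous_iff_continuousAt.2 fun w => (hasDerivAt_airyPrimitive w).continuousAt

lemma exists_tendsto_airyPrimitive_atTop : ∃ l : ℝ, Tendsto airyPrimitive atTop (𝓝 l) := by
  obtain ⟨C, hC, h⟩ := exists_airy_exp_decay
  have hi : IntegrableOn airyAi (Set.Ioi 0) := by
    have h0 : IntegrableOn (fun w => Real.exp (-w)) (Set.Ioi 0) := integrableOn_exp_neg_Ioi 0
    refine (h0.const_mul C).mono' measurable_airyAi.aestronglyMeasurable ?_
    exact (ae_restrict_iff' measurableSet_Ioi).2 (ae_of_all _ fun w hw => (h w (le_of_lt hw)).1)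
  exact ⟨_, intervalIntegral_tendsto_integral_Ioi 0 hi tendsto_id⟩

/-- Integration by parts with `Ai(-v) = (Ai'(-v))'/v`: adding `Ai'(-v)/v`, which tends to `0`,
leaves the derivative `-Ai'(-v)/v² = O(v^{-3/2})`, absolutely integrable. -/
lemma exists_tendsto_airyPrimitive_atBot : ∃ l : ℝ, Tendsto airyPrimitive atBot (𝓝 l) := by
  obtain ⟨C, hC, h⟩ := exists_abs_airyAiDeriv_neg_le
  have hd : ∀ v ∈ Set.Ioi (1 : ℝ), HasDerivAt
      (fun v => airyPrimitive (-v) + airyAiDeriv (-v) / v) (-(airyAiDeriv (-v) / v ^ 2)) v := by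
    intro v hv
    have hv0 : v ≠ 0 := (one_pos.trans hv).ne'
    have h1 := (hasDerivAt_airyPrimitive (-v)).comp v (hasDerivAt_neg v)
    have h2 := ((hasDerivAt_airyAiDeriv (-v)).comp v (hasDerivAt_neg v)).div (hasDerivAt_id v) hv0
    refine (h1.add h2).congr_deriv ?_
    simp only [Function.comp, id]
    field_simp
    ring
  have hsqrt : ∀ v : ℝ, 0 < v → Real.sqrt v / v = v ^ (-(1 / 2) : ℝ) := fun v hv => by
    rw [Real.sqrt_eq_rpow, div_eq_mul_inv, ← Real.rpow_neg_one, ← Real.rpow_add hv]; norm_num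
  have hi : IntegrableOn (fun v => -(airyAiDeriv (-v) / v ^ 2)) (Set.Ioi 1) := by
    refine ((integrableOn_Ioi_rpow_of_lt (show (-(3 / 2) : ℝ) < -1 by norm_num)
      one_pos).const_mul C).mono' ?_ ?_
    · exact ((measurable_airyAiDeriv.comp measurable_neg).div
        (measurable_id.pow_const 2)).neg.aestronglyMeasurable
    · refine (ae_restrict_iff' measurableSet_Ioi).2 (ae_of_all _ fun v hv => ?_)
      have hv0 : 0 < v := one_pos.trans hv
      have e : v ^ (-(3 / 2) : ℝ) = Real.sqrt v / v ^ 2 := by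
        rw [Real.sqrt_eq_rpow, ← Real.rpow_natCast, ← Real.rpow_sub hv0]; norm_num
      rw [norm_neg, norm_div, Real.norm_eq_abs, Real.norm_of_nonneg (by positivity), e,
        ← mul_div_assoc]
      gcongr
      exact h v (le_of_lt hv)
  have h0 : Tendsto (fun v => airyAiDeriv (-v) / v) atTop (𝓝 0) := by
    have h1 : Tendsto (fun v : ℝ => C * v ^ (-(1 / 2) : ℝ)) atTop (𝓝 0) := by
      simpa using (tendsto_rpow_neg_atTop (y := 1 / 2) (by norm_num)).const_mul C
    refine squeeze_zero_norm' ?_ h1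
    filter_upwards [eventually_ge_atTop 1] with v hv
    have hv0 : 0 < v := by linarith
    rw [norm_div, Real.norm_eq_abs, Real.norm_of_nonneg hv0.le, ← hsqrt v hv0, ← mul_div_assoc]
    gcongr
    exact h v hv
  have hlim := (tendsto_limUnder_of_hasDerivAt_of_integrableOn_Ioi hd hi).sub h0
  refine ⟨_, ((hlim.comp tendsto_neg_atBot_atTop)).congr fun v => ?_⟩
  simp

lemma exists_abs_airyPrimitive_le : ∃ K : ℝ, ∀ w : ℝ, |airyPrimitive w| ≤ K := by
  obtain ⟨l, hl⟩ := exists_tendsto_airyPrimitive_atTop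
  obtain ⟨m, hm⟩ := exists_tendsto_airyPrimitive_atBot
  obtain ⟨a, ha⟩ := eventually_atTop.1 (hl.abs.eventually (ge_mem_nhds (lt_add_one |l|)))
  obtain ⟨b, hb⟩ := eventually_atBot.1 (hm.abs.eventually (ge_mem_nhds (lt_add_one |m|)))
  obtain ⟨C, hC⟩ := isCompact_Icc.exists_bound_of_continuousOn
    (continuous_airyPrimitive.continuousOn (s := Set.Icc b a))
  refine ⟨max C (max (|l| + 1) (|m| + 1)), fun w => ?_⟩
  rcases le_total a w with h1 | h1
  · exact (ha w h1).trans ((le_max_left _ _).trans (le_max_right _ _))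
  rcases le_total w b with h2 | h2
  · exact (hb w h2).trans ((le_max_right _ _).trans (le_max_right _ _))
  · exact (hC w ⟨h2, h1⟩).trans (le_max_left _ _)

section TestFunction

variable {φ : ℝ → ℝ}

/-- Moving the derivative to the test function replaces the kernel by a bounded function of `x` and
`s`, so that dominated convergence applies as `s → 0`. -/
lemma integral_mul_thirdOrderKernel (hφ : ContDiff ℝ ((⊤ : ℕ∞) : WithTop ℕ∞) φ)
    (hc : HasCompactSupport φ) (s : ℝ) :
    ∫ x, φ x * thirdOrderKernel x s = -∫ x, deriv φ x * airyPrimitive (x * airyScale s) := by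
  have hφ1 : ContDiff ℝ 1 φ := hφ.of_le (by exact_mod_cast le_top)
  have hd : ∀ x, HasDerivAt (fun x => airyPrimitive (x * airyScale s)) (thirdOrderKernel x s) x :=
    fun x => by
      have h := (hasDerivAt_airyPrimitive (x * airyScale s)).comp x
        ((hasDerivAt_id x).mul_const (airyScale s))
      refine h.congr_deriv ?_
      rw [thirdOrderKernel_eq]; ring
  have hp : Continuous fun x => airyPrimitive (x * airyScale s) :=
    continuous_airyPrimitive.comp (by fun_prop)
  refine integral_mul_deriv_eq_deriv_mul_of_integrable
    (fun x _ => (hφ1.differentiable (by norm_num)).differentiableAt.hasDerivAt)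
    (fun x _ => hd x) ?_ ?_ ?_
  · exact (hφ.continuous.mul (contDiff_thirdOrderKernel s).continuous).integrable_of_hasCompactSupport
      hc.mul_right
  · exact ((hφ1.continuous_deriv le_rfl).mul hp).integrable_of_hasCompactSupport
      hc.deriv.mul_right
  · exact (hφ.continuous.mul hp).integrable_of_hasCompactSupport hc.mul_right

lemma exists_abs_integral_mul_thirdOrderKernel_le (hφ : ContDiff ℝ ((⊤ : ℕ∞) : WithTop ℕ∞) φ)
    (hc : HasCompactSupport φ) : ∃ K : ℝ, ∀ s : ℝ, |∫ x, φ x * thirdOrderKernel x s| ≤ K := by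
  obtain ⟨K, hK⟩ := exists_abs_airyPrimitive_le
  have hφ1 : ContDiff ℝ 1 φ := hφ.of_le (by exact_mod_cast le_top)
  have hi : Integrable (deriv φ) :=
    (hφ1.continuous_deriv le_rfl).integrable_of_hasCompactSupport hc.deriv
  refine ⟨∫ x, |deriv φ x| * K, fun s => ?_⟩
  rw [integral_mul_thirdOrderKernel hφ hc, abs_neg]
  rw [← Real.norm_eq_abs]
  refine norm_integral_le_of_norm_le (hi.abs.mul_const K) (ae_of_all _ fun x => ?_)
  rw [norm_mul, Real.norm_eq_abs, Real.norm_eq_abs]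
  gcongr
  exact hK _

/-- As `s → 0` the argument `x airyScale s` tends to `±∞` with the sign of `x`, so the primitive
converges to a step function with jump `l - m` at `0`. -/
lemma tendsto_integral_mul_thirdOrderKernel_aux {l m : ℝ}
    (hl : Tendsto airyPrimitive atTop (𝓝 l)) (hm : Tendsto airyPrimitive atBot (𝓝 m))
    (hφ : ContDiff ℝ ((⊤ : ℕ∞) : WithTop ℕ∞) φ) (hc : HasCompactSupport φ) :
    Tendsto (fun s => ∫ x, φ x * thirdOrderKernel x s) (𝓝[>] 0) (𝓝 ((l - m) * φ 0)) := by
  obtain ⟨K, hK⟩ := exists_abs_airyPrimitive_le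
  have hφ1 : ContDiff ℝ 1 φ := hφ.of_le (by exact_mod_cast le_top)
  have hi : Integrable (deriv φ) :=
    (hφ1.continuous_deriv le_rfl).integrable_of_hasCompactSupport hc.deriv
  have hlim : Tendsto (fun s => ∫ x, deriv φ x * airyPrimitive (x * airyScale s)) (𝓝[>] 0)
      (𝓝 (∫ x, deriv φ x * if 0 < x then l else m)) := by
    refine tendsto_integral_filter_of_dominated_convergence (fun x => |deriv φ x| * K)
      (Eventually.of_forall fun s => hi.aestronglyMeasurable.mul
        (continuous_airyPrimitive.comp (by fun_prop :
          Continuous fun x => x * airyScale s)).aestronglyMeasurable)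
      (Eventually.of_forall fun s => ae_of_all _ fun x => ?_) (hi.abs.mul_const K) ?_
    · rw [norm_mul, Real.norm_eq_abs, Real.norm_eq_abs]
      gcongr
      exact hK _
    · filter_upwards [compl_mem_ae_iff.2 (measure_singleton (μ := (volume : Measure ℝ)) 0)]
        with x hx
      refine Tendsto.const_mul _ ?_
      rcases lt_or_gt_of_ne (show x ≠ 0 from hx) with h | h
      · rw [if_neg h.not_gt]
        exact hm.comp (tendsto_airyScale_nhdsGT_zero.const_mul_atTop_of_neg h)
      · rw [if_pos h]
        exact hl.comp (tendsto_airyScale_nhdsGT_zero.const_mul_atTop h)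
  have e : ∫ x, deriv φ x * (if 0 < x then l else m) = -((l - m) * φ 0) := by
    have e1 : Set.EqOn (fun x => deriv φ x * if 0 < x then l else m) (fun x => deriv φ x * m)
        (Set.Iic 0) := fun x hx => by simp [not_lt.2 (show x ≤ 0 from hx)]
    have e2 : Set.EqOn (fun x => deriv φ x * if 0 < x then l else m) (fun x => deriv φ x * l)
        (Set.Ioi 0) := fun x hx => by simp [show 0 < x from hx]
    rw [← intervalIntegral.integral_Iic_add_Ioi (b := 0)
      (IntegrableOn.congr_fun (hi.mul_const m).integrableOn e1.symm measurableSet_Iic)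
      (IntegrableOn.congr_fun (hi.mul_const l).integrableOn e2.symm measurableSet_Ioi),
      setIntegral_congr_fun measurableSet_Iic e1, setIntegral_congr_fun measurableSet_Ioi e2,
      integral_mul_const, integral_mul_const, hc.integral_Iic_deriv_eq hφ1,
      hc.integral_Ioi_deriv_eq hφ1]
    ring
  rw [e] at hlim
  simpa only [integral_mul_thirdOrderKernel hφ hc, neg_neg] using hlim.neg

lemma integral_integral_mul_thirdOrderKernel (hφ : ContDiff ℝ ((⊤ : ℕ∞) : WithTop ℕ∞) φ)
    (hc : HasCompactSupport φ) {r : ℝ} (hr : 0 < r) :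
    ∫ s in Set.Ioi (0 : ℝ), (∫ x, φ x * thirdOrderKernel x s) * stableThirdDensity r s =
      ∫ x, φ x * skewCauchyDensity r x := by
  obtain ⟨C, hC, h⟩ := exists_abs_thirdOrderKernel_le
  have hi : Integrable φ := hφ.continuous.integrable_of_hasCompactSupport hc
  have hint : Integrable (Function.uncurry fun (x s : ℝ) => φ x * (thirdOrderKernel x s *
      stableThirdDensity r s)) (volume.prod (volume.restrict (Set.Ioi 0))) := by
    have hdom := (hi.abs.const_mul C).mul_prod (integrableOn_airyScale_mul_stableThirdDensity hr)
    refine hdom.mono' ?_ ?_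
    · exact ((hφ.continuous.measurable.comp measurable_fst).mul (measurable_thirdOrderKernel.mul
        (measurable_stableThirdDensity.comp
          (measurable_const.prodMk measurable_snd)))).aestronglyMeasurable
    · have hs : ∀ᵐ q : ℝ × ℝ ∂(volume.prod (volume.restrict (Set.Ioi 0))), 0 < q.2 :=
        Measure.quasiMeasurePreserving_snd.ae (ae_restrict_mem measurableSet_Ioi)
      filter_upwards [hs] with q hq
      have hp := stableThirdDensity_nonneg hr hq
      simp only [Function.uncurry, norm_mul, Real.norm_eq_abs, abs_of_nonneg hp]
      calc |φ q.1| * (|thirdOrderKernel q.1 q.2| * stableThirdDensity r q.2)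
          ≤ |φ q.1| * (C * airyScale q.2 * stableThirdDensity r q.2) := by
            gcongr
            exact h _ _ hq
        _ = _ := by ring
  calc _ = ∫ s in Set.Ioi (0 : ℝ), ∫ x, φ x * (thirdOrderKernel x s * stableThirdDensity r s) := by
        refine integral_congr_ae (ae_of_all _ fun s => ?_)
        simp only [← integral_mul_const, mul_assoc]
    _ = ∫ x, ∫ s in Set.Ioi (0 : ℝ), φ x * (thirdOrderKernel x s * stableThirdDensity r s) :=
        (integral_integral_swap hint).symm
    _ = _ := by
        simp only [integral_const_mul, integral_kernel_mul_stableThirdDensity _ hr]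

lemma tendsto_integral_mul_skewCauchyDensity (hφ : Continuous φ) (hc : HasCompactSupport φ) :
    Tendsto (fun r => ∫ x, φ x * skewCauchyDensity r x) (𝓝[>] 0) (𝓝 (φ 0)) := by
  obtain ⟨K, hK⟩ := hc.exists_bound_of_continuous hφ
  have hi := integrable_skewCauchyDensity one_pos
  have e : ∀ r : ℝ, 0 < r → ∫ x, φ x * skewCauchyDensity r x =
      ∫ y, φ (r * y) * skewCauchyDensity 1 y := fun r hr => by
    rw [integral_comp_affine hr 0]
    refine integral_congr_ae (ae_of_all _ fun y => ?_)
    have h1 := skewCauchy_quadratic_pos one_pos y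
    have h2 : r * skewCauchyDensity r (r * y) = skewCauchyDensity 1 y := by
      rw [skewCauchyDensity, skewCauchyDensity, show (r * y) ^ 2 + r * y * r + r ^ 2 =
        r ^ 2 * (y ^ 2 + y * 1 + 1 ^ 2) by ring]
      field_simp
    simp only [add_zero, smul_eq_mul, ← h2]
    ring
  have hlim : Tendsto (fun r => ∫ y, φ (r * y) * skewCauchyDensity 1 y) (𝓝[>] 0)
      (𝓝 (∫ y, φ 0 * skewCauchyDensity 1 y)) := by
    refine tendsto_integral_filter_of_dominated_convergence
      (fun y => K * skewCauchyDensity 1 y)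
      (Eventually.of_forall fun r => ((hφ.comp (by fun_prop)).aestronglyMeasurable).mul
        hi.aestronglyMeasurable)
      (Eventually.of_forall fun r => ae_of_all _ fun y => ?_) (hi.const_mul K)
      (ae_of_all _ fun y => ?_)
    · have hp := (skewCauchyDensity_pos one_pos y).le
      rw [norm_mul, Real.norm_of_nonneg hp]
      gcongr
      exact hK _
    · have hc' : Continuous fun r => φ (r * y) * skewCauchyDensity 1 y :=
        (hφ.comp (by fun_prop)).mul continuous_const
      simpa using (hc'.tendsto 0).mono_left (nhdsWithin_le_nhds (s := Set.Ioi 0))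
  rw [integral_const_mul, integral_skewCauchyDensity one_pos, mul_one] at hlim
  refine hlim.congr' ?_
  filter_upwards [self_mem_nhdsWithin] with r hr using (e r hr).symm

/-- By scaling, the stable time is `r³ s` with `s` of a fixed law of mass one, and tends to `0` with
`r`; averaging over it does not change the limit. -/
lemma tendsto_integral_integral_mul_thirdOrderKernel {l : ℝ}
    (hφ : ContDiff ℝ ((⊤ : ℕ∞) : WithTop ℕ∞) φ) (hc : HasCompactSupport φ)
    (hl : Tendsto (fun s => ∫ x, φ x * thirdOrderKernel x s) (𝓝[>] 0) (𝓝 l)) :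
    Tendsto (fun r => ∫ s in Set.Ioi (0 : ℝ),
      (∫ x, φ x * thirdOrderKernel x s) * stableThirdDensity r s) (𝓝[>] 0) (𝓝 l) := by
  obtain ⟨K, hK⟩ := exists_abs_integral_mul_thirdOrderKernel_le hφ hc
  have hi := integrableOn_stableThirdDensity one_pos
  have hm : Measurable fun s => ∫ x, φ x * thirdOrderKernel x s := by
    have : StronglyMeasurable (Function.uncurry fun x s => φ x * thirdOrderKernel x s) :=
      ((hφ.continuous.measurable.comp measurable_fst).mul
        measurable_thirdOrderKernel).stronglyMeasurable
    exact this.integral_prod_left.measurable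
  have e : ∀ r : ℝ, 0 < r → ∫ s in Set.Ioi (0 : ℝ),
      (∫ x, φ x * thirdOrderKernel x s) * stableThirdDensity r s = ∫ s in Set.Ioi (0 : ℝ),
      (∫ x, φ x * thirdOrderKernel x (r ^ 3 * s)) * stableThirdDensity 1 s := fun r hr => by
    have h := integral_comp_mul_left_Ioi (fun s : ℝ =>
      (∫ x, φ x * thirdOrderKernel x s) * stableThirdDensity r s) 0 (pow_pos hr 3)
    rw [mul_zero, eq_inv_smul_iff₀ (by positivity)] at h
    rw [← h, ← integral_smul]
    refine setIntegral_congr_fun measurableSet_Ioi fun s hs => ?_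
    simp only [← stableThirdDensity_mul hr hs, smul_eq_mul]
    ring
  have hlim : Tendsto (fun r => ∫ s in Set.Ioi (0 : ℝ),
      (∫ x, φ x * thirdOrderKernel x (r ^ 3 * s)) * stableThirdDensity 1 s) (𝓝[>] 0)
      (𝓝 (∫ s in Set.Ioi (0 : ℝ), l * stableThirdDensity 1 s)) := by
    refine tendsto_integral_filter_of_dominated_convergence
      (fun s => K * |stableThirdDensity 1 s|)
      (Eventually.of_forall fun r =>
        ((hm.comp (measurable_id.const_mul (r ^ 3))).aestronglyMeasurable).mul
        hi.aestronglyMeasurable)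
      (Eventually.of_forall fun r => ae_of_all _ fun s => ?_) (hi.abs.const_mul K)
      ((ae_restrict_iff' measurableSet_Ioi).2 (ae_of_all _ fun s hs => ?_))
    · rw [norm_mul, Real.norm_eq_abs, Real.norm_eq_abs]
      gcongr
      exact hK _
    · refine Tendsto.mul_const _ (hl.comp ?_)
      refine tendsto_nhdsWithin_iff.2 ⟨?_, ?_⟩
      · have hc' : Continuous fun r : ℝ => r ^ 3 * s := by fun_prop
        simpa using (hc'.tendsto 0).mono_left (nhdsWithin_le_nhds (s := Set.Ioi 0))
      · filter_upwards [self_mem_nhdsWithin] with r hr using mul_pos (pow_pos (Set.mem_Ioi.1 hr) 3)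
          (Set.mem_Ioi.1 hs)
  rw [integral_const_mul, integral_stableThirdDensity_one, mul_one] at hlim
  refine hlim.congr' ?_
  filter_upwards [self_mem_nhdsWithin] with r hr using (e r hr).symm

end TestFunction

/-- The total (conditionally convergent) mass of the Airy function is `1`. -/
lemma airyPrimitive_limit_sub_eq_one {l m : ℝ} (hl : Tendsto airyPrimitive atTop (𝓝 l))
    (hm : Tendsto airyPrimitive atBot (𝓝 m)) : l - m = 1 := by
  let φ : ContDiffBump (0 : ℝ) := ⟨1, 2, one_pos, one_lt_two⟩
  have h0 : φ 0 = 1 := φ.one_of_mem_closedBall (by simp [φ])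
  -- The test integral averaged over the time `T_{1/3}(r)` has two limits as `r → 0`: `(l - m) φ(0)`
  -- from the kernel and `φ(0)` from the Cauchy density. A bump function with `φ(0) = 1` compares
  -- them.
  have h1 := tendsto_integral_mul_thirdOrderKernel_aux hl hm φ.contDiff φ.hasCompactSupport
  have h2 := tendsto_integral_integral_mul_thirdOrderKernel φ.contDiff φ.hasCompactSupport h1
  have h3 := tendsto_integral_mul_skewCauchyDensity φ.continuous φ.hasCompactSupport
  have h4 := tendsto_nhds_unique h2 (h3.congr' ?_)
  · rwa [h0, mul_one] at h4
  · filter_upwards [self_mem_nhdsWithin] with r hr using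
      (integral_integral_mul_thirdOrderKernel φ.contDiff φ.hasCompactSupport hr).symm

theorem isThirdOrderFundamentalSolution_thirdOrderKernel :
    IsThirdOrderFundamentalSolution thirdOrderKernel where
  contDiff t _ := contDiff_thirdOrderKernel t
  equation t ht x := by
    rw [iteratedDeriv_three_thirdOrderKernel]
    exact hasDerivAt_kernel_time x ht
  initial φ hφ hc := by
    obtain ⟨l, hl⟩ := exists_tendsto_airyPrimitive_atTop
    obtain ⟨m, hm⟩ := exists_tendsto_airyPrimitive_atBot
    have h := tendsto_integral_mul_thirdOrderKernel_aux hl hm hφ hc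
    rwa [airyPrimitive_limit_sub_eq_one hl hm, one_mul] at h

/-! ### A random function evaluated at an independent random time -/

section IndepComp

variable {Ω Ω' E : Type*} [MeasurableSpace Ω] {mΩ' : MeasurableSpace Ω'} {P : Measure Ω}
  [IsProbabilityMeasure P] [NormedAddCommGroup E] [NormedSpace ℝ E]
  {R : Ω → ℝ} {X : Ω → Ω'} {G : ℝ → Ω' → ℝ}

/-- Independence makes the law of `(R, X)` a product, and Fubini freezes the random time. The target
of `X` has its own σ-algebra so that `X` can be the identity into `(Ω, m 0)`, which carries a whole
random function. -/
lemma integral_comp_of_indepFun (hR : Measurable R) (hX : Measurable X)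
    (hG : Measurable (Function.uncurry G)) (hi : IndepFun R X P) {g : ℝ → E}
    (hg : StronglyMeasurable g) (hint : Integrable (fun ω => g (G (R ω) (X ω))) P) :
    Integrable (fun ω => ∫ ω', g (G (R ω) (X ω')) ∂P) P ∧
      ∫ ω, g (G (R ω) (X ω)) ∂P = ∫ ω, ∫ ω', g (G (R ω) (X ω')) ∂P ∂P := by
  have hmap := (indepFun_iff_map_prod_eq_prod_map_map hR.aemeasurable hX.aemeasurable).1 hi
  have hRX : Measurable fun ω => (R ω, X ω) := hR.prodMk hX
  have hPX : IsProbabilityMeasure (P.map X) := Measure.isProbabilityMeasure_map hX.aemeasurable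
  have hPR : IsProbabilityMeasure (P.map R) := Measure.isProbabilityMeasure_map hR.aemeasurable
  have hh : StronglyMeasurable fun q : ℝ × Ω' => g (G q.1 q.2) := hg.comp_measurable hG
  have hint2 : Integrable (fun q : ℝ × Ω' => g (G q.1 q.2)) ((P.map R).prod (P.map X)) := by
    rw [← hmap]
    exact (integrable_map_measure hh.aestronglyMeasurable hRX.aemeasurable).2 hint
  have hinner : ∀ r : ℝ, ∫ y, g (G r y) ∂(P.map X) = ∫ ω', g (G r (X ω')) ∂P := fun r =>
    integral_map hX.aemeasurable
      (hh.comp_measurable (measurable_prodMk_left (x := r))).aestronglyMeasurable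
  have hleft := hint2.integral_prod_left
  simp only [hinner] at hleft
  refine ⟨(integrable_map_measure hleft.aestronglyMeasurable hR.aemeasurable).1 hleft, ?_⟩
  have h := integral_prod _ hint2
  rw [← hmap, integral_map hRX.aemeasurable hh.aestronglyMeasurable] at h
  rw [h]
  simp only [hinner]
  exact integral_map hR.aemeasurable hleft.aestronglyMeasurable

lemma ae_comp_of_indepFun (hR : Measurable R) (hX : Measurable X)
    (hG : Measurable (Function.uncurry G)) (hi : IndepFun R X P) {A : Set ℝ}
    (hA : MeasurableSet A) (h : ∀ᵐ ω ∂P, ∀ᵐ ω' ∂P, G (R ω) (X ω') ∈ A) :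
    ∀ᵐ ω ∂P, G (R ω) (X ω) ∈ A := by
  have hmap := (indepFun_iff_map_prod_eq_prod_map_map hR.aemeasurable hX.aemeasurable).1 hi
  have hRX : Measurable fun ω => (R ω, X ω) := hR.prodMk hX
  have hPX : IsProbabilityMeasure (P.map X) := Measure.isProbabilityMeasure_map hX.aemeasurable
  have hB : MeasurableSet {q : ℝ × Ω' | G q.1 q.2 ∈ A} := hG hA
  refine (ae_map_iff hRX.aemeasurable hB).1 ?_
  rw [hmap]
  refine (Measure.ae_prod_mem_iff_ae_ae_mem hB).2 ?_
  have hC : MeasurableSet {r : ℝ | ∀ᵐ y ∂(P.map X), (r, y) ∈ {q : ℝ × Ω' | G q.1 q.2 ∈ A}} := by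
    have hm := measurable_measure_prodMk_left (ν := P.map X) hB.compl
    have : {r : ℝ | ∀ᵐ y ∂(P.map X), (r, y) ∈ {q : ℝ × Ω' | G q.1 q.2 ∈ A}} =
        {r : ℝ | P.map X (Prod.mk r ⁻¹' {q : ℝ × Ω' | G q.1 q.2 ∈ A}ᶜ) = 0} := rfl
    rw [this]
    exact hm (measurableSet_singleton 0)
  rw [ae_map_iff hR.aemeasurable hC]
  filter_upwards [h] with ω hω
  exact (ae_map_iff hX.aemeasurable (measurable_prodMk_left (x := R ω) hB)).2 hω

end IndepComp

/-! ### Iterated stable times -/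

lemma iteratedTime_zero {Ω : Type*} (T : Fin 0 → ℝ → Ω → ℝ) (t : ℝ) (ω : Ω) : iteratedTime T t ω = t := by
  simp [iteratedTime]

lemma iteratedTime_succ {Ω : Type*} {n : ℕ} (T : Fin (n + 1) → ℝ → Ω → ℝ) (t : ℝ) (ω : Ω) :
    iteratedTime T t ω = T 0 (iteratedTime (fun j => T j.succ) t ω) ω := by
  simp [iteratedTime, Fin.foldr_succ]

/-- Measurability with respect to the join of the `m j`, rather than the ambient σ-algebra, is what
makes the inner iterated time independent of `m 0`. -/
lemma measurable_iteratedTime_iSup {Ω : Type*} {n : ℕ} (T : Fin n → ℝ → Ω → ℝ)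
    (m : Fin n → MeasurableSpace Ω)
    (hT : ∀ j, @Measurable (ℝ × Ω) ℝ (@Prod.instMeasurableSpace ℝ Ω (borel ℝ) (m j)) (borel ℝ)
      (fun p => T j p.1 p.2)) (t : ℝ) :
    @Measurable Ω ℝ (⨆ j, m j) (borel ℝ) (iteratedTime T t) := by
  induction n with
  | zero =>
    have : iteratedTime T t = fun _ => t := funext fun ω => iteratedTime_zero T t ω
    rw [this]
    exact measurable_const
  | succ n ih =>
    have h1 := ih (fun j => T j.succ) (fun j => m j.succ) (fun j => hT j.succ)
    have hle : (⨆ j : Fin n, m j.succ) ≤ ⨆ j, m j := iSup_le fun j => le_iSup m j.succ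
    have : iteratedTime T t = (fun p : ℝ × Ω => T 0 p.1 p.2) ∘
        fun ω => (iteratedTime (fun j => T j.succ) t ω, ω) :=
      funext fun ω => iteratedTime_succ T t ω
    rw [this]
    refine @Measurable.comp _ _ _ (⨆ j, m j) (@Prod.instMeasurableSpace ℝ Ω (borel ℝ) (m 0))
      (borel ℝ) _ _ (hT 0) ?_
    exact @Measurable.prodMk Ω (⨆ j, m j) ℝ Ω (borel ℝ) (m 0) _ _
      (h1.mono hle le_rfl) (measurable_id'' (le_iSup m 0))

section IteratedTime

variable {Ω : Type*} [mΩ : MeasurableSpace Ω] {P : Measure Ω}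

namespace IsIndepStableThirdFamily

variable {n : ℕ}

lemma measurable_iteratedTime {T : Fin n → ℝ → Ω → ℝ} (hT : IsIndepStableThirdFamily P T)
    (t : ℝ) : Measurable (iteratedTime T t) := by
  obtain ⟨m, hle, _, hm⟩ := hT.indep
  exact (measurable_iteratedTime_iSup T m hm t).mono (iSup_le hle) le_rfl

lemma measurable_apply {T : Fin n → ℝ → Ω → ℝ} (hT : IsIndepStableThirdFamily P T)
    (j : Fin n) (t : ℝ) : Measurable (T j t) := by
  obtain ⟨m, hle, _, hm⟩ := hT.indep
  have h : @Measurable Ω ℝ (m j) (borel ℝ) (T j t) :=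
    @Measurable.comp _ _ _ (m j) (@Prod.instMeasurableSpace ℝ Ω (borel ℝ) (m j)) (borel ℝ) _ _
      (hm j) (@measurable_prodMk_left ℝ Ω (borel ℝ) (m j) t)
  exact h.mono (hle j) le_rfl

lemma tail {T : Fin (n + 1) → ℝ → Ω → ℝ} (hT : IsIndepStableThirdFamily P T) :
    IsIndepStableThirdFamily P fun j => T j.succ where
  indep := by
    obtain ⟨m, hle, hi, hm⟩ := hT.indep
    exact ⟨fun j => m j.succ, fun j => hle _, hi.precomp (Fin.succ_injective n), fun j => hm _⟩
  law j := hT.law j.succ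

/-- The inner time is measurable for the join of the `m j` with `j ≠ 0`, which is independent of `m
0`. The random function `T 0` enters through the identity map into `(Ω, m 0)`. -/
lemma exists_indepFun {T : Fin (n + 1) → ℝ → Ω → ℝ} (hT : IsIndepStableThirdFamily P T) (t : ℝ) :
    ∃ m : Fin (n + 1) → MeasurableSpace Ω, m 0 ≤ mΩ ∧
      @Measurable (ℝ × Ω) ℝ (@Prod.instMeasurableSpace ℝ Ω (borel ℝ) (m 0)) (borel ℝ)
        (Function.uncurry (T 0)) ∧
      @IndepFun Ω ℝ Ω _ _ (m 0) (iteratedTime (fun j => T j.succ) t) id P := by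
  obtain ⟨m, hle, hi, hm⟩ := hT.indep
  refine ⟨m, hle 0, hm 0, ?_⟩
  have hd : Disjoint {j : Fin (n + 1) | j ≠ 0} {0} := by
    rw [Set.disjoint_singleton_right]
    simp
  have h := indep_iSup_of_disjoint hle hi hd
  have hR := measurable_iteratedTime_iSup (fun j : Fin n => T j.succ) (fun j => m j.succ)
    (fun j => hm j.succ) t
  refine (@IndepFun_iff_Indep Ω ℝ Ω mΩ _ (m 0) _ _ P).2 ?_
  refine indep_of_indep_of_le_left (indep_of_indep_of_le_right h ?_) ?_
  · have h0 : m 0 ≤ ⨆ j ∈ ({0} : Set (Fin (n + 1))), m j :=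
      le_iSup₂_of_le 0 (Set.mem_singleton 0) le_rfl
    rintro _ ⟨A, hA, rfl⟩
    exact h0 A hA
  · refine hR.comap_le.trans (iSup_le fun j => ?_)
    exact le_iSup₂_of_le j.succ (Fin.succ_ne_zero j) le_rfl

lemma ae_pos_apply [IsProbabilityMeasure P] {T : Fin n → ℝ → Ω → ℝ}
    (hT : IsIndepStableThirdFamily P T) (j : Fin n) {t : ℝ} (ht : 0 < t) :
    ∀ᵐ ω ∂P, T j t ω ∈ Set.Ioi (0 : ℝ) := by
  refine (ae_map_iff (hT.measurable_apply j t).aemeasurable measurableSet_Ioi).1 ?_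
  rw [hT.law j t ht]
  exact (withDensity_absolutelyContinuous _ _).ae_le (ae_restrict_mem measurableSet_Ioi)

lemma integral_apply {E : Type*} [NormedAddCommGroup E] [NormedSpace ℝ E]
    {T : Fin n → ℝ → Ω → ℝ} (hT : IsIndepStableThirdFamily P T) (j : Fin n) {t : ℝ} (ht : 0 < t)
    {g : ℝ → E} (hg : StronglyMeasurable g) :
    ∫ ω, g (T j t ω) ∂P = ∫ s in Set.Ioi (0 : ℝ), stableThirdDensity t s • g s := by
  rw [← integral_map (hT.measurable_apply j t).aemeasurable hg.aestronglyMeasurable,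
    hT.law j t ht, integral_withDensity_eq_integral_toReal_smul]
  · refine setIntegral_congr_fun measurableSet_Ioi fun s hs => ?_
    simp only [ENNReal.toReal_ofReal (stableThirdDensity_nonneg ht hs)]
  · exact (measurable_stableThirdDensity.comp measurable_prodMk_left).ennreal_ofReal
  · exact ae_of_all _ fun s => ENNReal.ofReal_lt_top

variable [IsProbabilityMeasure P]

lemma ae_pos_iteratedTime {T : Fin n → ℝ → Ω → ℝ} (hT : IsIndepStableThirdFamily P T) {t : ℝ}
    (ht : 0 < t) : ∀ᵐ ω ∂P, 0 < iteratedTime T t ω := by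
  induction n with
  | zero => exact ae_of_all _ fun ω => by rwa [iteratedTime_zero]
  | succ n ih =>
    obtain ⟨m, hle, hm, hi⟩ := hT.exists_indepFun t
    simp only [iteratedTime_succ]
    refine ae_comp_of_indepFun (mΩ' := m 0) (X := id) (G := T 0) (A := Set.Ioi 0)
      (hT.tail.measurable_iteratedTime t) (measurable_id'' hle) hm hi measurableSet_Ioi ?_
    filter_upwards [ih hT.tail] with ω hω using hT.ae_pos_apply 0 hω

/-- Integrates out the outermost layer `T 0`. It is applied to exponentials, for the Laplace
transform, and to `u₃(x, ·)`, for the Cauchy mixture. -/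
lemma integral_iteratedTime_succ {E : Type*} [NormedAddCommGroup E] [NormedSpace ℝ E]
    {T : Fin (n + 1) → ℝ → Ω → ℝ} (hT : IsIndepStableThirdFamily P T) {t : ℝ} (ht : 0 < t)
    {g : ℝ → E} (hg : StronglyMeasurable g)
    (hint : Integrable (fun ω => g (iteratedTime T t ω)) P) {h : ℝ → E}
    (hh : ∀ r : ℝ, 0 < r → ∫ s in Set.Ioi (0 : ℝ), stableThirdDensity r s • g s = h r) :
    Integrable (fun ω => h (iteratedTime (fun j => T j.succ) t ω)) P ∧
      ∫ ω, g (iteratedTime T t ω) ∂P =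
        ∫ ω, h (iteratedTime (fun j => T j.succ) t ω) ∂P := by
  obtain ⟨m, hle, hm, hi⟩ := hT.exists_indepFun t
  simp only [iteratedTime_succ T] at hint ⊢
  have key := integral_comp_of_indepFun (mΩ' := m 0) (X := id) (G := T 0)
    (hT.tail.measurable_iteratedTime t) (measurable_id'' hle) hm hi hg hint
  have e : (fun ω => ∫ ω', g (T 0 (iteratedTime (fun j => T j.succ) t ω) (id ω')) ∂P) =ᵐ[P]
      fun ω => h (iteratedTime (fun j => T j.succ) t ω) := by
    filter_upwards [hT.tail.ae_pos_iteratedTime ht] with ω hω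
    rw [← hh _ hω]
    exact hT.integral_apply 0 hω hg
  exact ⟨key.1.congr e, key.2.trans (integral_congr_ae e)⟩

lemma integrable_exp_neg_mul_iteratedTime {T : Fin n → ℝ → Ω → ℝ}
    (hT : IsIndepStableThirdFamily P T) {t : ℝ} (ht : 0 < t) {z : ℂ} (hz : 0 ≤ z.re) :
    Integrable (fun ω => Complex.exp (-z * (iteratedTime T t ω : ℝ))) P := by
  have hm := hT.measurable_iteratedTime t
  refine (integrable_const (1 : ℝ)).mono' (by fun_prop) ?_
  filter_upwards [hT.ae_pos_iteratedTime ht] with ω hω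
  rw [norm_exp_neg_mul]
  refine Real.exp_le_one_iff.2 ?_
  have := mul_nonneg hz hω.le
  linarith

/-- The Laplace transform of the iterated stable time, on the right half-plane. -/
lemma integral_exp_neg_mul_iteratedTime {T : Fin n → ℝ → Ω → ℝ}
    (hT : IsIndepStableThirdFamily P T) {t : ℝ} (ht : 0 < t) {l : ℂ}
    (hl : |l.im| < Real.pi / 2) :
    ∫ ω, Complex.exp (-Complex.exp l * (iteratedTime T t ω : ℝ)) ∂P =
      Complex.exp (-Complex.exp (l / 3 ^ n) * t) := by
  induction n generalizing l with
  | zero => simp [iteratedTime_zero]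
  | succ n ih =>
    have hl3 : |(l / 3).im| < Real.pi / 2 := by
      rw [show (l / 3).im = l.im / 3 by simp, abs_div, abs_of_pos (by norm_num : (0 : ℝ) < 3)]
      have := abs_nonneg l.im
      linarith
    have key := (hT.integral_iteratedTime_succ ht
      (g := fun s : ℝ => Complex.exp (-Complex.exp l * s))
      (by fun_prop : Measurable _).stronglyMeasurable
      (hT.integrable_exp_neg_mul_iteratedTime ht (exp_re_pos hl).le)
      (h := fun r : ℝ => Complex.exp (-Complex.exp (l / 3) * r)) fun r hr => ?_).2
    · rw [key, ih hT.tail hl3, div_div, pow_succ']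
    · rw [← timeLaplace_stableThirdDensity hl hr, timeLaplace]
      refine integral_congr_ae (ae_of_all _ fun s => ?_)
      simp only [Complex.real_smul]
      ring

lemma integral_exp_neg_mul_iteratedTime_real {T : Fin n → ℝ → Ω → ℝ}
    (hT : IsIndepStableThirdFamily P T) {t : ℝ} (ht : 0 < t) {a : ℝ} (ha : 0 < a) :
    ∫ ω, Real.exp (-a * iteratedTime T t ω) ∂P = Real.exp (-t * a ^ (1 / 3 ^ n : ℝ)) := by
  have h := hT.integral_exp_neg_mul_iteratedTime ht (l := (Real.log a : ℝ))
    (by simp; positivity)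
  have e1 : Complex.exp ((Real.log a : ℝ) : ℂ) = (a : ℂ) := by
    rw [← Complex.ofReal_exp, Real.exp_log ha]
  have e2 : Complex.exp (((Real.log a : ℝ) : ℂ) / 3 ^ n) = ((a ^ (1 / 3 ^ n : ℝ) : ℝ) : ℂ) := by
    rw [Real.rpow_def_of_pos ha, Complex.ofReal_exp]
    push_cast
    ring_nf
  rw [e1, e2] at h
  apply Complex.ofReal_injective
  rw [← integral_complex_ofReal]
  push_cast
  rw [h]
  ring_nf

/-- The moment of order `-1/3` of the iterated stable time is finite. -/
lemma integrable_airyScale_iteratedTime {T : Fin n → ℝ → Ω → ℝ}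
    (hT : IsIndepStableThirdFamily P T) {t : ℝ} (ht : 0 < t) :
    Integrable (fun ω => airyScale (iteratedTime T t ω)) P := by
  have hm := hT.measurable_iteratedTime t
  have hq : (0 : ℝ) < 1 / 3 ^ n := by positivity
  -- `Γ(1/3) S^{-1/3} = ∫ a^{-2/3} e^{-aS} da`. Taking the expectation first gives `∫ a^{-2/3}
  -- exp(-t a^{1/3ⁿ}) da`, which is finite.
  have hint : Integrable (fun q : Ω × ℝ => q.2 ^ (1 / 3 - 1 : ℝ) *
      Real.exp (-q.2 * iteratedTime T t q.1)) (P.prod (volume.restrict (Set.Ioi 0))) := by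
    have hmm : Measurable fun q : Ω × ℝ => q.2 ^ (1 / 3 - 1 : ℝ) *
        Real.exp (-q.2 * iteratedTime T t q.1) := by fun_prop
    refine (integrable_prod_iff' hmm.aestronglyMeasurable).2 ⟨?_, ?_⟩
    · refine (ae_restrict_iff' measurableSet_Ioi).2 (ae_of_all _ fun a ha => ?_)
      have h := (hT.integrable_exp_neg_mul_iteratedTime ht (z := (a : ℂ))
        (by simpa using le_of_lt ha)).norm
      simp only [norm_exp_neg_mul, Complex.ofReal_re] at h
      exact h.const_mul (a ^ (1 / 3 - 1 : ℝ))
    · refine IntegrableOn.congr_fun (integrableOn_rpow_mul_exp_neg_mul_rpow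
        (show -1 < (1 / 3 - 1 : ℝ) by norm_num) hq ht) (fun a ha => ?_) measurableSet_Ioi
      have ha0 : 0 < a := ha
      simp only [norm_mul, Real.norm_of_nonneg (Real.exp_nonneg _),
        Real.norm_of_nonneg (Real.rpow_nonneg ha0.le _)]
      rw [integral_const_mul, hT.integral_exp_neg_mul_iteratedTime_real ht ha0]
  have hg := Real.Gamma_pos_of_pos (show (0 : ℝ) < 1 / 3 by norm_num)
  refine (hint.integral_prod_left.const_mul ((3 : ℝ) ^ (-(1 / 3) : ℝ) /
    Real.Gamma (1 / 3))).congr ?_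
  filter_upwards [hT.ae_pos_iteratedTime ht] with ω hω
  have h := Real.integral_rpow_mul_exp_neg_mul_Ioi (a := 1 / 3) (by norm_num) hω
  have e : ∫ a in Set.Ioi (0 : ℝ), a ^ (1 / 3 - 1 : ℝ) * Real.exp (-a * iteratedTime T t ω) =
      (1 / iteratedTime T t ω) ^ (1 / 3 : ℝ) * Real.Gamma (1 / 3) := by
    rw [← h]
    refine setIntegral_congr_fun measurableSet_Ioi fun a _ => ?_
    ring_nf
  simp only [e]
  have h2 := airyScale_pow_eq hω 1
  simp only [pow_one, Nat.cast_one] at h2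
  rw [h2, one_div (iteratedTime T t ω), Real.inv_rpow hω.le, ← Real.rpow_neg hω.le]
  field_simp

lemma integrable_thirdOrderKernel_iteratedTime {T : Fin n → ℝ → Ω → ℝ}
    (hT : IsIndepStableThirdFamily P T) {t : ℝ} (ht : 0 < t) (x : ℝ) :
    Integrable (fun ω => thirdOrderKernel x (iteratedTime T t ω)) P := by
  obtain ⟨C, hC, h⟩ := exists_abs_thirdOrderKernel_le
  refine ((hT.integrable_airyScale_iteratedTime ht).const_mul C).mono' ?_ ?_
  · exact (measurable_thirdOrderKernel.comp (measurable_const.prodMk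
      (hT.measurable_iteratedTime t))).aestronglyMeasurable
  · filter_upwards [hT.ae_pos_iteratedTime ht] with ω hω using h x _ hω

/-! ### The density of the composition -/

variable {T : Fin (n + 1) → ℝ → Ω → ℝ} {t : ℝ}

/-- Only the outermost time is averaged: it turns the sign-varying kernel into a Cauchy density at
the inner time. Positivity and total mass one then follow from the Cauchy case. -/
lemma composedDensity_eq (hT : IsIndepStableThirdFamily P T) (ht : 0 < t) (x : ℝ) :
    Integrable (fun ω => skewCauchyDensity (iteratedTime (fun j => T j.succ) t ω) x) P ∧
      composedDensity P (iteratedTime T t) x =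
        ∫ ω, skewCauchyDensity (iteratedTime (fun j => T j.succ) t ω) x ∂P := by
  refine hT.integral_iteratedTime_succ ht
    (g := fun s => thirdOrderKernel x s) (h := fun r => skewCauchyDensity r x)
    (measurable_thirdOrderKernel.comp measurable_prodMk_left).stronglyMeasurable
    (hT.integrable_thirdOrderKernel_iteratedTime ht x) fun r hr => ?_
  simp only [← integral_kernel_mul_stableThirdDensity x hr, smul_eq_mul, mul_comm]

lemma composedDensity_pos (hT : IsIndepStableThirdFamily P T) (ht : 0 < t) (x : ℝ) :
    0 < composedDensity P (iteratedTime T t) x := by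
  obtain ⟨hi, he⟩ := hT.composedDensity_eq ht x
  have hpos : ∀ᵐ ω ∂P, 0 < skewCauchyDensity (iteratedTime (fun j => T j.succ) t ω) x := by
    filter_upwards [hT.tail.ae_pos_iteratedTime ht] with ω hω using skewCauchyDensity_pos hω x
  rw [he, integral_pos_iff_support_of_nonneg_ae (hpos.mono fun ω h => h.le) hi, pos_iff_ne_zero]
  intro h0
  obtain ⟨ω, h1, h2⟩ := (hpos.and (measure_eq_zero_iff_ae_notMem.1 h0)).exists
  exact h2 h1.ne'

lemma integrable_prod_skewCauchyDensity (hT : IsIndepStableThirdFamily P T) (ht : 0 < t) :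
    Integrable (fun q : Ω × ℝ =>
      skewCauchyDensity (iteratedTime (fun j => T j.succ) t q.1) q.2) (P.prod volume) := by
  have hm := hT.tail.measurable_iteratedTime t
  have hmm : Measurable fun q : Ω × ℝ =>
      skewCauchyDensity (iteratedTime (fun j => T j.succ) t q.1) q.2 :=
    measurable_skewCauchyDensity.comp ((hm.comp measurable_fst).prodMk measurable_snd)
  refine (integrable_prod_iff hmm.aestronglyMeasurable).2 ⟨?_, ?_⟩
  · filter_upwards [hT.tail.ae_pos_iteratedTime ht] with ω hω using
      integrable_skewCauchyDensity hω
  · refine (integrable_const (1 : ℝ)).congr ?_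
    filter_upwards [hT.tail.ae_pos_iteratedTime ht] with ω hω
    rw [← integral_skewCauchyDensity hω]
    exact integral_congr_ae (ae_of_all _ fun x =>
      (Real.norm_of_nonneg (skewCauchyDensity_pos hω x).le).symm)

lemma integrable_composedDensity (hT : IsIndepStableThirdFamily P T) (ht : 0 < t) :
    Integrable (composedDensity P (iteratedTime T t)) volume := by
  have h := (hT.integrable_prod_skewCauchyDensity ht).integral_prod_right
  refine h.congr (ae_of_all _ fun x => ?_)
  exact (hT.composedDensity_eq ht x).2.symm

lemma integral_exp_mul_composedDensity (hT : IsIndepStableThirdFamily P T) (ht : 0 < t) (β : ℝ) :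
    ∫ x : ℝ, Complex.exp (β * x * Complex.I) * (composedDensity P (iteratedTime T t) x : ℂ) =
      ∫ ω, Complex.exp (-((Real.sqrt 3 / 2 * |β| : ℝ) + (β / 2 : ℝ) * Complex.I) *
        (iteratedTime (fun j => T j.succ) t ω : ℝ)) ∂P := by
  have hint : Integrable (Function.uncurry fun (ω : Ω) (x : ℝ) =>
      Complex.exp (β * x * Complex.I) *
        (skewCauchyDensity (iteratedTime (fun j => T j.succ) t ω) x : ℂ)) (P.prod volume) := by
    refine Integrable.bdd_mul (c := 1) (hT.integrable_prod_skewCauchyDensity ht).ofReal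
      (by fun_prop : Measurable fun q : Ω × ℝ =>
        Complex.exp (β * q.2 * Complex.I)).aestronglyMeasurable (ae_of_all _ fun q => ?_)
    rw [← Complex.ofReal_mul, Complex.norm_exp_ofReal_mul_I]
  calc _ = ∫ x : ℝ, ∫ ω, Complex.exp (β * x * Complex.I) *
        (skewCauchyDensity (iteratedTime (fun j => T j.succ) t ω) x : ℂ) ∂P := by
        refine integral_congr_ae (ae_of_all _ fun x => ?_)
        simp only [(hT.composedDensity_eq ht x).2]
        rw [integral_const_mul, integral_complex_ofReal]
    _ = ∫ ω, (∫ x : ℝ, Complex.exp (β * x * Complex.I) *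
        (skewCauchyDensity (iteratedTime (fun j => T j.succ) t ω) x : ℂ)) ∂P :=
        (integral_integral_swap hint).symm
    _ = _ := by
        refine integral_congr_ae ?_
        filter_upwards [hT.tail.ae_pos_iteratedTime ht] with ω hω using
          integral_exp_mul_skewCauchyDensity hω β

lemma isProbabilityMeasure_composedLaw (hT : IsIndepStableThirdFamily P T) (ht : 0 < t) :
    IsProbabilityMeasure (composedLaw P (iteratedTime T t)) := by
  have h := hT.integral_exp_mul_composedDensity ht 0
  simp only [Complex.ofReal_zero, zero_mul, Complex.exp_zero, one_mul, abs_zero, mul_zero,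
    zero_div, add_zero, neg_zero, integral_const, probReal_univ, one_smul] at h
  rw [integral_complex_ofReal] at h
  have h1 : ∫ x, composedDensity P (iteratedTime T t) x = 1 := by exact_mod_cast h
  refine ⟨?_⟩
  rw [composedLaw, withDensity_apply _ MeasurableSet.univ, Measure.restrict_univ,
    ← ofReal_integral_eq_lintegral_ofReal (hT.integrable_composedDensity ht)
      (ae_of_all _ fun x => (hT.composedDensity_pos ht x).le), h1, ENNReal.ofReal_one]

lemma charFun_composedLaw (hT : IsIndepStableThirdFamily P T) (ht : 0 < t) (β : ℝ) :
    charFun (composedLaw P (iteratedTime T t)) β = Complex.exp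
      (-((t * |β| ^ (1 / 3 ^ n : ℝ) : ℝ) : ℂ) *
        ((Real.cos (Real.pi / (2 * 3 ^ (n + 1))) : ℂ) +
          Complex.I * (Real.sign β : ℂ) * (Real.sin (Real.pi / (2 * 3 ^ (n + 1))) : ℂ))) := by
  have hpi := Real.pi_pos
  rw [charFun_apply_real, composedLaw, integral_withDensity_eq_integral_toReal_smul₀
    (hT.integrable_composedDensity ht).aestronglyMeasurable.aemeasurable.ennreal_ofReal
    (ae_of_all _ fun x => ENNReal.ofReal_lt_top)]
  have e : ∀ x : ℝ, (ENNReal.ofReal (composedDensity P (iteratedTime T t) x)).toReal •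
      Complex.exp (β * x * Complex.I) = Complex.exp (β * x * Complex.I) *
        (composedDensity P (iteratedTime T t) x : ℂ) := fun x => by
    rw [ENNReal.toReal_ofReal (hT.composedDensity_pos ht x).le, Complex.real_smul, mul_comm]
  simp only [e]
  rw [hT.integral_exp_mul_composedDensity ht β]
  rcases eq_or_ne β 0 with rfl | hβ
  · simp
  have hs : Real.sign β = 1 ∨ Real.sign β = -1 :=
    (lt_or_gt_of_ne hβ).elim (fun h => .inr (Real.sign_of_neg h)) fun h =>
      .inl (Real.sign_of_pos h)
  have hβs : β = Real.sign β * |β| := by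
    rcases lt_or_gt_of_ne hβ with h | h
    · rw [Real.sign_of_neg h, abs_of_neg h]; ring
    · rw [Real.sign_of_pos h, abs_of_pos h]; ring
  have hcos : ∀ a : ℝ, Real.cos (Real.sign β * a) = Real.cos a := fun a => by
    rcases hs with h | h <;> simp [h]
  have hsin : ∀ a : ℝ, Real.sin (Real.sign β * a) = Real.sign β * Real.sin a := fun a => by
    rcases hs with h | h <;> simp [h]
  have habs : 0 < |β| := abs_pos.2 hβ
  -- A logarithm of the Cauchy exponent `√3/2 |β| + iβ/2`. The `n` remaining layers divide it by
  -- `3ⁿ`, which takes the angle `π/6` to `π/(2·3^{n+1})`.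
  set l : ℂ := ((Real.log |β| : ℝ) : ℂ) + ((Real.sign β * (Real.pi / 6) : ℝ) : ℂ) * Complex.I
    with hl
  have hl2 : |l.im| < Real.pi / 2 := by
    have : l.im = Real.sign β * (Real.pi / 6) := by simp [hl]
    rw [this]
    rcases hs with h | h <;> rw [h, abs_lt] <;> constructor <;> linarith
  have hexp : ∀ c : ℝ, Complex.exp (l * c) = ((|β| ^ c : ℝ) : ℂ) *
      ((Real.cos (Real.pi / 6 * c) : ℂ) +
        Complex.I * (Real.sign β : ℂ) * (Real.sin (Real.pi / 6 * c) : ℂ)) := fun c => by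
    rw [show l * c = ((Real.log |β| * c : ℝ) : ℂ) +
      ((Real.sign β * (Real.pi / 6 * c) : ℝ) : ℂ) * Complex.I by rw [hl]; push_cast; ring,
      Complex.exp_add, Complex.exp_mul_I, ← Complex.ofReal_cos, ← Complex.ofReal_sin, hcos, hsin,
      Real.rpow_def_of_pos habs, ← Complex.ofReal_exp]
    push_cast
    ring
  have h1 : ((Real.sqrt 3 / 2 * |β| : ℝ) : ℂ) + (β / 2 : ℝ) * Complex.I = Complex.exp l := by
    have := hexp 1
    rw [Complex.ofReal_one, mul_one, mul_one, Real.rpow_one, Real.cos_pi_div_six,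
      Real.sin_pi_div_six] at this
    rw [this]
    have h2 : (β : ℂ) = Real.sign β * (|β| : ℝ) := by exact_mod_cast hβs
    push_cast
    linear_combination (Complex.I / 2) * h2
  rw [h1, hT.tail.integral_exp_neg_mul_iteratedTime ht hl2, div_eq_mul_one_div l,
    show (1 / 3 ^ n : ℂ) = ((1 / 3 ^ n : ℝ) : ℂ) by push_cast; rfl, hexp,
    show Real.pi / 6 * (1 / 3 ^ n) = Real.pi / (2 * 3 ^ (n + 1)) by
      rw [pow_succ]; field_simp; norm_num]
  push_cast
  ring_nf

end IsIndepStableThirdFamily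

end IteratedTime

/-! ### Laws with a stable characteristic function -/

lemma real_sign_mul_of_pos {a : ℝ} (ha : 0 < a) (b : ℝ) : Real.sign (a * b) = Real.sign b := by
  rcases lt_trichotomy b 0 with h | rfl | h
  · rw [Real.sign_of_neg h, Real.sign_of_neg (mul_neg_of_pos_of_neg ha h)]
  · simp
  · rw [Real.sign_of_pos h, Real.sign_of_pos (mul_pos ha h)]

section StableCharFun

variable {μ : Measure ℝ} {t α C S : ℝ}

/-- The exponent is homogeneous of degree `α` under positive scaling, so the law is strictly stable:
the shift `d` is `0`. Absolute continuity excludes point masses. -/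
lemma isStableOfIndex_of_charFun [IsProbabilityMeasure μ] (hμ : μ ≪ volume) (hα : 0 < α)
    (h : ∀ β : ℝ, charFun μ β = Complex.exp (-((t * |β| ^ α : ℝ) : ℂ) *
      ((C : ℂ) + Complex.I * (Real.sign β : ℂ) * (S : ℂ)))) : IsStableOfIndex μ α := by
  refine ⟨inferInstance, fun x hx => ?_, fun a b ha hb => ⟨0, ?_⟩⟩
  · have h0 : μ {x} = 0 := hμ (measure_singleton x)
    rw [hx] at h0
    simp at h0
  · have hab : 0 < a ^ α + b ^ α := by positivity
    simp only [add_zero]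
    have := Measure.isProbabilityMeasure_map (μ := μ) (f := fun x : ℝ => a * x) (by fun_prop)
    have := Measure.isProbabilityMeasure_map (μ := μ) (f := fun x : ℝ => b * x) (by fun_prop)
    have := Measure.isProbabilityMeasure_map (μ := μ)
      (f := fun x : ℝ => (a ^ α + b ^ α) ^ (1 / α) * x) (by fun_prop)
    refine Measure.ext_of_charFun (funext fun β => ?_)
    have hp : 0 < (a ^ α + b ^ α) ^ (1 / α) := by positivity
    rw [charFun_conv, charFun_map_mul, charFun_map_mul, charFun_map_mul, h, h, h,
      ← Complex.exp_add, real_sign_mul_of_pos ha, real_sign_mul_of_pos hb,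
      real_sign_mul_of_pos hp, abs_mul, abs_mul, abs_mul, abs_of_pos ha, abs_of_pos hb,
      abs_of_pos hp, Real.mul_rpow ha.le (abs_nonneg _), Real.mul_rpow hb.le (abs_nonneg _),
      Real.mul_rpow hp.le (abs_nonneg _), ← Real.rpow_mul hab.le, one_div_mul_cancel hα.ne',
      Real.rpow_one]
    push_cast
    ring_nf

lemma map_neg_ne_of_charFun (ht : 0 < t) (hα : 0 < α) (hS : 0 < S) (hSpi : S < Real.pi)
    (h : ∀ β : ℝ, charFun μ β = Complex.exp (-((t * |β| ^ α : ℝ) : ℂ) *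
      ((C : ℂ) + Complex.I * (Real.sign β : ℂ) * (S : ℂ)))) : μ.map (fun x => -x) ≠ μ := by
  intro hsymm
  -- At this point `t |β|^α = 1`, so the characteristic function at `±β` has imaginary part `∓e^{-C}
  -- sin S`; symmetry would force `sin S = 0`.
  set β : ℝ := (1 / t) ^ (1 / α)
  have hβ : 0 < β := by positivity
  have hβα : t * |β| ^ α = 1 := by
    rw [abs_of_pos hβ, ← Real.rpow_mul (by positivity), one_div_mul_cancel hα.ne', Real.rpow_one]
    field_simp
  have h1 : charFun μ (-β) = charFun μ β := by
    conv_rhs => rw [← hsymm]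
    have := charFun_map_mul (μ := μ) (-1) β
    simpa using this.symm
  rw [h, h, abs_neg, hβα, Real.sign_of_pos hβ, Real.sign_of_neg (neg_neg_of_pos hβ)] at h1
  have h2 := congrArg Complex.im h1
  simp only [Complex.exp_im] at h2
  simp at h2
  have h3 := Real.sin_pos_of_pos_of_lt_pi hS hSpi
  have h4 := Real.exp_pos (-C)
  nlinarith

end StableCharFun

/-- The tangent is increasing on `[0, π/2)`, and `n ≥ 2` keeps the larger angle strictly below
`π/2`; at `n = 1` the denominator would be `tan(π/2)`. -/
lemma asymmetryRatio_mem_Ioo {n : ℕ} (hn : 2 ≤ n) :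
    0 < asymmetryRatio n ∧ asymmetryRatio n < 1 := by
  have hpi := Real.pi_pos
  obtain ⟨k, rfl⟩ := Nat.exists_eq_add_of_le hn
  have h3 : (1 : ℝ) ≤ 3 ^ k := one_le_pow₀ (by norm_num)
  have e1 : Real.pi / (2 * 3 ^ (2 + k)) = Real.pi / (18 * 3 ^ k) := by rw [pow_add]; ring_nf
  have e2 : Real.pi / (2 * 3 ^ (2 + k - 1)) = Real.pi / (6 * 3 ^ k) := by
    rw [show 2 + k - 1 = 1 + k by omega, pow_add]; ring_nf
  have hlt : Real.pi / (18 * 3 ^ k) < Real.pi / (6 * 3 ^ k) := by gcongr; norm_num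
  have hle : Real.pi / (6 * 3 ^ k) < Real.pi / 2 := by gcongr; linarith
  have h0 : 0 < Real.pi / (18 * 3 ^ k) := by positivity
  have t0 := Real.tan_pos_of_pos_of_lt_pi_div_two h0 (hlt.trans hle)
  have t1 := Real.tan_lt_tan_of_lt_of_lt_pi_div_two (by linarith) hle hlt
  rw [asymmetryRatio, e1, e2]
  exact ⟨div_pos t0 (t0.trans t1), (div_lt_one (t0.trans t1)).2 t1⟩

/-! ### The law of `Z_n(t)` and its stable parameters. -/

theorem theorem2p5 {Ω : Type*} [MeasurableSpace Ω] (P : Measure Ω) [IsProbabilityMeasure P]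
    (n : ℕ) (hn : 1 ≤ n) (T : Fin n → ℝ → Ω → ℝ) (hT : IsIndepStableThirdFamily P T)
    (t : ℝ) (ht : 0 < t) :
    -- the kernel of `X₃` is the fundamental solution of the third-order heat equation
    IsThirdOrderFundamentalSolution thirdOrderKernel ∧
    -- `Z_n(t)` is a genuine random variable, spread on the whole line
    (∀ᵐ ω ∂P, 0 < iteratedTime T t ω) ∧
    (∀ x : ℝ, Integrable (fun ω => thirdOrderKernel x (iteratedTime T t ω)) P) ∧
    (∀ x : ℝ, 0 < composedDensity P (iteratedTime T t) x) ∧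
    Integrable (composedDensity P (iteratedTime T t)) volume ∧
    IsProbabilityMeasure (composedLaw P (iteratedTime T t)) ∧
    -- its characteristic function, in both forms
    (∀ β : ℝ, charFun (composedLaw P (iteratedTime T t)) β = Complex.exp
      (-((t * |β| ^ (1 / 3 ^ (n - 1) : ℝ) : ℝ) : ℂ) *
        ((Real.cos (Real.pi / (2 * 3 ^ n)) : ℂ) +
          Complex.I * (Real.sign β : ℂ) * (Real.sin (Real.pi / (2 * 3 ^ n)) : ℂ)))) ∧
    (∀ β : ℝ, charFun (composedLaw P (iteratedTime T t)) β = Complex.exp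
      (-((t * |β| ^ (1 / 3 ^ (n - 1) : ℝ) * Real.cos (Real.pi / (2 * 3 ^ n)) : ℝ) : ℂ) *
        (1 + Complex.I * (Real.sign β : ℂ) * (Real.tan (Real.pi / (2 * 3 ^ n)) : ℂ)))) ∧
    -- it is an asymmetric stable random variable of index `3^{1-n}`
    IsStableOfIndex (composedLaw P (iteratedTime T t)) (1 / 3 ^ (n - 1)) ∧
    (composedLaw P (iteratedTime T t)).map (fun x => -x) ≠ composedLaw P (iteratedTime T t) ∧
    -- its parameters; a negative skewness means skewed to the left
    (2 ≤ n → 0 < asymmetryRatio n ∧ asymmetryRatio n < 1 ∧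
      HasStableParameters (composedLaw P (iteratedTime T t)) (1 / 3 ^ (n - 1))
        (t * Real.cos (Real.pi / (2 * 3 ^ n))) (-asymmetryRatio n) 0) ∧
    (n = 1 → HasStableParameters (composedLaw P (iteratedTime T t)) 1
      (t * Real.cos (Real.pi / 6)) 0 (-(t * Real.sin (Real.pi / 6)))) := by
  obtain ⟨k, rfl⟩ := Nat.exists_eq_add_of_le' hn
  have hpi := Real.pi_pos
  have hprob := hT.isProbabilityMeasure_composedLaw ht
  have hchar := hT.charFun_composedLaw ht
  have h3 : (1 : ℝ) ≤ 3 ^ k := one_le_pow₀ (by norm_num)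
  have hα : (0 : ℝ) < 1 / 3 ^ k := by positivity
  have hα1 : (1 / 3 ^ k : ℝ) ≤ 1 := by rw [div_le_one (by positivity)]; exact h3
  have hθ0 : 0 < Real.pi / (2 * 3 ^ (k + 1)) := by positivity
  have hθ1 : Real.pi / (2 * 3 ^ (k + 1)) < Real.pi / 2 := by
    gcongr
    rw [pow_succ]; linarith
  have hcos : 0 < Real.cos (Real.pi / (2 * 3 ^ (k + 1))) :=
    Real.cos_pos_of_mem_Ioo ⟨by linarith, hθ1⟩
  have hsin : 0 < Real.sin (Real.pi / (2 * 3 ^ (k + 1))) :=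
    Real.sin_pos_of_pos_of_lt_pi hθ0 (by linarith)
  have htan : ∀ β : ℝ, charFun (composedLaw P (iteratedTime T t)) β = Complex.exp
      (-((t * |β| ^ (1 / 3 ^ k : ℝ) * Real.cos (Real.pi / (2 * 3 ^ (k + 1))) : ℝ) : ℂ) *
        (1 + Complex.I * (Real.sign β : ℂ) *
          (Real.tan (Real.pi / (2 * 3 ^ (k + 1))) : ℂ))) := fun β => by
    have hs : (Real.sin (Real.pi / (2 * 3 ^ (k + 1))) : ℂ) =
        (Real.cos (Real.pi / (2 * 3 ^ (k + 1))) : ℂ) *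
          (Real.tan (Real.pi / (2 * 3 ^ (k + 1))) : ℂ) := by
      rw [← Complex.ofReal_mul, mul_comm (Real.cos _), Real.tan_mul_cos hcos.ne']
    rw [hchar β, hs]
    congr 1
    rw [Complex.ofReal_mul (t * _)]
    ring
  simp only [Nat.add_sub_cancel]
  refine ⟨isThirdOrderFundamentalSolution_thirdOrderKernel, hT.ae_pos_iteratedTime ht,
    hT.integrable_thirdOrderKernel_iteratedTime ht, hT.composedDensity_pos ht,
    hT.integrable_composedDensity ht, hprob, hchar, htan,
    isStableOfIndex_of_charFun (withDensity_absolutelyContinuous _ _) hα hchar,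
    map_neg_ne_of_charFun ht hα hsin
      ((Real.sin_le_one _).trans_lt (by linarith [Real.pi_gt_three])) hchar,
    fun hk => ?_, fun hk => ?_⟩
  · obtain ⟨ha0, ha1⟩ := asymmetryRatio_mem_Ioo hk
    refine ⟨ha0, ha1, hprob, ⟨hα, by linarith⟩, by positivity, ⟨by linarith, by linarith⟩,
      fun _ β => ?_, fun h1 => ?_⟩
    · have htan2 : 0 < Real.tan (Real.pi * (1 / 3 ^ k) / 2) := by
        refine Real.tan_pos_of_pos_of_lt_pi_div_two (by positivity) ?_
        have : (1 / 3 ^ k : ℝ) < 1 := by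
          rw [div_lt_one (by positivity)]
          exact one_lt_pow₀ (by norm_num) (by omega)
        nlinarith
      -- With `α = 3^{-k}` the factor `tan(πα/2)` of the parametrization is the denominator of the
      -- ratio, so their product is the tangent in `htan`.
      have hr : asymmetryRatio (k + 1) * Real.tan (Real.pi * (1 / 3 ^ k) / 2) =
          Real.tan (Real.pi / (2 * 3 ^ (k + 1))) := by
        rw [asymmetryRatio, Nat.add_sub_cancel,
          show Real.pi / (2 * 3 ^ k) = Real.pi * (1 / 3 ^ k) / 2 by field_simp,
          div_mul_cancel₀ _ htan2.ne']
      rw [htan β, ← hr]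
      congr 1
      push_cast
      ring
    · exfalso
      have : (1 / 3 ^ k : ℝ) < 1 := by
        rw [div_lt_one (by positivity)]
        exact one_lt_pow₀ (by norm_num) (by omega)
      linarith
  · obtain rfl : k = 0 := by omega
    refine ⟨hprob, ⟨one_pos, one_le_two⟩, ?_, ⟨by norm_num, by norm_num⟩,
      fun h => absurd rfl h, fun _ β => ?_⟩
    · rw [Real.cos_pi_div_six]; positivity
    -- At `α = 1` the sine term is linear in `β`, since `|β| sgn β = β`, and becomes a location
    -- instead of a skewness.
    · have hβ : (β : ℂ) = (|β| : ℝ) * (Real.sign β : ℂ) := by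
        rcases lt_trichotomy β 0 with h | rfl | h
        · rw [Real.sign_of_neg h, abs_of_neg h]; push_cast; ring
        · simp
        · rw [Real.sign_of_pos h, abs_of_pos h]; simp
      rw [hchar β, show Real.pi / (2 * 3 ^ (0 + 1)) = Real.pi / 6 by norm_num, pow_zero, div_one,
        Real.rpow_one]
      congr 1
      rw [zero_mul, zero_mul, zero_mul, Complex.ofReal_zero, Complex.ofReal_mul _ β, hβ]
      simp only [Complex.ofReal_mul, Complex.ofReal_neg]
      ring
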